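/- Let $\Bbbk$ be an algebraically closed field of arbitrary characteristic, $V=H^0(\mathbb{P}^N,\mathcal{O}(1))^\vee\cong \Bbbk^{N+1}$, and let $\mathbb{G}(r,\mathbb{P}^N)$ be the Grassmann variety of $r$-planes in $\mathbb{P}^N$, i.e. of $(r+1)$-dimensional linear subspaces of $V$ ($\mathbb{G}(-1,\mathbb{P}^N)$ is a point), with universal family $$\mathcal{U}_{\mathbb{G}(r,\mathbb{P}^N)}=\{([L],x)\in\mathbb{G}(r,\mathbb{P}^N)\times\mathbb{P}^N \mid x\in L\}.$$ On $\mathbb{G}(n,\mathbb{P}^N)$ let $0\to\mathcal{Q}^\vee\to V\otimes\mathcal{O}\to\mathcal{S}^\vee\to 0$ be the universal sequence, with $\operatorname{rk}\mathcal{Q}^\vee=n+1$; thus $T_{\mathbb{G}(n,\mathbb{P}^N)}=\mathcal{H}om(\mathcal{Q}^\vee,\mathcal{S}^\vee)$, and $\mathcal{U}=\mathcal{U}_{\mathbb{G}(n,\mathbb{P}^N)}$ carries the tautological line subbundle $\mathcal{O}_{\mathcal{U}}(-1)\subset \mathrm{pr}_1^*\mathcal{Q}^\vee$, whose fibre at $([L],x)$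 is the line of $V$ corresponding to $x$. For an $n$-dimensional projective variety $X\subset\mathbb{P}^N$, the graph of its Gauss map $\gamma_X$ is the closure in $\mathbb{G}(n,\mathbb{P}^N)\times\mathbb{P}^N$ of the set of all $([\mathbb{T}_xX],x)$, where $x$ is a smooth point of $X$ and $\mathbb{T}_xX\subset\mathbb{P}^N$ is the embedded tangent space. Let $X'\subset\mathbb{G}(n,\mathbb{P}^N)\times\mathbb{P}^N$ be an $n$-dimensional projective variety contained in $\mathcal{U}$, with projections $\mathrm{pr}_1,\mathrm{pr}_2$, such that $\mathrm{pr}_2:X'\to\mathbb{P}^N$ is generically finite and separable onto its image (i.e. the rank of $d\,\mathrm{pr}_2$ at a general point of $X'$ equals $\dim \mathrm{pr}_2(X')$). On the smooth locus of $X'$ let $$\Phi:\mathrm{pr}_1^*\mathcal{Q}^\vee\to\mathcal{H}om(T_{X'},\mathrm{pr}_1^*\mathcal{S}^\vee)$$ be the homomorphism corresponding to the differential $d\,\mathrm{pr}_1:T_{X'}\to\mathrm{pr}_1^*\mathcal{H}om(\mathcal{Q}^\vee,\mathcal{S}^\vee)$. Let $n^-+1$ (with $-1\le n^-\le n$) be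 the dimension of the kernel of $\Phi$ at a general point of $X'$, and let the shrinking map $\sigma:X'\dashrightarrow\mathbb{G}(n^-,\mathbb{P}^N)$ be the rational map defined by the subbundle $\ker\Phi\subset V\otimes\mathcal{O}$ on a nonempty open set of smooth points, i.e. $\sigma(z)=[\ker\Phi_z]$. Then the following are equivalent: (i) $X'$ is the graph of the Gauss map $\gamma_X$ of some $n$-dimensional projective variety $X\subset\mathbb{P}^N$; (ii) the composite $\mathcal{O}_{\mathcal{U}}(-1)|_{X'}\hookrightarrow\mathrm{pr}_1^*\mathcal{Q}^\vee\xrightarrow{\ \Phi\ }\mathcal{H}om(T_{X'},\mathrm{pr}_1^*\mathcal{S}^\vee)$ is zero on a nonempty open subset of smooth points of $X'$; (iii) the image of $(\sigma,\mathrm{pr}_2):X'\dashrightarrow\mathbb{G}(n^-,\mathbb{P}^N)\times\mathbb{P}^N$ is contained in the universal family $\mathcal{U}_{\mathbb{G}(n^-,\mathbb{P}^N)}$. -/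

import Mathlib

open scoped LinearAlgebra.Projectivization

noncomputable section

namespace GaussGraph

/-! ### Zariski topology, general points, Zariski tangent spaces in affine space -/

/-- The Zariski topology on the affine space `ι → k`: the closed sets are the common zero sets of
families of polynomials. -/
abbrev zariski (k : Type*) [Field k] (ι : Type*) : TopologicalSpace (ι → k) :=
  TopologicalSpace.induced (MvPolynomial.pointToPoint (k := k) (K := k)) inferInstance

/-- `P` holds at a general point of `Z`, i.e. on a nonempty (relatively) open subset of `Z`. -/
def ForGeneral {M : Type*} [TopologicalSpace M] (Z : Set M) (P : M → Prop) : Prop :=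
  ∃ U : Set M, IsOpen U ∧ (Z ∩ U).Nonempty ∧ ∀ z ∈ Z ∩ U, P z

/-- The differential `w ↦ ∑ i, (∂f/∂x_i)(p) * w_i` of a polynomial `f` at the point `p`. -/
def polyDifferential {k : Type*} [Field k] {ι : Type*} [Fintype ι] (f : MvPolynomial ι k)
    (p : ι → k) : (ι → k) →ₗ[k] k :=
  ∑ i, (MvPolynomial.eval p (MvPolynomial.pderiv i f)) • LinearMap.proj i

/-- The Zariski tangent space at `p` of a (locally closed) subset `S` of affine space: the vectors
killed by the differentials of all polynomials vanishing on `S`. -/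
def affineTangent {k : Type*} [Field k] {ι : Type*} [Fintype ι] (S : Set (ι → k)) (p : ι → k) :
    Submodule k (ι → k) :=
  ⨅ f ∈ MvPolynomial.vanishingIdeal k S, LinearMap.ker (polyDifferential f p)

/-! ### Projective space and Grassmannians -/

/-- The vector space `k^(N+1)`, i.e. the dual of `H⁰(ℙ^N, 𝒪(1))`. -/
abbrev Vec (k : Type*) (N : ℕ) := Fin (N + 1) → k

/-- The closed points of `ℙ^N`: lines in `k^(N+1)`. -/
def ProjSpace (k : Type*) [Field k] (N : ℕ) := ℙ k (Vec k N)

/-- The line in `k^(N+1)` given by a point of `ℙ^N`. -/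
def ProjSpace.line {k : Type*} [Field k] {N : ℕ} (x : ProjSpace k N) : Submodule k (Vec k N) :=
  Projectivization.submodule x

/-- The closed points of the Grassmann variety of `r`-dimensional linear subspaces of `k^(N+1)`,
i.e. of `(r-1)`-planes in `ℙ^N`. Thus `𝔾(n, ℙ^N)` is `Grass k (n + 1) N`. -/
abbrev Grass (k : Type*) [Field k] (r N : ℕ) :=
  {W : Submodule k (Vec k N) // Module.finrank k W = r}

/-- The closed points of the product of `Grass k r N` with `ℙ^N`. -/
def GrassProj (k : Type*) [Field k] (r N : ℕ) := Grass k r N × ProjSpace k N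

/-- First projection `pr₁`. -/
def pr1 {k : Type*} [Field k] {r N : ℕ} (z : GrassProj k r N) : Grass k r N := z.1

/-- Second projection `pr₂`. -/
def pr2 {k : Type*} [Field k] {r N : ℕ} (z : GrassProj k r N) : ProjSpace k N := z.2

/-- The universal family `𝒰 = {([L], x) | x ∈ L}`. -/
def universalFamily (k : Type*) [Field k] (r N : ℕ) : Set (GrassProj k r N) :=
  {z | (pr2 z).line ≤ (pr1 z).1}

/-- The nonzero vectors of `k^(N+1)`. -/
abbrev Punctured (k : Type*) [Field k] (N : ℕ) := {v : Vec k N // v ≠ 0}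

/-- The point of `ℙ^N` with given homogeneous coordinates. -/
def toProj {k : Type*} [Field k] {N : ℕ} (v : Punctured k N) : ProjSpace k N :=
  Projectivization.mk k v.1 v.2

/-- Pairs of a basis `(A_1, …, A_r)` of an `r`-dimensional subspace of `k^(N+1)` and a nonzero
vector. -/
abbrev Frame (k : Type*) [Field k] (r N : ℕ) :=
  {p : (Fin r → Vec k N) × Vec k N // LinearIndependent k p.1 ∧ p.2 ≠ 0}

/-- The entries of a list of `r` vectors and one further vector, as a point of affine space. -/
def coords {k : Type*} {r N : ℕ} (A : Fin r → Vec k N) (v : Vec k N) :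
    (Fin r × Fin (N + 1)) ⊕ Fin (N + 1) → k :=
  Sum.elim (fun ij => A ij.1 ij.2) v

/-- The point `(⟨A_1, …, A_r⟩, [v])` defined by a frame. -/
def toGrassProj {k : Type*} [Field k] {r N : ℕ} (p : Frame k r N) : GrassProj k r N :=
  (⟨Submodule.span k (Set.range p.1.1), by
    rw [finrank_span_eq_card p.2.1, Fintype.card_fin]⟩, toProj ⟨p.1.2, p.2.2⟩)

/-- The Zariski topology on `ℙ^N`, as the quotient of `k^(N+1) ∖ {0}`: a set is closed iff it is
the zero set of polynomials (equivalently, of homogeneous ones) in the homogeneous coordinates. -/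
instance {k : Type*} [Field k] {N : ℕ} : TopologicalSpace (ProjSpace k N) :=
  TopologicalSpace.coinduced toProj
    (TopologicalSpace.induced (fun v : Punctured k N => v.1) (zariski k _))

/-- The Zariski topology on `Grass × ℙ^N` (this is not the product topology), as the quotient of the
space of frames, which is open in affine space and is a torsor under `GL_r × 𝔾_m` over
`Grass × ℙ^N`. -/
instance {k : Type*} [Field k] {r N : ℕ} : TopologicalSpace (GrassProj k r N) :=
  TopologicalSpace.coinduced toGrassProj
    (TopologicalSpace.induced (fun p : Frame k r N => coords p.1.1 p.1.2) (zariski k _))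

/-- `Z` is a `d`-dimensional projective variety: an irreducible Zariski closed set of Krull
dimension `d` (in the induced topology). -/
def IsProjVariety {M : Type*} [TopologicalSpace M] (Z : Set M) (d : ℕ) : Prop :=
  IsClosed Z ∧ IsIrreducible Z ∧ topologicalKrullDim Z = d

/-! ### The Gauss map of a projective variety -/

section Gauss

variable {k : Type*} [Field k] {N : ℕ}

/-- The punctured affine cone over `X ⊆ ℙ^N`. -/
def cone (X : Set (ProjSpace k N)) : Set (Vec k N) :=
  {v | ∃ h : v ≠ 0, toProj ⟨v, h⟩ ∈ X}

/-- The embedded tangent space `𝕋_x X ⊆ ℙ^N`, as a linear subspace of `k^(N+1)`: the tangent space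
of the affine cone at any nonzero vector `v` of the line `x` (it does not depend on `v`). -/
def embTangent (X : Set (ProjSpace k N)) (x : ProjSpace k N) : Submodule k (Vec k N) :=
  ⨅ (v : Punctured k N) (_ : toProj v = x), affineTangent (cone X) v.1

/-- The smooth points of a `d`-dimensional projective variety `X ⊆ ℙ^N`. -/
def smoothLocus (X : Set (ProjSpace k N)) (d : ℕ) : Set (ProjSpace k N) :=
  {x ∈ X | Module.finrank k (embTangent X x) = d + 1}

/-- The Gauss map `γ_X`, sending a smooth point `x` of `X` to `𝕋_x X`. -/
def gaussMap (X : Set (ProjSpace k N)) (n : ℕ) (x : smoothLocus X n) : Grass k (n + 1) N :=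
  ⟨embTangent X x, x.2.2⟩

/-- The graph of the Gauss map: the closure of the image of `(γ_X, id_X)`. -/
def gaussGraph (X : Set (ProjSpace k N)) (n : ℕ) : Set (GrassProj k (n + 1) N) :=
  closure (Set.range fun x : smoothLocus X n =>
    ((gaussMap X n x, x.1) : GrassProj k (n + 1) N))

end Gauss

/-! ### Tangent spaces of subvarieties of `Grass × ℙ^N`, the map `Φ`, and the shrinking map -/

section Shrinking

variable {k : Type*} [Field k] {r N : ℕ}

/-- The tangent space `Hom(W, V/W)` of the Grassmannian at `W ⊆ V`: the fibre at `W` of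
`Hom(𝒬^∨, 𝒮^∨)`. -/
abbrev TGrass (W : Submodule k (Vec k N)) := W →ₗ[k] (Vec k N ⧸ W)

/-- All frames lying over the points of `Z`. -/
def frames (Z : Set (GrassProj k r N)) : Set ((Fin r × Fin (N + 1)) ⊕ Fin (N + 1) → k) :=
  {q | ∃ p : Frame k r N, toGrassProj p ∈ Z ∧ q = coords p.1.1 p.1.2}

/-- The Zariski tangent space at `z = (W, ℓ)` of `Z ⊆ Grass × ℙ^N`, as a subspace of
`Hom(W, V/W) × Hom(ℓ, V/ℓ)`. A velocity `(A', v')` at a frame `(A, v)` of `(W, ℓ)` projects to the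
pair `(φ, ψ)` with `φ A_i = A'_i mod W` and `ψ v = v' mod ℓ`; the tangent space of `Z` at `z` is the
image of the tangent space at `(A, v)` of the set of frames over `Z` (it does not depend on the
frame, as the frames over `Z` form a torsor over `Z` under `GL_r × 𝔾_m`). -/
def tangent (Z : Set (GrassProj k r N)) (z : GrassProj k r N) :
    Submodule k (TGrass (pr1 z).1 × TGrass (pr2 z).line) where
  carrier := {t | ∀ (A : Fin r → (pr1 z).1) (v : (pr2 z).line), LinearIndependent k A → v ≠ 0 →
    ∃ (A' : Fin r → Vec k N) (v' : Vec k N),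
      (∀ i, t.1 (A i) = Submodule.Quotient.mk (A' i)) ∧ t.2 v = Submodule.Quotient.mk v' ∧
      coords A' v' ∈ affineTangent (frames Z) (coords (fun i => (A i : Vec k N)) v)}
  zero_mem' := by
    intro A v _ _
    refine ⟨0, 0, fun i => by simp, by simp, ?_⟩
    have : coords (0 : Fin r → Vec k N) (0 : Vec k N) = 0 := by
      ext i; rcases i with i | i <;> rfl
    rw [this]; exact Submodule.zero_mem _
  add_mem' := by
    intro s t hs ht A v hA hv
    obtain ⟨A₁, v₁, h₁, h₁', h₁''⟩ := hs A v hA hv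
    obtain ⟨A₂, v₂, h₂, h₂', h₂''⟩ := ht A v hA hv
    refine ⟨A₁ + A₂, v₁ + v₂, fun i => by simp [h₁ i, h₂ i], by simp [h₁', h₂'], ?_⟩
    have : coords (A₁ + A₂) (v₁ + v₂) = coords A₁ v₁ + coords A₂ v₂ := by
      ext i; rcases i with i | i <;> rfl
    rw [this]; exact Submodule.add_mem _ h₁'' h₂''
  smul_mem' := by
    intro c s hs A v hA hv
    obtain ⟨A₁, v₁, h₁, h₁', h₁''⟩ := hs A v hA hv
    refine ⟨c • A₁, c • v₁, fun i => by simp [h₁ i], by simp [h₁'], ?_⟩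
    have : coords (c • A₁) (c • v₁) = c • coords A₁ v₁ := by
      ext i; rcases i with i | i <;> rfl
    rw [this]; exact Submodule.smul_mem _ c h₁''

/-- The smooth points of a `d`-dimensional projective variety `Z ⊆ Grass × ℙ^N`. -/
def smoothPoints (Z : Set (GrassProj k r N)) (d : ℕ) : Set (GrassProj k r N) :=
  {z ∈ Z | Module.finrank k (tangent Z z) = d}

/-- The differential of `pr₁ : Z → Grass` at `z`. -/
def dpr1 (Z : Set (GrassProj k r N)) (z : GrassProj k r N) :
    tangent Z z →ₗ[k] TGrass (pr1 z).1 :=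
  LinearMap.fst k _ _ ∘ₗ (tangent Z z).subtype

/-- The differential of `pr₂ : Z → ℙ^N` at `z`. -/
def dpr2 (Z : Set (GrassProj k r N)) (z : GrassProj k r N) :
    tangent Z z →ₗ[k] TGrass (pr2 z).line :=
  LinearMap.snd k _ _ ∘ₗ (tangent Z z).subtype

/-- `pr₂ : Z → ℙ^N` is separable (onto its image): the rank of its differential at a general point
is the dimension of the image. -/
def IsSeparablePr2 (Z : Set (GrassProj k r N)) : Prop :=
  ForGeneral Z fun z =>
    (Module.finrank k (LinearMap.range (dpr2 Z z)) : WithBot ℕ∞) = topologicalKrullDim (pr2 '' Z)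

/-- `pr₂ : Z → ℙ^N` is generically finite: its fibre over a general point of the image is finite. -/
def IsGenericallyFinitePr2 (Z : Set (GrassProj k r N)) : Prop :=
  ForGeneral (pr2 '' Z) fun x => {z ∈ Z | pr2 z = x}.Finite

/-- The fibre at `z` of `Φ : pr₁^* 𝒬^∨ → Hom(T_Z, pr₁^* 𝒮^∨)`: it sends `w ∈ W` to the composite of
`d pr₁ : T_z Z → Hom(W, V/W)` with evaluation at `w`. -/
def Phi (Z : Set (GrassProj k r N)) (z : GrassProj k r N) :
    (pr1 z).1 →ₗ[k] tangent Z z →ₗ[k] (Vec k N ⧸ (pr1 z).1) :=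
  (dpr1 Z z).flip

/-- The inclusion, at a point `z` of the universal family, of the fibre of `𝒪_𝒰(-1)` (the line `pr₂ z`)
into the fibre of `pr₁^* 𝒬^∨` (the subspace `pr₁ z`). -/
def tautIncl (z : GrassProj k r N) (hz : z ∈ universalFamily k r N) :
    (pr2 z).line →ₗ[k] (pr1 z).1 :=
  Submodule.inclusion hz

/-- `n⁻ + 1`: the dimension of `ker Φ` at a general point of `Z` (for irreducible `Z` there is exactly
one number with the property below). -/
def shrinkRank (Z : Set (GrassProj k r N)) : ℕ :=
  sInf {m | ForGeneral Z fun z => Module.finrank k (LinearMap.ker (Phi Z z)) = m}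

/-- The open set of smooth points of the `d`-dimensional variety `Z` on which the shrinking map is
defined. -/
def shrinkDomain (Z : Set (GrassProj k r N)) (d : ℕ) : Set (GrassProj k r N) :=
  {z ∈ smoothPoints Z d | Module.finrank k (LinearMap.ker (Phi Z z)) = shrinkRank Z}

/-- The shrinking map `σ_{Z, pr₁} : Z ⇢ 𝔾(n⁻, ℙ^N)`, `z ↦ ker Φ_z ⊆ k^(N+1)`. -/
def shrinkingMap (Z : Set (GrassProj k r N)) (d : ℕ) (z : shrinkDomain Z d) :
    Grass k (shrinkRank Z) N :=
  ⟨(LinearMap.ker (Phi Z z.1)).map (pr1 z.1).1.subtype, by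
    rw [Submodule.finrank_map_subtype_eq]; exact z.2.2⟩

end Shrinking

end GaussGraph

end

/-! ### Commutative algebra: dimension, transcendence degree, Chevalley's theorem. -/

section

open MvPolynomial Algebra Topology

/-! Represent a point of `X'` by a frame `(A, v)`: `A` is a basis of `W = pr₁ z`, and `v` spans the
line `ℓ = pr₂ z`. As `ℓ ⊆ W`, one has `v = ∑ cᵢ Aᵢ`. Differentiating along a tangent vector gives
`v' = ∑ cᵢ' Aᵢ + ∑ cᵢ Aᵢ'`, so the value of `Φ(v)` on that vector is `v'` modulo `W`. Hence `Φ`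
kills `ℓ` exactly when all velocities `v'` lie in `W` (`Phi_comp_tautIncl_eq_zero_iff`).

(i) ⇒ (ii): at a general point of the graph, `W` is the tangent space of the cone over `X`
(`forGeneral_eq_embTangent_of_gaussGraph`), and every `v'` is tangent to that cone.

(ii) ⇒ (i): take for `X` the closure of `pr₂ X'`. Generic finiteness gives `dim X = n`. By
separability the normalized velocities `v'` at a general point fill an `n`-dimensional space `R`
with `R ∩ ℓ = 0`. Then `R + ℓ` lies both in `W` and in the tangent space of the cone, and all three
have dimension `n + 1`, so they agree (`forGeneral_eq_embTangent`). Thus a general point of `X'`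
lies on the graph, hence all of `X'` does (`subset_gaussGraph`). Conversely the tangent space varies
algebraically over the smooth locus of `X`, so the closed set `X'` contains the graph
(`gaussGraph_subset`).

(ii) ⇔ (iii): pointwise, (iii) says `ℓ ⊆ ker Φ`, but over the whole domain of `σ`. The vanishing in
(ii) spreads from general points to all smooth points, because the tangent spaces there have
polynomial frames (`Phi_comp_tautIncl_eq_zero_of_smooth`). Conversely a general point lies in the
domain of `σ`, since the rank of `ker Φ` is generically constant (`forGeneral_mem_shrinkDomain`).

All of this is computed on affine slices (`AffineSlice`): closed sets of normalized frames,
homeomorphic to open pieces of the variety. There the dimension is a transcendence degree, a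
separating transcendence basis bounds the general tangent space, and Chevalley's theorem controls
images under `pr₂`. -/

theorem Algebra.IsIntegral.ringKrullDim_eq {A B : Type*} [CommRing A] [CommRing B] [IsDomain A]
    [IsDomain B] [Algebra A B] [Algebra.IsIntegral A B]
    (hinj : Function.Injective (algebraMap A B)) : ringKrullDim B = ringKrullDim A := by
  apply le_antisymm
  -- Incomparability: contraction of primes along an integral extension is strictly monotone.
  · refine Order.krullDim_le_of_strictMono (PrimeSpectrum.comap (algebraMap A B)) ?_
    intro P Q h
    exact Ideal.IsIntegral.comap_lt_comap (I := P.asIdeal) (J := Q.asIdeal) h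
  -- Lying over lifts the smallest prime of a chain, and going up lifts the rest.
  · refine iSup_le fun l => ?_
    let l' : LTSeries (PrimeSpectrum A) := l
    have : FaithfulSMul A B := (faithfulSMul_iff_algebraMap_injective A B).mpr hinj
    obtain ⟨P, hP, hlo⟩ := Ideal.exists_ideal_over_prime_of_isIntegral_of_isDomain (S := B)
      (RelSeries.head l).asIdeal (by
        rw [(RingHom.injective_iff_ker_eq_bot _).mp hinj]; exact bot_le)
    have : P.LiesOver (RelSeries.head l).asIdeal := ⟨hlo.symm⟩
    obtain ⟨L, hL, -⟩ := Ideal.exists_ltSeries_of_hasGoingUp l P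
    rw [← hL]
    exact Order.LTSeries.length_le_krullDim L

/-- By Noether normalization both sides are the number of variables of a polynomial ring over which
`R` is integral. The transcendence degree is therefore finite and `toNat` loses nothing. -/
theorem ringKrullDim_eq_trdeg (k : Type*) {R : Type*} [Field k] [CommRing R] [IsDomain R]
    [Algebra k R] [Algebra.FiniteType k R] :
    ringKrullDim R = ((Algebra.trdeg k R).toNat : ℕ) := by
  obtain ⟨s, g, hg, hint⟩ := exists_integral_inj_algHom_of_fg k R
  let : Algebra (MvPolynomial (Fin s) k) R := g.toRingHom.toAlgebra
  have : IsScalarTower k (MvPolynomial (Fin s) k) R := IsScalarTower.of_algHom g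
  have : Algebra.IsIntegral (MvPolynomial (Fin s) k) R := ⟨hint⟩
  have : FaithfulSMul (MvPolynomial (Fin s) k) R :=
    (faithfulSMul_iff_algebraMap_injective _ _).mpr hg
  rw [Algebra.IsIntegral.ringKrullDim_eq (A := MvPolynomial (Fin s) k) hg,
    MvPolynomial.ringKrullDim_of_isNoetherianRing, ringKrullDim_eq_zero_of_field, zero_add]
  have h := lift_trdeg_add_eq k (MvPolynomial (Fin s) k) R
  rw [trdeg_eq_zero (R := MvPolynomial (Fin s) k), Cardinal.lift_zero, add_zero,
    MvPolynomial.trdeg_of_isDomain] at h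
  have := congrArg Cardinal.toNat h
  simp at this
  simp [← this]

theorem trdeg_localization_eq (k : Type*) {R : Type*} (L : Type*) [Field k] [CommRing R]
    [IsDomain R] [Algebra k R] [CommRing L] [IsDomain L] [Algebra R L] [Algebra k L]
    [IsScalarTower k R L] (M : Submonoid R) [IsLocalization M L] (hM : M ≤ nonZeroDivisors R) :
    (Algebra.trdeg k L).toNat = (Algebra.trdeg k R).toNat := by
  have : FaithfulSMul R L :=
    (faithfulSMul_iff_algebraMap_injective _ _).mpr (IsLocalization.injective L hM)
  have : Algebra.IsAlgebraic R L := IsLocalization.isAlgebraic L M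
  have h := lift_trdeg_add_eq k R L
  rw [trdeg_eq_zero (R := R), Cardinal.lift_zero, add_zero] at h
  simpa using (congrArg Cardinal.toNat h).symm

/-- The dichotomy holds for open sets and is symmetric under complements. It survives unions because
a product of two nonzero elements of a domain is nonzero. -/
theorem PrimeSpectrum.exists_basicOpen_subset_of_isConstructible {A : Type*} [CommRing A]
    [IsDomain A] {s : Set (PrimeSpectrum A)} (hs : Topology.IsConstructible s) :
    (∃ a : A, a ≠ 0 ∧ (PrimeSpectrum.basicOpen a : Set (PrimeSpectrum A)) ⊆ s) ∨
    (∃ a : A, a ≠ 0 ∧ (PrimeSpectrum.basicOpen a : Set (PrimeSpectrum A)) ⊆ sᶜ) := by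
  induction hs using Topology.IsConstructible.empty_union_induction with
  | open_retrocompact U hU _ =>
    rcases U.eq_empty_or_nonempty with rfl | ⟨x, hx⟩
    · exact Or.inr ⟨1, one_ne_zero, by simp⟩
    · obtain ⟨_, ⟨a, rfl⟩, hxa, ha⟩ :=
        PrimeSpectrum.isTopologicalBasis_basic_opens.exists_subset_of_mem_open hx hU
      refine Or.inl ⟨a, ?_, ha⟩
      rintro rfl
      simp at hxa
  | union s hs t ht h1 h2 =>
    rcases h1 with ⟨a, ha, h⟩ | ⟨a, ha, h⟩
    · exact Or.inl ⟨a, ha, h.trans Set.subset_union_left⟩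
    · rcases h2 with ⟨b, hb, h'⟩ | ⟨b, hb, h'⟩
      · exact Or.inl ⟨b, hb, h'.trans Set.subset_union_right⟩
      · refine Or.inr ⟨a * b, mul_ne_zero ha hb, ?_⟩
        rw [PrimeSpectrum.basicOpen_mul, Set.compl_union]
        exact Set.inter_subset_inter h h'
  | compl s hs h =>
    rw [compl_compl]; exact h.symm

/-- A strong form of Chevalley's theorem on extensions of homomorphisms: a homomorphism from `A`
to an algebraically closed field which does not kill a suitable `a ≠ 0` extends to `B`. -/
theorem exists_forall_algHom_extends {k A B : Type*} [Field k] [IsAlgClosed k] [CommRing A]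
    [CommRing B] [IsDomain A] [IsDomain B] [Algebra k A] [Algebra k B] [Algebra.FiniteType k A]
    [Algebra.FiniteType k B] (f : A →ₐ[k] B) (hf : Function.Injective f) (b : B) (hb : b ≠ 0) :
    ∃ a : A, a ≠ 0 ∧ ∀ φ : A →ₐ[k] k, φ a ≠ 0 → ∃ ψ : B →ₐ[k] k, ψ.comp f = φ ∧ ψ b ≠ 0 := by
  have : IsNoetherianRing A := Algebra.FiniteType.isNoetherianRing k A
  have hfin : f.toRingHom.FinitePresentation := by
    rw [← RingHom.FinitePresentation.of_finiteType]
    refine RingHom.FiniteType.of_comp_finiteType (f := algebraMap k A) ?_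
    rw [show f.toRingHom.comp (algebraMap k A) = algebraMap k B from f.comp_algebraMap]
    exact RingHom.finiteType_algebraMap.mpr inferInstance
  -- Chevalley: the image of the locus `b ≠ 0` is constructible.
  have hc := PrimeSpectrum.isConstructible_comap_image hfin
    (s := (PrimeSpectrum.basicOpen b : Set (PrimeSpectrum B)))
    ((PrimeSpectrum.isCompact_basicOpen b).isConstructible (PrimeSpectrum.basicOpen b).2)
  obtain ⟨a, ha, h⟩ : ∃ a : A, a ≠ 0 ∧ (PrimeSpectrum.basicOpen a : Set (PrimeSpectrum A)) ⊆
      PrimeSpectrum.comap f.toRingHom '' (PrimeSpectrum.basicOpen b) := by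
    rcases PrimeSpectrum.exists_basicOpen_subset_of_isConstructible hc with h | ⟨a, ha, h⟩
    · exact h
    · exfalso
      -- By injectivity of `f` the generic point of `Spec B` maps to that of `Spec A`, so the image
      -- cannot avoid a nonempty open set.
      have h0 : (⟨⊥, Ideal.isPrime_bot⟩ : PrimeSpectrum A) ∈
          (PrimeSpectrum.basicOpen a : Set (PrimeSpectrum A)) := by simpa using ha
      refine h h0 ⟨⟨⊥, Ideal.isPrime_bot⟩, by simpa using hb, ?_⟩
      ext x
      simpa using map_eq_zero_iff f hf
  refine ⟨a, ha, fun φ hφ => ?_⟩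
  have hφmem : (⟨RingHom.ker φ, RingHom.ker_isPrime _⟩ : PrimeSpectrum A) ∈
      (PrimeSpectrum.basicOpen a : Set (PrimeSpectrum A)) := by simpa using hφ
  obtain ⟨Q, hQb, hQ⟩ := h hφmem
  -- a closed point of the fibre
  have hbQ : b ∉ Q.asIdeal := by simpa using hQb
  have : IsJacobsonRing B := isJacobsonRing_of_finiteType (A := k)
  obtain ⟨M, hM, hQM, hbM⟩ : ∃ M : Ideal B, M.IsMaximal ∧ Q.asIdeal ≤ M ∧ b ∉ M := by
    have := IsJacobsonRing.out ‹_› (Q.isPrime.isRadical)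
    by_contra! hcon
    apply hbQ
    rw [← this, Ideal.jacobson, Ideal.mem_sInf]
    rintro M ⟨h1, h2⟩
    exact hcon M h2 h1
  let : Field (B ⧸ M) := Ideal.Quotient.field M
  have : Module.Finite k (B ⧸ M) := finite_of_finite_type_of_isJacobsonRing k (B ⧸ M)
  -- Nullstellensatz: the residue field is finite over the algebraically closed field `k`, hence
  -- equal to it.
  let e : k ≃ₐ[k] (B ⧸ M) := AlgEquiv.ofBijective (Algebra.ofId k (B ⧸ M))
    IsAlgClosed.algebraMap_bijective_of_isIntegral
  let ψ : B →ₐ[k] k := e.symm.toAlgHom.comp (Ideal.Quotient.mkₐ k M)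
  have hψ : ∀ x, ψ x = 0 ↔ x ∈ M := fun x => by
    simp [ψ, Ideal.Quotient.eq_zero_iff_mem]
  refine ⟨ψ, ?_, fun h0 => hbM ((hψ b).mp h0)⟩
  ext x
  -- This element lies in `ker φ`, the contraction of `Q`, and `Q ≤ M = ker ψ`; so `ψ ∘ f` and `φ`
  -- agree at `x`.
  have hx : x - algebraMap k A (φ x) ∈ (PrimeSpectrum.comap f.toRingHom Q).asIdeal := by
    rw [hQ]; simp
  have hx' : f (x - algebraMap k A (φ x)) ∈ M := hQM hx
  rw [← hψ, map_sub, map_sub, AlgHom.commutes, AlgHom.commutes, sub_eq_zero] at hx'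
  simpa using hx'

namespace GaussGraph

/-! ### Zariski topology on affine space and dimension of irreducible sets. -/

section ZariskiTopology

variable {k : Type*} [Field k] {ι κ : Type*}

attribute [local instance] zariski

theorem mem_vanishingIdeal_iff_eval {S : Set (ι → k)} {f : MvPolynomial ι k} :
    f ∈ vanishingIdeal k S ↔ ∀ x ∈ S, eval x f = 0 := by
  simp [mem_vanishingIdeal_iff, aeval_eq_eval]

theorem isClosed_zeroSet (J : Set (MvPolynomial ι k)) :
    IsClosed {x : ι → k | ∀ f ∈ J, eval x f = 0} := by
  refine isClosed_induced_iff.mpr ⟨_, PrimeSpectrum.isClosed_zeroLocus J, ?_⟩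
  ext x
  simp [pointToPoint, PrimeSpectrum.mem_zeroLocus, Set.subset_def, aeval_eq_eval]

theorem isClosed_zariski_iff {C : Set (ι → k)} :
    IsClosed C ↔ ∃ J : Set (MvPolynomial ι k), C = {x | ∀ f ∈ J, eval x f = 0} := by
  constructor
  · intro h
    obtain ⟨D, hD, rfl⟩ := isClosed_induced_iff.mp h
    obtain ⟨J, rfl⟩ := (PrimeSpectrum.isClosed_iff_zeroLocus D).mp hD
    refine ⟨J, ?_⟩
    ext x
    simp [pointToPoint, PrimeSpectrum.mem_zeroLocus, Set.subset_def, aeval_eq_eval]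
  · rintro ⟨J, rfl⟩
    exact isClosed_zeroSet J

theorem isOpen_basic (f : MvPolynomial ι k) : IsOpen {x : ι → k | eval x f ≠ 0} := by
  have := (isClosed_zeroSet {f}).isOpen_compl
  simpa [Set.compl_def] using this

theorem exists_basic_subset {U : Set (ι → k)} (hU : IsOpen U) {x : ι → k} (hx : x ∈ U) :
    ∃ f : MvPolynomial ι k, eval x f ≠ 0 ∧ ∀ y, eval y f ≠ 0 → y ∈ U := by
  obtain ⟨J, hJ⟩ := isClosed_zariski_iff.mp hU.isClosed_compl
  have hx' : x ∉ Uᶜ := fun h => h hx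
  rw [hJ] at hx'
  simp only [Set.mem_ofPred_eq, not_forall] at hx'
  obtain ⟨f, hf, hfx⟩ := hx'
  refine ⟨f, hfx, fun y hy => ?_⟩
  by_contra hyU
  have : y ∈ Uᶜ := hyU
  rw [hJ] at this
  exact hy (this f hf)

theorem mem_closure_zariski_iff {S : Set (ι → k)} {x : ι → k} :
    x ∈ closure S ↔ ∀ f ∈ vanishingIdeal k S, eval x f = 0 := by
  constructor
  · intro h f hf
    have hc := isClosed_zeroSet {f}
    have hS : S ⊆ {x : ι → k | ∀ g ∈ ({f} : Set _), eval x g = 0} := by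
      intro y hy g hg
      rw [Set.mem_singleton_iff.mp hg]
      exact mem_vanishingIdeal_iff_eval.mp hf y hy
    exact closure_minimal hS hc h f rfl
  · intro h
    obtain ⟨J, hJ⟩ := isClosed_zariski_iff.mp (isClosed_closure (s := S))
    rw [hJ]
    intro f hf
    refine h f (mem_vanishingIdeal_iff_eval.mpr fun y hy => ?_)
    have : y ∈ closure S := subset_closure hy
    rw [hJ] at this
    exact this f hf

theorem vanishingIdeal_closure (S : Set (ι → k)) :
    vanishingIdeal k (closure S) = vanishingIdeal k S := by
  refine le_antisymm (vanishingIdeal_anti_mono subset_closure) fun f hf => ?_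
  exact mem_vanishingIdeal_iff_eval.mpr fun x hx => mem_closure_zariski_iff.mp hx f hf

theorem isIrreducible_iff_isPrime_vanishingIdeal {S : Set (ι → k)} :
    IsIrreducible S ↔ (vanishingIdeal k S).IsPrime := by
  have hind : Topology.IsInducing (pointToPoint : (ι → k) → PrimeSpectrum (MvPolynomial ι k)) :=
    ⟨rfl⟩
  rw [← vanishingIdeal_pointToPoint, ← PrimeSpectrum.isIrreducible_iff_vanishingIdeal_isPrime]
  refine ⟨fun h => h.image _ hind.continuous.continuousOn, fun h => ⟨h.1.of_image, ?_⟩⟩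
  intro u v hu hv hu' hv'
  obtain ⟨u, hu0, rfl⟩ := isOpen_induced_iff.mp hu
  obtain ⟨v, hv0, rfl⟩ := isOpen_induced_iff.mp hv
  obtain ⟨_, ⟨x, hx, rfl⟩, h1, h2⟩ := h.2 u v hu0 hv0
    (by obtain ⟨x, hx⟩ := hu'; exact ⟨_, ⟨x, hx.1, rfl⟩, hx.2⟩)
    (by obtain ⟨x, hx⟩ := hv'; exact ⟨_, ⟨x, hx.1, rfl⟩, hx.2⟩)
  exact ⟨x, hx, h1, h2⟩

theorem continuous_to_zariski {X : Type*} [TopologicalSpace X] {f : X → (ι → k)}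
    (h : ∀ g : MvPolynomial ι k, IsClosed {x | eval (f x) g = 0}) : Continuous f := by
  refine continuous_iff_isClosed.mpr fun C hC => ?_
  obtain ⟨J, rfl⟩ := isClosed_zariski_iff.mp hC
  have : f ⁻¹' {x | ∀ g ∈ J, eval x g = 0} = ⋂ g ∈ J, {x | eval (f x) g = 0} := by
    ext x; simp
  rw [this]
  exact isClosed_biInter fun g _ => h g

theorem continuous_polynomialMap (Q : κ → MvPolynomial ι k) :
    Continuous fun (x : ι → k) (j : κ) => eval x (Q j) := by
  refine continuous_to_zariski fun g => ?_
  have := isClosed_zeroSet {bind₁ Q g}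
  convert this using 1
  ext x
  simp [← aeval_eq_eval, aeval_bind₁]

theorem mem_of_forall_vanishingIdeal {S : Set (ι → k)} (hS : IsClosed S) {x : ι → k}
    (h : ∀ f ∈ vanishingIdeal k S, eval x f = 0) : x ∈ S := by
  rw [← hS.closure_eq]; exact mem_closure_zariski_iff.mpr h

theorem exists_mem_eval_ne_zero {S : Set (ι → k)} {f : MvPolynomial ι k}
    (hf : f ∉ vanishingIdeal k S) : ∃ x ∈ S, eval x f ≠ 0 := by
  by_contra! h
  exact hf (mem_vanishingIdeal_iff_eval.mpr h)

/-- The dimension of an irreducible subset of affine space: the transcendence degree of its ring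
of polynomial functions. -/
noncomputable def affDim (S : Set (ι → k)) : ℕ :=
  (Algebra.trdeg k (MvPolynomial ι k ⧸ vanishingIdeal k S)).toNat

variable [IsAlgClosed k] [Finite ι]

/-- Upper bound: the points of `S ∩ U` form a subspace of the spectrum of the coordinate ring. Lower
bound: for a basic open set `D(f) ⊆ U` meeting `S`, the primes of the localization at `f` are
recovered, by the Nullstellensatz, from their zero loci in `S ∩ U`. Localization does not change the
transcendence degree, so the bounds coincide. -/
theorem topologicalKrullDim_inter_open {S U : Set (ι → k)} (hS : IsClosed S)
    (hirr : IsIrreducible S) (hU : IsOpen U) (hne : (S ∩ U).Nonempty) :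
    topologicalKrullDim ↥(S ∩ U) = (affDim S : ℕ) := by
  have hP : (vanishingIdeal k S).IsPrime := isIrreducible_iff_isPrime_vanishingIdeal.mp hirr
  set I := vanishingIdeal k S with hI
  let R := MvPolynomial ι k ⧸ I
  apply le_antisymm
  · have hdim : topologicalKrullDim (PrimeSpectrum R) = (affDim S : ℕ) := by
      rw [PrimeSpectrum.topologicalKrullDim_eq_ringKrullDim, ringKrullDim_eq_trdeg k]; rfl
    rw [← hdim]
    have hle : ∀ x : ↥(S ∩ U), I ≤ vanishingIdeal k {x.1} := fun x =>
      vanishingIdeal_anti_mono (by simpa using x.2.1)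
    -- Each point goes to its maximal ideal in the coordinate ring.
    let F : ↥(S ∩ U) → PrimeSpectrum R := fun x =>
      ⟨(vanishingIdeal k {x.1}).map (Ideal.Quotient.mk I),
        Ideal.map_isPrime_of_surjective Ideal.Quotient.mk_surjective (by
          rw [Ideal.mk_ker]; exact hle x)⟩
    have hcomp : (PrimeSpectrum.comap (Ideal.Quotient.mk I)) ∘ F =
        (pointToPoint : (ι → k) → PrimeSpectrum (MvPolynomial ι k)) ∘ Subtype.val := by
      funext x
      ext f
      have : (Ideal.map (Ideal.Quotient.mk I) (vanishingIdeal k {x.1})).comap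
          (Ideal.Quotient.mk I) = vanishingIdeal k {x.1} := by
        rw [Ideal.comap_map_of_surjective _ Ideal.Quotient.mk_surjective,
          ← RingHom.ker_eq_comap_bot,
          Ideal.mk_ker, sup_eq_left]
        exact hle x
      exact iff_of_eq (congrArg (f ∈ ·) this)
    have hind : Topology.IsInducing F := by
      rw [← (PrimeSpectrum.isClosedEmbedding_comap_of_surjective _ (Ideal.Quotient.mk I)
        Ideal.Quotient.mk_surjective).isInducing.of_comp_iff, hcomp]
      exact Topology.IsInducing.comp ⟨rfl⟩ Topology.IsInducing.subtypeVal
    exact hind.topologicalKrullDim_le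
  · obtain ⟨x₀, hx₀S, hx₀U⟩ := hne
    obtain ⟨f, hf0, hfU⟩ := exists_basic_subset hU hx₀U
    have hfI : f ∉ I := fun h => hf0 (mem_vanishingIdeal_iff_eval.mp h x₀ hx₀S)
    let fb : R := Ideal.Quotient.mk I f
    have hfb : fb ≠ 0 := fun h => hfI (Ideal.Quotient.eq_zero_iff_mem.mp h)
    let L := Localization.Away fb
    have hle : Submonoid.powers fb ≤ nonZeroDivisors R :=
      powers_le_nonZeroDivisors_of_noZeroDivisors hfb
    have : IsDomain L := IsLocalization.isDomain_localization hle
    have hfinL : Algebra.FiniteType R L := IsLocalization.finiteType_of_monoid_fg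
      (Submonoid.powers fb) L
    have : Algebra.FiniteType k L := Algebra.FiniteType.trans (S := R) inferInstance hfinL
    have hdim : ringKrullDim L = (affDim S : ℕ) := by
      rw [ringKrullDim_eq_trdeg k, trdeg_localization_eq k (R := R) L (Submonoid.powers fb) hle]
      rfl
    rw [← hdim]
    let P : PrimeSpectrum L → Ideal (MvPolynomial ι k) := fun q =>
      (q.asIdeal.comap (algebraMap R L)).comap (Ideal.Quotient.mk I)
    have hPp : ∀ q, (P q).IsPrime := fun q => by
      have := q.isPrime
      infer_instance
    have hPf : ∀ q, f ∉ P q := fun q hq => by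
      refine q.isPrime.ne_top (Ideal.eq_top_of_isUnit_mem _ hq ?_)
      exact IsLocalization.map_units L (⟨fb, Submonoid.mem_powers fb⟩ : Submonoid.powers fb)
    have hPI : ∀ q, I ≤ P q := fun q g hg => by
      simp only [P, Ideal.mem_comap, Ideal.Quotient.eq_zero_iff_mem.mpr hg, zero_mem]
    let Y : PrimeSpectrum L → Set (ι → k) := fun q => zeroLocus k (P q) ∩ U
    have hYI : ∀ q, vanishingIdeal k (Y q) = P q := fun q => by
      apply le_antisymm
      · intro g hg
        -- Outside `U` the factor `f` vanishes, so a function vanishing only inside `U` is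
        -- controlled after multiplication by `f`.
        have : g * f ∈ vanishingIdeal k (zeroLocus k (P q)) := by
          rw [mem_vanishingIdeal_iff_eval]
          intro x hx
          by_cases hxf : eval x f = 0
          · simp [hxf]
          · rw [map_mul, mem_vanishingIdeal_iff_eval.mp hg x ⟨hx, hfU x hxf⟩, zero_mul]
        rw [IsPrime.vanishingIdeal_zeroLocus] at this
        exact ((hPp q).mem_or_mem this).resolve_right (hPf q)
      · exact (le_vanishingIdeal_zeroLocus _).trans (vanishingIdeal_anti_mono Set.inter_subset_left)
    have hYS : ∀ q, Y q ⊆ S ∩ U := fun q x hx =>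
      ⟨mem_of_forall_vanishingIdeal hS fun g hg => by
        simpa [aeval_eq_eval] using hx.1 g (hPI q hg), hx.2⟩
    have hYirr : ∀ q, IsIrreducible (Y q) := fun q => by
      rw [isIrreducible_iff_isPrime_vanishingIdeal, hYI]; exact hPp q
    -- Larger primes have smaller zero loci, hence the order dual.
    let G : PrimeSpectrum L → (TopologicalSpace.IrreducibleCloseds ↥(S ∩ U))ᵒᵈ := fun q =>
      OrderDual.toDual ⟨Subtype.val ⁻¹' Y q, by
        refine ⟨?_, ?_⟩
        · obtain ⟨x, hx⟩ := (hYirr q).1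
          exact ⟨⟨x, hYS q hx⟩, hx⟩
        · intro u v hu hv hu' hv'
          obtain ⟨u, hu0, rfl⟩ := isOpen_induced_iff.mp hu
          obtain ⟨v, hv0, rfl⟩ := isOpen_induced_iff.mp hv
          obtain ⟨x, hx, h1, h2⟩ := (hYirr q).2 u v hu0 hv0
            (by obtain ⟨x, hx⟩ := hu'; exact ⟨_, hx.1, hx.2⟩)
            (by obtain ⟨x, hx⟩ := hv'; exact ⟨_, hx.1, hx.2⟩)
          exact ⟨⟨x, hYS q hx⟩, hx, h1, h2⟩,
        by
        have hc : IsClosed (zeroLocus k (P q)) := by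
          rw [isClosed_zariski_iff]
          refine ⟨P q, ?_⟩
          ext x
          simp [aeval_eq_eval]
        have : (Subtype.val ⁻¹' Y q : Set ↥(S ∩ U)) = Subtype.val ⁻¹' (zeroLocus k (P q)) := by
          ext x
          simp only [Y, Set.mem_preimage, Set.mem_inter_iff]
          exact ⟨fun h => h.1, fun h => ⟨h, x.2.2⟩⟩
        rw [this]
        exact hc.preimage continuous_subtype_val⟩
    rw [topologicalKrullDim, ← Order.krullDim_orderDual]
    refine Order.krullDim_le_of_strictMono G fun q q' hq => ?_
    have hPinj : ∀ q q' : PrimeSpectrum L, q < q' → P q < P q' := fun q q' h => by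
      have h1 : q.asIdeal.comap (algebraMap R L) < q'.asIdeal.comap (algebraMap R L) := by
        refine lt_of_le_of_ne (Ideal.comap_mono h.le) fun heq => h.ne ?_
        have := congrArg (Ideal.map (algebraMap R L)) heq
        rw [IsLocalization.map_under (Submonoid.powers fb),
          IsLocalization.map_under (Submonoid.powers fb)] at this
        exact PrimeSpectrum.ext this
      refine lt_of_le_of_ne (Ideal.comap_mono h1.le) fun heq => h1.ne ?_
      exact Ideal.comap_injective_of_surjective _ Ideal.Quotient.mk_surjective heq
    have h1 : Y q' ⊆ Y q := Set.inter_subset_inter_left _ (zeroLocus_anti_mono (hPinj _ _ hq).le)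
    refine lt_of_le_of_ne (fun x hx => h1 hx) fun heq => (hPinj _ _ hq).ne ?_
    rw [← hYI q, ← hYI q']
    congr 1
    have h2 : (Subtype.val ⁻¹' Y q : Set ↥(S ∩ U)) = Subtype.val ⁻¹' Y q' :=
      congrArg (fun Z => (OrderDual.ofDual Z).carrier) heq
    apply Set.Subset.antisymm _ h1
    intro x hx
    have : (⟨x, hYS q hx⟩ : ↥(S ∩ U)) ∈ (Subtype.val ⁻¹' Y q' : Set ↥(S ∩ U)) := by
      rw [← h2]; exact hx
    exact this

end ZariskiTopology

/-! ### Differentials of polynomials and affine tangent spaces. -/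

section Differentials

variable {k : Type*} [Field k] {ι κ : Type*} [Fintype ι] [Fintype κ]

theorem polyDifferential_apply (f : MvPolynomial ι k) (p w : ι → k) :
    polyDifferential f p w = ∑ i, eval p (pderiv i f) * w i := by
  simp [polyDifferential]

theorem polyDifferential_add (f g : MvPolynomial ι k) (p : ι → k) :
    polyDifferential (f + g) p = polyDifferential f p + polyDifferential g p := by
  ext1
  simp [polyDifferential, add_smul, Finset.sum_add_distrib]

theorem polyDifferential_mul_apply (f g : MvPolynomial ι k) (p w : ι → k) :
    polyDifferential (f * g) p w =
      eval p f * polyDifferential g p w + eval p g * polyDifferential f p w := by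
  simp only [polyDifferential_apply, Derivation.leibniz, smul_eq_mul, map_add, map_mul,
    Finset.mul_sum, ← Finset.sum_add_distrib]
  refine Finset.sum_congr rfl fun i _ => ?_
  ring

theorem polyDifferential_C_apply (c : k) (p w : ι → k) :
    polyDifferential (C c : MvPolynomial ι k) p w = 0 := by
  simp [polyDifferential_apply]

theorem polyDifferential_X_apply (i : ι) (p w : ι → k) :
    polyDifferential (X i : MvPolynomial ι k) p w = w i := by
  classical
  simp [polyDifferential_apply, pderiv_X, Pi.single_apply, apply_ite]

theorem polyDifferential_bind₁ (Q : κ → MvPolynomial ι k) (f : MvPolynomial κ k) (p w : ι → k) :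
    polyDifferential (bind₁ Q f) p w =
      polyDifferential f (fun j => eval p (Q j)) (fun j => polyDifferential (Q j) p w) := by
  have hev : ∀ g : MvPolynomial κ k, eval p (bind₁ Q g) = eval (fun j => eval p (Q j)) g := by
    intro g
    simp [← aeval_eq_eval, aeval_bind₁]
  induction f using MvPolynomial.induction_on with
  | C a => simp [polyDifferential_C_apply]
  | add f g hf hg => simp [polyDifferential_add, hf, hg]
  | mul_X f i hf =>
    rw [map_mul, polyDifferential_mul_apply, polyDifferential_mul_apply, hf, bind₁_X_right,
      polyDifferential_X_apply, hev, eval_X]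

/-- Evaluation at the dual number point `p + εw` records value and derivative together, so
identities between polynomials can be differentiated by applying an algebra homomorphism. -/
theorem aeval_dualNumber (f : MvPolynomial ι k) (p w : ι → k) :
    aeval (fun i => (TrivSqZeroExt.inl (p i) + TrivSqZeroExt.inr (w i) : TrivSqZeroExt k k)) f =
      TrivSqZeroExt.inl (eval p f) + TrivSqZeroExt.inr (polyDifferential f p w) := by
  induction f using MvPolynomial.induction_on with
  | C a =>
    rw [polyDifferential_C_apply, aeval_C, eval_C]
    simp [TrivSqZeroExt.algebraMap_eq_inl]
  | add f g hf hg =>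
    rw [map_add, hf, hg, polyDifferential_add, LinearMap.add_apply, map_add, TrivSqZeroExt.inl_add,
      TrivSqZeroExt.inr_add]
    abel
  | mul_X f i hf =>
    rw [map_mul, hf, polyDifferential_mul_apply, aeval_X, polyDifferential_X_apply]
    ext
    · simp
    · simp
      ring

theorem mem_affineTangent_iff {S : Set (ι → k)} {p w : ι → k} :
    w ∈ affineTangent S p ↔ ∀ f ∈ vanishingIdeal k S, polyDifferential f p w = 0 := by
  simp [affineTangent, Submodule.mem_iInf]

theorem affineTangent_mono {S S' : Set (ι → k)} (h : S ⊆ S') (p : ι → k) :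
    affineTangent S p ≤ affineTangent S' p := fun _ hw =>
  mem_affineTangent_iff.mpr fun f hf =>
    mem_affineTangent_iff.mp hw f (vanishingIdeal_anti_mono h hf)

/-- The differential of a polynomial map carries tangent vectors to tangent vectors. -/
theorem polyDifferential_mem_affineTangent {S : Set (ι → k)} {T : Set (κ → k)}
    (Q : κ → MvPolynomial ι k) (hQ : ∀ x ∈ S, (fun j => eval x (Q j)) ∈ T) {p w : ι → k}
    (hw : w ∈ affineTangent S p) :
    (fun j => polyDifferential (Q j) p w) ∈ affineTangent T (fun j => eval p (Q j)) := by
  refine mem_affineTangent_iff.mpr fun f hf => ?_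
  rw [← polyDifferential_bind₁]
  refine mem_affineTangent_iff.mp hw _ (mem_vanishingIdeal_iff_eval.mpr fun x hx => ?_)
  rw [← aeval_eq_eval, aeval_bind₁]
  simpa [aeval_eq_eval] using mem_vanishingIdeal_iff_eval.mp hf _ (hQ x hx)

end Differentials

/-! ### Substituting fractions with a common denominator into polynomials. -/

section ClearDenominators

variable {k : Type*} [Field k] {ι κ : Type*}

/-- The polynomial `δ ^ totalDegree g * g (Q / δ)`. -/
noncomputable def clearDenom (Q : κ → MvPolynomial ι k) (δ : MvPolynomial ι k)
    (g : MvPolynomial κ k) : MvPolynomial ι k :=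
  ∑ s ∈ g.support, C (g.coeff s) * (δ ^ (g.totalDegree - s.degree) * s.prod fun j e => Q j ^ e)

/-- The target is an arbitrary algebra because three are needed: the base field, a function field
and the dual numbers. Writing `θ (Q j) = θ δ * y j` avoids any division. -/
theorem algHom_clearDenom {A : Type*} [CommRing A] [Algebra k A] (Q : κ → MvPolynomial ι k)
    (δ : MvPolynomial ι k) (g : MvPolynomial κ k) (θ : MvPolynomial ι k →ₐ[k] A) (y : κ → A)
    (hy : ∀ j, θ (Q j) = θ δ * y j) :
    θ (clearDenom Q δ g) = θ δ ^ g.totalDegree * aeval y g := by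
  rw [clearDenom, map_sum, aeval_def, eval₂_eq, Finset.mul_sum]
  refine Finset.sum_congr rfl fun s hs => ?_
  have hd : s.degree ≤ g.totalDegree := by
    rw [totalDegree]
    exact Finset.le_sup (f := fun s : κ →₀ ℕ => s.sum fun _ e => e) hs
  have hprod : θ (s.prod fun j e => Q j ^ e) = θ δ ^ s.degree * s.prod fun j e => y j ^ e := by
    rw [Finsupp.prod, map_prod, Finsupp.prod, show s.degree = ∑ i ∈ s.support, s i from rfl,
      ← Finset.prod_pow_eq_pow_sum,
      ← Finset.prod_mul_distrib]
    refine Finset.prod_congr rfl fun j _ => ?_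
    rw [map_pow, hy, mul_pow]
  have hsplit : θ δ ^ g.totalDegree = θ δ ^ (g.totalDegree - s.degree) * θ δ ^ s.degree := by
    rw [← pow_add, Nat.sub_add_cancel hd]
  rw [map_mul, map_mul, hprod, map_pow, hsplit, ← algebraMap_eq, AlgHom.commutes, Finsupp.prod]
  ring

theorem eval_clearDenom (Q : κ → MvPolynomial ι k) (δ : MvPolynomial ι k) (g : MvPolynomial κ k)
    (p : ι → k) (y : κ → k) (hy : ∀ j, eval p (Q j) = eval p δ * y j) :
    eval p (clearDenom Q δ g) = eval p δ ^ g.totalDegree * eval y g := by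
  have := algHom_clearDenom Q δ g (aeval p) y (by simpa [aeval_eq_eval] using hy)
  simpa [aeval_eq_eval] using this

end ClearDenominators

/-! ### Separable elements as simple roots of polynomials. -/

section Separable

variable {k : Type*} [Field k]

theorem pderiv_none_rename_some {σ : Type*} (a : MvPolynomial σ k) :
    pderiv none (rename some a) = 0 := by
  induction a using MvPolynomial.induction_on with
  | C a => simp
  | add f g hf hg => simp [hf, hg]
  | mul_X f i hf =>
    rw [map_mul, Derivation.leibniz, hf, rename_X, pderiv_X_of_ne (by simp)]
    simp

theorem pderiv_none_optionEquivLeft_symm {σ : Type*} (G : Polynomial (MvPolynomial σ k)) :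
    pderiv none ((optionEquivLeft k σ).symm G) =
      (optionEquivLeft k σ).symm (Polynomial.derivative G) := by
  induction G using Polynomial.induction_on' with
  | add f g hf hg => simp [hf, hg]
  | monomial n a =>
    rw [← Polynomial.C_mul_X_pow_eq_monomial, Polynomial.derivative_C_mul_X_pow]
    simp only [map_mul, map_pow, optionEquivLeft_symm_apply,
      Polynomial.aevalTower_C, Polynomial.aevalTower_X, Derivation.leibniz, Derivation.leibniz_pow,
      pderiv_none_rename_some, pderiv_X_self]
    simp
    ring

theorem aeval_optionEquivLeft_symm {σ A : Type*} [CommRing A] [Algebra k A] (y : Option σ → A)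
    (G : Polynomial (MvPolynomial σ k)) :
    aeval y ((optionEquivLeft k σ).symm G) =
      (G.map (aeval fun j => y (some j)).toRingHom).eval (y none) := by
  induction G using Polynomial.induction_on' with
  | add f g hf hg => simp [hf, hg]
  | monomial n a =>
    rw [← Polynomial.C_mul_X_pow_eq_monomial, Polynomial.map_mul, Polynomial.map_pow,
      Polynomial.map_X, Polynomial.map_C, Polynomial.eval_mul, Polynomial.eval_pow,
      Polynomial.eval_X, Polynomial.eval_C]
    simp [optionEquivLeft_symm_apply, aeval_rename, Function.comp_def]

/-- An element separable over `k(s)` is a simple root of a polynomial with coefficients in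
`k[s]`. -/
theorem exists_aeval_eq_zero_of_isSeparable {K : Type*} [Field K] [Algebra k K] (s : Set K) {x : K}
    (hx : IsSeparable (IntermediateField.adjoin k s) x) :
    ∃ F : MvPolynomial (Option s) k, aeval (fun o => o.elim x Subtype.val) F = 0 ∧
      aeval (fun o => o.elim x Subtype.val) (pderiv none F) ≠ 0 := by
  open scoped IntermediateField.algebraAdjoinAdjoin in
  let A := Algebra.adjoin k s
  let E := IntermediateField.adjoin k s
  let P := minpoly E x
  -- Clear the denominators of the minimal polynomial, then lift its coefficients from `k[s]` to a
  -- polynomial ring along the surjection `φ`.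
  obtain ⟨b, hb, hP⟩ := IsLocalization.integerNormalization_spec (nonZeroDivisors A) P
  set P' := IsLocalization.integerNormalization (nonZeroDivisors A) P
  let φ : MvPolynomial s k →ₐ[k] A := aeval fun j => (⟨j.1, Algebra.subset_adjoin j.2⟩ : A)
  have hval : ∀ g, ((φ g : A) : K) = aeval (Subtype.val : s → K) g := fun g => by
    have : (A.val.comp φ) = aeval (Subtype.val : s → K) := by
      ext j; simp [φ, A]
    exact DFunLike.congr_fun this g
  have hφ : Function.Surjective φ := by
    rintro ⟨a, ha⟩
    have ha' : a ∈ Algebra.adjoin k (Set.range (Subtype.val : s → K)) := by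
      rw [Subtype.range_coe]; exact ha
    rw [Algebra.adjoin_range_eq_range_aeval] at ha'
    obtain ⟨g, hg⟩ := ha'
    exact ⟨g, Subtype.ext ((hval g).trans hg)⟩
  obtain ⟨G, hG⟩ := Polynomial.map_surjective φ.toRingHom hφ P'
  have hb0 : algebraMap A K b ≠ 0 := by
    have := nonZeroDivisors.ne_zero hb
    simpa [A] using this
  -- Needed twice: for the minimal polynomial, which vanishes at `x`, and for its derivative, which
  -- by separability does not.
  have key : ∀ (H : Polynomial (MvPolynomial s k)) (R : Polynomial E),
      (H.map φ.toRingHom).map (algebraMap A E) = b • R →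
      aeval (fun o : Option s => o.elim x Subtype.val) ((optionEquivLeft k s).symm H) =
        algebraMap A K b * Polynomial.aeval x R := by
    intro H R h
    rw [aeval_optionEquivLeft_symm]
    have h1 : (H.map (aeval (Subtype.val : s → K)).toRingHom) =
        ((H.map φ.toRingHom).map (algebraMap A E)).map (algebraMap E K) := by
      rw [Polynomial.map_map, Polynomial.map_map]
      congr 1
      ext j
      · simp only [RingHom.coe_comp, Function.comp_apply, AlgHom.toRingHom_eq_coe, RingHom.coe_coe,
          ← algebraMap_eq, AlgHom.commutes]
        rfl
      · simp only [AlgHom.toRingHom_eq_coe, RingHom.coe_coe, aeval_X, RingHom.coe_comp,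
          Function.comp_apply, φ]
        rfl
    have h2 : (algebraMap E K) (algebraMap A E b) = algebraMap A K b := rfl
    simp only [Option.elim_some, Option.elim_none]
    rw [h1, h, ← algebraMap_smul E b R, Polynomial.map_smul, Polynomial.eval_smul, h2,
      Polynomial.aeval_def, Polynomial.eval₂_eq_eval_map, smul_eq_mul]
  refine ⟨(optionEquivLeft k s).symm G, ?_, ?_⟩
  · rw [key G P (by rw [hG, hP]), minpoly.aeval, mul_zero]
  · rw [pderiv_none_optionEquivLeft_symm, key (Polynomial.derivative G) (Polynomial.derivative P)
      (by rw [← Polynomial.derivative_map, hG, ← Polynomial.derivative_map, hP,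
        Polynomial.derivative_smul])]
    exact mul_ne_zero hb0 (hx.aeval_derivative_ne_zero (minpoly.aeval _ _))

end Separable

/-! ### Tangent spaces at a general point are no larger than the dimension. -/

section GenericTangent

variable {k : Type*} [Field k] [IsAlgClosed k] {ι : Type*} [Fintype ι]

attribute [local instance] zariski

/-- The tangent spaces of an irreducible affine set have dimension at most `affDim S` at a general
point. -/
theorem exists_forall_finrank_affineTangent_le {S : Set (ι → k)} (hirr : IsIrreducible S) :
    ∃ h ∉ vanishingIdeal k S, ∀ p ∈ S, eval p h ≠ 0 →
      Module.finrank k (affineTangent S p) ≤ affDim S := by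
  classical
  have hP : (vanishingIdeal k S).IsPrime := isIrreducible_iff_isPrime_vanishingIdeal.mp hirr
  set I := vanishingIdeal k S with hI
  let R := MvPolynomial ι k ⧸ I
  let K := FractionRing R
  -- An algebraically closed field is perfect, so the function field has a separating transcendence
  -- basis, in any characteristic.
  obtain ⟨s, hs, hsep⟩ := exists_isTranscendenceBasis_and_isSeparable_of_perfectField k K
  have hcard : s.card = affDim S := by
    have h1 := hs.cardinalMk_eq_trdeg
    have h2 := trdeg_localization_eq k (R := R) K (nonZeroDivisors R) le_rfl
    rw [← h1, Cardinal.mk_fintype, Cardinal.toNat_natCast, Fintype.card_coe] at h2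
    exact h2
  let q : MvPolynomial ι k →ₐ[k] K :=
    (IsScalarTower.toAlgHom k R K).comp (Ideal.Quotient.mkₐ k I)
  have hq : ∀ f, q f = 0 ↔ f ∈ I := fun f => by
    have h1 : q f = algebraMap R K (Ideal.Quotient.mk I f) := rfl
    rw [h1, map_eq_zero_iff _ (IsFractionRing.injective R K), Ideal.Quotient.eq_zero_iff_mem]
  -- With a common denominator, the basis elements become fractions `a j / b'` of polynomials.
  obtain ⟨b, hb⟩ := IsLocalization.exist_integer_multiples_of_finset (nonZeroDivisors R) s
  obtain ⟨b', hb'⟩ := Ideal.Quotient.mk_surjective b.1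
  have hb'0 : q b' ≠ 0 := by
    have h1 : q b' = algebraMap R K b.1 := by rw [← hb']; rfl
    rw [h1, map_ne_zero_iff _ (IsFractionRing.injective R K)]
    exact nonZeroDivisors.ne_zero b.2
  have hnum : ∀ j : s, ∃ a : MvPolynomial ι k, q a = q b' * j.1 := fun j => by
    obtain ⟨a, ha⟩ := hb j.1 j.2
    obtain ⟨a', ha'⟩ := Ideal.Quotient.mk_surjective a
    refine ⟨a', ?_⟩
    have h1 : q b' = algebraMap R K b.1 := by rw [← hb']; rfl
    have h2 : q a' = algebraMap R K a := by rw [← ha']; rfl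
    rw [h1, h2, ha, Algebra.smul_def]
  choose a ha using hnum
  have hF : ∀ i : ι, ∃ F : MvPolynomial (Option (s : Set K)) k,
      aeval (fun o => o.elim (q (X i)) Subtype.val) F = 0 ∧
      aeval (fun o => o.elim (q (X i)) Subtype.val) (pderiv none F) ≠ 0 := fun i =>
    exists_aeval_eq_zero_of_isSeparable (s : Set K) (Algebra.IsSeparable.isSeparable _ (q (X i)))
  choose F hF0 hF1 using hF
  let Q : ι → Option (s : Set K) → MvPolynomial ι k := fun i o => o.elim (b' * X i) a
  have hQ : ∀ i o, q (Q i o) = q b' * (o.elim (q (X i)) Subtype.val : K) := by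
    rintro i (_ | j)
    · simp [Q]
    · exact ha j
  -- `f i` is the numerator of the equation `F i (x_i, s) = 0`, so it vanishes on `S`; `h i` is the
  -- numerator of its derivative in `x_i`, which does not vanish identically there.
  let f : ι → MvPolynomial ι k := fun i => clearDenom (Q i) b' (F i)
  let h : ι → MvPolynomial ι k := fun i => clearDenom (Q i) b' (pderiv none (F i))
  have hf : ∀ i, f i ∈ I := fun i => by
    rw [← hq, algHom_clearDenom _ _ _ q _ (hQ i), hF0, mul_zero]
  have hh : ∀ i, q (h i) ≠ 0 := fun i => by
    rw [algHom_clearDenom _ _ _ q _ (hQ i)]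
    exact mul_ne_zero (pow_ne_zero _ hb'0) (hF1 i)
  refine ⟨b' * ∏ i, h i, ?_, ?_⟩
  · rw [← hq, map_mul, map_prod]
    exact mul_ne_zero hb'0 (Finset.prod_ne_zero_iff.mpr fun i _ => hh i)
  intro p hp hph
  rw [map_mul, map_prod] at hph
  have hbp : eval p b' ≠ 0 := left_ne_zero_of_mul hph
  have hhp : ∀ i, eval p (h i) ≠ 0 := fun i =>
    Finset.prod_ne_zero_iff.mp (right_ne_zero_of_mul hph) i (Finset.mem_univ i)
  -- The quotient rule: `lam` is `b' ^ 2` times the differential of the functions `a j / b'`.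
  let lam : (ι → k) →ₗ[k] (↥(s : Set K) → k) := LinearMap.pi fun j =>
    eval p b' • polyDifferential (a j) p - eval p (a j) • polyDifferential b' p
  -- If `w` does not move the transcendence basis, differentiating `F i = 0` leaves `(∂F i/∂x_i) * w
  -- i = 0`, and the partial derivative is nonzero at `p`.
  have hinj : ∀ w ∈ affineTangent S p, lam w = 0 → w = 0 := by
    intro w hw hlam
    funext i
    have hlamj : ∀ j, eval p b' * polyDifferential (a j) p w =
        eval p (a j) * polyDifferential b' p w := fun j => by
      simpa [lam, sub_eq_zero] using congrFun hlam j
    let θ : MvPolynomial ι k →ₐ[k] TrivSqZeroExt k k :=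
      aeval fun i => (TrivSqZeroExt.inl (p i) + TrivSqZeroExt.inr (w i) : TrivSqZeroExt k k)
    have hθ : ∀ g,
        θ g = TrivSqZeroExt.inl (eval p g) + TrivSqZeroExt.inr (polyDifferential g p w) :=
      fun g => aeval_dualNumber g p w
    let y₀ : Option (s : Set K) → k := fun o => o.elim (p i) fun j => eval p (a j) / eval p b'
    let v₀ : Option (s : Set K) → k := fun o => o.elim (w i) fun _ => 0
    have hy : ∀ o, θ (Q i o) =
        θ b' * (TrivSqZeroExt.inl (y₀ o) + TrivSqZeroExt.inr (v₀ o) : TrivSqZeroExt k k) := by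
      rintro (_ | j)
      · simp only [Q, y₀, v₀, Option.elim_none, map_mul]
        rw [hθ (X i), eval_X, polyDifferential_X_apply]
      · simp only [Q, y₀, v₀, Option.elim_some]
        rw [hθ, hθ]
        ext
        · simp [mul_div_cancel₀, hbp, mul_comm]
        · have := hlamj j
          simp
          field_simp
          linear_combination this
    have h1 := algHom_clearDenom (Q i) b' (F i) θ _ hy
    have h2 : θ (f i) = 0 := by
      rw [hθ, mem_vanishingIdeal_iff_eval.mp (hf i) p hp, mem_affineTangent_iff.mp hw _ (hf i)]
      simp
    rw [show clearDenom (Q i) b' (F i) = f i from rfl, h2, aeval_dualNumber (F i)] at h1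
    have hpd : polyDifferential (F i) y₀ v₀ = eval y₀ (pderiv none (F i)) * w i := by
      rw [polyDifferential_apply, Fintype.sum_option]
      simp only [v₀, Option.elim_none, Option.elim_some, mul_zero, Finset.sum_const_zero, add_zero]
    have h3 : eval p (h i) = eval p b' ^ _ * eval y₀ (pderiv none (F i)) :=
      eval_clearDenom (Q i) b' _ p y₀ (by
        rintro (_ | j)
        · simp [Q, y₀]
        · simp only [Q, y₀, Option.elim_some]
          field_simp)
    have h4 : eval y₀ (pderiv none (F i)) ≠ 0 := fun h0 => hhp i (by rw [h3, h0, mul_zero])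
    have hunit : IsUnit (θ b') := by
      rw [TrivSqZeroExt.isUnit_iff_isUnit_fst, hθ]
      simpa using hbp
    have h5 := ((hunit.pow (F i).totalDegree).mul_right_eq_zero).mp h1.symm
    have h6 := congrArg TrivSqZeroExt.snd h5
    simp [hpd, h4] at h6
    exact h6
  have hle : Module.finrank k (affineTangent S p) ≤ Module.finrank k (↥(s : Set K) → k) := by
    refine LinearMap.finrank_le_finrank_of_injective (f := lam.domRestrict (affineTangent S p)) ?_
    rw [← LinearMap.ker_eq_bot, LinearMap.ker_eq_bot']
    rintro ⟨w, hw⟩ hw0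
    exact Subtype.ext (hinj w hw hw0)
  rw [Module.finrank_fintype_fun_eq_card] at hle
  exact hle.trans ((Fintype.card_coe s).trans hcard).le

end GenericTangent

/-! ### Coordinate projections: images, fibres and dimension. -/

section Projection

variable {k : Type*} [Field k] {ι κ : Type*}

attribute [local instance] zariski

theorem vanishingIdeal_closure_comp (S : Set (ι → k)) (j : κ → ι) :
    vanishingIdeal k (closure ((fun x => x ∘ j) '' S)) = (vanishingIdeal k S).comap (rename j) := by
  rw [vanishingIdeal_closure]
  ext f
  rw [Ideal.mem_comap, mem_vanishingIdeal_iff_eval, mem_vanishingIdeal_iff_eval]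
  simp [eval_rename]

theorem continuous_comp (j : κ → ι) : Continuous fun x : ι → k => x ∘ j := by
  have := continuous_polynomialMap (k := k) fun a : κ => (X (j a) : MvPolynomial ι k)
  simpa [Function.comp_def] using this

theorem isIrreducible_closure_comp {S : Set (ι → k)} (hS : IsIrreducible S) (j : κ → ι) :
    IsIrreducible (closure ((fun x => x ∘ j) '' S)) :=
  (hS.image _ (continuous_comp j).continuousOn).closure

/-- The homomorphism of rings of functions induced by a coordinate projection. -/
noncomputable def projectionAlgHom (S : Set (ι → k)) (j : κ → ι) :
    (MvPolynomial κ k ⧸ vanishingIdeal k (closure ((fun x => x ∘ j) '' S))) →ₐ[k]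
      (MvPolynomial ι k ⧸ vanishingIdeal k S) :=
  Ideal.quotientMapₐ _ (rename j) (vanishingIdeal_closure_comp S j).le

theorem projectionAlgHom_mk (S : Set (ι → k)) (j : κ → ι) (f : MvPolynomial κ k) :
    projectionAlgHom S j (Ideal.Quotient.mk _ f) = Ideal.Quotient.mk _ (rename j f) := rfl

theorem projectionAlgHom_injective (S : Set (ι → k)) (j : κ → ι) :
    Function.Injective (projectionAlgHom S j) := by
  rw [injective_iff_map_eq_zero]
  intro a ha
  obtain ⟨f, rfl⟩ := Ideal.Quotient.mk_surjective a
  rw [projectionAlgHom_mk, Ideal.Quotient.eq_zero_iff_mem] at ha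
  rw [Ideal.Quotient.eq_zero_iff_mem, vanishingIdeal_closure_comp]
  exact ha

variable [IsAlgClosed k] [Finite ι] [Finite κ]

/-- The image of a nonempty open part of `S` under a coordinate projection contains a nonempty open
part of the closure of the image of `S`. -/
theorem exists_forall_exists_lift {S : Set (ι → k)} (hS : IsClosed S) (hirr : IsIrreducible S)
    (j : κ → ι) {b : MvPolynomial ι k} (hb : b ∉ vanishingIdeal k S) :
    ∃ a ∉ vanishingIdeal k (closure ((fun x => x ∘ j) '' S)),
      ∀ t ∈ closure ((fun x => x ∘ j) '' S), eval t a ≠ 0 →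
        ∃ x ∈ S, x ∘ j = t ∧ eval x b ≠ 0 := by
  have hP : (vanishingIdeal k S).IsPrime := isIrreducible_iff_isPrime_vanishingIdeal.mp hirr
  have hP' : (vanishingIdeal k (closure ((fun x => x ∘ j) '' S))).IsPrime :=
    isIrreducible_iff_isPrime_vanishingIdeal.mp (isIrreducible_closure_comp hirr j)
  obtain ⟨a, ha, hext⟩ := exists_forall_algHom_extends (projectionAlgHom S j)
    (projectionAlgHom_injective S j) (Ideal.Quotient.mk _ b)
    (fun h => hb (Ideal.Quotient.eq_zero_iff_mem.mp h))
  obtain ⟨a, rfl⟩ := Ideal.Quotient.mk_surjective a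
  refine ⟨a, fun h => ha (Ideal.Quotient.eq_zero_iff_mem.mpr h), fun t ht hta => ?_⟩
  let φ : (MvPolynomial κ k ⧸ vanishingIdeal k (closure ((fun x => x ∘ j) '' S))) →ₐ[k] k :=
    Ideal.Quotient.liftₐ _ (aeval t) fun f hf => by
      rw [aeval_eq_eval]; exact mem_vanishingIdeal_iff_eval.mp hf t ht
  have hφ : ∀ f, φ (Ideal.Quotient.mk _ f) = eval t f := fun f => by
    rw [← aeval_eq_eval]; rfl
  obtain ⟨ψ, hψ, hψb⟩ := hext φ (by rwa [hφ])
  -- The extended homomorphism `ψ` on the coordinate ring of `S` is evaluation at a point of `S`.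
  let x : ι → k := fun i => ψ (Ideal.Quotient.mk _ (X i))
  have hx : ∀ f, ψ (Ideal.Quotient.mk _ f) = eval x f := fun f => by
    have : ψ.comp (Ideal.Quotient.mkₐ k (vanishingIdeal k S)) = aeval x := by
      ext i; simp [x]
    rw [← aeval_eq_eval, ← this]; rfl
  refine ⟨x, mem_of_forall_vanishingIdeal hS fun f hf => ?_, ?_, ?_⟩
  · rw [← hx, Ideal.Quotient.eq_zero_iff_mem.mpr hf, map_zero]
  · funext c
    have h1 : φ (Ideal.Quotient.mk _ (X c)) = t c := by rw [hφ, eval_X]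
    rw [← h1, ← hψ, AlgHom.comp_apply, projectionAlgHom_mk, hx, rename_X, eval_X]
    rfl
  · rwa [hx] at hψb

/-- A coordinate projection with finite general fibres preserves the dimension. -/
theorem affDim_closure_comp {S : Set (ι → k)} (hS : IsClosed S) (hirr : IsIrreducible S)
    (j : κ → ι) {a₀ : MvPolynomial κ k}
    (ha₀ : a₀ ∉ vanishingIdeal k (closure ((fun x => x ∘ j) '' S)))
    (hfin : ∀ t ∈ (fun x => x ∘ j) '' S, eval t a₀ ≠ 0 → {x ∈ S | x ∘ j = t}.Finite) :
    affDim (closure ((fun x => x ∘ j) '' S)) = affDim S := by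
  have hP : (vanishingIdeal k S).IsPrime := isIrreducible_iff_isPrime_vanishingIdeal.mp hirr
  have hP' : (vanishingIdeal k (closure ((fun x => x ∘ j) '' S))).IsPrime :=
    isIrreducible_iff_isPrime_vanishingIdeal.mp (isIrreducible_closure_comp hirr j)
  set T := closure ((fun x : ι → k => x ∘ j) '' S) with hT
  let A := MvPolynomial κ k ⧸ vanishingIdeal k T
  let B := MvPolynomial ι k ⧸ vanishingIdeal k S
  let : Algebra A B := (projectionAlgHom S j).toRingHom.toAlgebra
  have : IsScalarTower k A B := IsScalarTower.of_algHom (projectionAlgHom S j)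
  have hinj : Function.Injective (algebraMap A B) := projectionAlgHom_injective S j
  have : FaithfulSMul A B := (faithfulSMul_iff_algebraMap_injective A B).mpr hinj
  have hmap : ∀ f, algebraMap A B (Ideal.Quotient.mk _ f) = Ideal.Quotient.mk _ (rename j f) :=
    fun f => projectionAlgHom_mk S j f
  by_cases hall : ∀ i, IsAlgebraic A (Ideal.Quotient.mk (vanishingIdeal k S) (X i))
  · have halg : Algebra.IsAlgebraic A B := by
      refine ⟨fun b => ?_⟩
      obtain ⟨f, rfl⟩ := Ideal.Quotient.mk_surjective b
      induction f using MvPolynomial.induction_on with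
      | C c =>
        have : (Ideal.Quotient.mk (vanishingIdeal k S) (C c)) =
            algebraMap A B (Ideal.Quotient.mk _ (C c)) := by rw [hmap, rename_C]
        rw [this]
        exact isAlgebraic_algebraMap _
      | add f g hf hg => rw [map_add]; exact hf.add hg
      | mul_X f i hf => rw [map_mul]; exact hf.mul (hall i)
    have h := lift_trdeg_add_eq k A B
    rw [trdeg_eq_zero (R := A), Cardinal.lift_zero, add_zero] at h
    have h' := congrArg Cardinal.toNat h
    rw [Cardinal.toNat_lift, Cardinal.toNat_lift] at h'
    exact h'
  · exfalso
    push Not at hall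
    obtain ⟨i, hi⟩ := hall
    -- Retain the coordinate `x_i`, transcendental over `A`, together with the projection. The image
    -- closure `T'` then contains all of `T × 𝔸¹`, which contradicts finite fibres.
    let j' : Option κ → ι := fun o => o.elim i j
    set T' := closure ((fun x : ι → k => x ∘ j') '' S) with hT'
    -- An equation of `T'` is a relation for `x_i` over `A`; by transcendence each of its
    -- coefficients vanishes on `T`.
    have hcoeff : ∀ f ∈ vanishingIdeal k T', ∀ n,
        (optionEquivLeft k κ f).coeff n ∈ vanishingIdeal k T := by
      intro f hf n
      rw [hT', vanishingIdeal_closure_comp, Ideal.mem_comap] at hf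
      have h1 : Polynomial.aeval (Ideal.Quotient.mk (vanishingIdeal k S) (X i))
          ((optionEquivLeft k κ f).map (Ideal.Quotient.mk (vanishingIdeal k T))) =
          Ideal.Quotient.mk (vanishingIdeal k S) (rename j' f) := by
        clear hf
        induction f using MvPolynomial.induction_on with
        | C c =>
          rw [optionEquivLeft_C, Polynomial.map_C, Polynomial.aeval_C, rename_C]
          erw [hmap]
          rw [rename_C]
        | add f g hf hg => rw [map_add, Polynomial.map_add, map_add, hf, hg, map_add, map_add]
        | mul_X f o hf =>
          rw [map_mul, Polynomial.map_mul, map_mul, hf, map_mul, map_mul, rename_X]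
          congr 1
          rcases o with _ | o
          · rw [optionEquivLeft_X_none, Polynomial.map_X, Polynomial.aeval_X]; rfl
          · rw [optionEquivLeft_X_some, Polynomial.map_C, Polynomial.aeval_C]
            erw [hmap]
            rw [rename_X]; rfl
      rw [Ideal.Quotient.eq_zero_iff_mem.mpr hf] at h1
      have h2 := transcendental_iff.mp hi _ h1
      rw [← Ideal.Quotient.eq_zero_iff_mem, ← Polynomial.coeff_map, h2, Polynomial.coeff_zero]
    have heval : ∀ (f : MvPolynomial (Option κ) k) (t : κ → k) (y : k),
        eval (fun o : Option κ => o.elim y t) f =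
          Polynomial.eval y ((optionEquivLeft k κ f).map (eval t)) := fun f t y =>
      optionEquivLeft_elim_eval _ _ t y f
    obtain ⟨a, ha, hlift⟩ := exists_forall_exists_lift hS hirr j' (b := 1) (fun h =>
      hP.ne_top ((Ideal.eq_top_iff_one _).mpr h))
    obtain ⟨n, hn⟩ : ∃ n, (optionEquivLeft k κ a).coeff n ∉ vanishingIdeal k T := by
      by_contra! hcon
      refine ha (mem_vanishingIdeal_iff_eval.mpr ?_)
      rw [← hT']
      intro t' ht'
      have h3 : t' ∘ some ∈ T := by
        refine mem_closure_zariski_iff.mpr fun f hf => ?_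
        have h4 : rename some f ∈ vanishingIdeal k T' := by
          rw [hT', vanishingIdeal_closure_comp, Ideal.mem_comap, rename_rename]
          rw [← vanishingIdeal_closure, ← hT, hT, vanishingIdeal_closure_comp] at hf
          exact hf
        simpa [eval_rename] using mem_vanishingIdeal_iff_eval.mp h4 t' ht'
      have h5 : t' = fun o : Option κ => o.elim (t' none) (t' ∘ some) := by
        funext o; cases o <;> rfl
      rw [h5, heval]
      have : (optionEquivLeft k κ a).map (eval (t' ∘ some)) = 0 := by
        ext m
        rw [Polynomial.coeff_map, Polynomial.coeff_zero]
        exact mem_vanishingIdeal_iff_eval.mp (hcon m) _ h3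
      rw [this, Polynomial.eval_zero]
    have hprod : (optionEquivLeft k κ a).coeff n * a₀ ∉ vanishingIdeal k T := fun h =>
      (hP'.mem_or_mem h).elim hn ha₀
    rw [hT, vanishingIdeal_closure] at hprod
    obtain ⟨t, ht, hne⟩ := exists_mem_eval_ne_zero hprod
    rw [map_mul] at hne
    have hfin' := hfin t ht (right_ne_zero_of_mul hne)
    let p : Polynomial k := (optionEquivLeft k κ a).map (eval t)
    have hp : p ≠ 0 := fun h => left_ne_zero_of_mul hne (by
      rw [← Polynomial.coeff_map]
      exact congrArg (fun q => Polynomial.coeff q n) h)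
    -- Every point `(y, t)` lies in `T'`, and it lifts to `S` unless `y` is a root of `p`.
    have hsub : {y : k | p.eval y ≠ 0} ⊆ (fun x : ι → k => x i) '' {x ∈ S | x ∘ j = t} := by
      intro y hy
      have hmem : (fun o : Option κ => o.elim y t) ∈ T' := by
        refine mem_closure_zariski_iff.mpr fun f hf => ?_
        rw [← vanishingIdeal_closure] at hf
        rw [heval]
        have : (optionEquivLeft k κ f).map (eval t) = 0 := by
          ext m
          rw [Polynomial.coeff_map, Polynomial.coeff_zero]
          exact mem_vanishingIdeal_iff_eval.mp (hcoeff f hf m) _ (subset_closure ht)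
        rw [this, Polynomial.eval_zero]
      obtain ⟨x, hxS, hx, -⟩ := hlift _ hmem (by rw [heval]; exact hy)
      refine ⟨x, ⟨hxS, ?_⟩, congrFun hx none⟩
      funext c
      exact congrFun hx (some c)
    have hinf : {y : k | p.eval y ≠ 0}.Infinite := by
      have h1 : {y : k | p.eval y = 0}.Finite := by
        refine (p.rootSet_finite k).subset fun y hy => ?_
        rw [Polynomial.mem_rootSet]
        exact ⟨hp, by simpa using hy⟩
      have h2 := h1.infinite_compl
      simpa [Set.compl_def] using h2
    exact hinf ((hfin'.image _).subset hsub)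

end Projection

/-! ### Polynomial frames for kernels of families of covectors. -/

section KernelFrame

variable {k : Type*} [Field k] {ι κ : Type*} [Fintype κ]

/-- The common kernel at `p` of a family of covectors with polynomial coefficients. -/
def kernelAt (L : Set (κ → MvPolynomial ι k)) (p : ι → k) : Submodule k (κ → k) where
  carrier := {w | ∀ l ∈ L, ∑ i, eval p (l i) * w i = 0}
  zero_mem' := by simp
  add_mem' := by
    intro v w hv hw l hl
    simp [mul_add, Finset.sum_add_distrib, hv l hl, hw l hl]
  smul_mem' := by
    intro c v hv l hl
    have : ∑ i, eval p (l i) * (c • v) i = c * ∑ i, eval p (l i) * v i := by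
      rw [Finset.mul_sum]
      exact Finset.sum_congr rfl fun i _ => by simp; ring
    rw [this, hv l hl, mul_zero]

theorem mem_kernelAt {L : Set (κ → MvPolynomial ι k)} {p : ι → k} {w : κ → k} :
    w ∈ kernelAt L p ↔ ∀ l ∈ L, ∑ i, eval p (l i) * w i = 0 := Iff.rfl

/-- Near a point, the common kernels of a family of polynomial covectors are contained in the span
of a polynomial frame of constant rank. -/
theorem exists_kernel_frame (L : Set (κ → MvPolynomial ι k)) (p₀ : ι → k) {e : ℕ}
    (he : Module.finrank k (kernelAt L p₀) = e) :
    ∃ (h : MvPolynomial ι k) (B : Fin e → κ → MvPolynomial ι k), eval p₀ h ≠ 0 ∧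
      ∀ p, eval p h ≠ 0 → LinearIndependent k (fun j i => eval p (B j i)) ∧
        kernelAt L p ≤ Submodule.span k (Set.range fun j i => eval p (B j i)) := by
  classical
  let lam : (κ → MvPolynomial ι k) → Module.Dual k (κ → k) := fun l =>
    ∑ i, eval p₀ (l i) • LinearMap.proj i
  have hlam : ∀ l w, lam l w = ∑ i, eval p₀ (l i) * w i := fun l w => by simp [lam]
  -- A maximal independent set of covectors at `p₀`; it has `card κ - e` elements.
  obtain ⟨b, hbL, hspan, hind⟩ := exists_linearIndependent k (lam '' L)
  have : Finite b := hind.finite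
  have : Fintype b := Fintype.ofFinite b
  have hK : kernelAt L p₀ =
      (Submodule.span k (Set.range (Subtype.val : b → _))).dualCoannihilator := by
    ext w
    rw [Subtype.range_coe, hspan, Submodule.mem_dualCoannihilator, mem_kernelAt]
    constructor
    · intro h φ hφ
      induction hφ using Submodule.span_induction with
      | mem φ hφ => obtain ⟨l, hl, rfl⟩ := hφ; rw [hlam]; exact h l hl
      | zero => simp
      | add φ ψ _ _ h1 h2 => simp [h1, h2]
      | smul c φ _ h1 => simp [h1]
    · intro h l hl
      rw [← hlam]
      exact h _ (Submodule.subset_span ⟨l, hl, rfl⟩)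
  have hcard : Fintype.card κ = Fintype.card (b ⊕ Fin e) := by
    have h1 := Subspace.finrank_add_finrank_dualCoannihilator_eq
      (Submodule.span k (Set.range (Subtype.val : b → Module.Dual k (κ → k))))
    rw [← hK, he, finrank_span_eq_card hind, Module.finrank_fintype_fun_eq_card] at h1
    rw [Fintype.card_sum, Fintype.card_fin]
    exact h1.symm
  let ε : κ ≃ b ⊕ Fin e := Fintype.equivOfCardEq hcard
  have hbL' : ∀ φ : b, ∃ l, l ∈ L ∧ lam l = φ := fun φ => hbL φ.2
  choose l hlL hl using hbL'
  let eK : kernelAt L p₀ ≃ₗ[k] (Fin e → k) := LinearEquiv.ofFinrankEq _ _ (by simp [he])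
  -- Coordinates on the kernel at `p₀`, extended by a retraction to forms `ρ`, supply `e` constant
  -- rows that complete the chosen covectors to a square matrix `M` invertible at `p₀`.
  obtain ⟨r, hr⟩ := (kernelAt L p₀).subtype.exists_leftInverse_of_injective
    (Submodule.ker_subtype _)
  let ρ : (κ → k) →ₗ[k] (Fin e → k) := eK.toLinearMap ∘ₗ r
  let row : b ⊕ Fin e → κ → MvPolynomial ι k :=
    Sum.elim l (fun j i => C (ρ (Pi.single i 1) j))
  let M : Matrix κ κ (MvPolynomial ι k) := Matrix.of fun i c => row (ε i) c
  let Mp : (ι → k) → Matrix κ κ k := fun p => M.map (eval p)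
  have hdet : ∀ p, eval p M.det = (Mp p).det := fun p => RingHom.map_det _ _
  have hadj : ∀ p i c, eval p (M.adjugate i c) = (Mp p).adjugate i c := fun p i c => by
    have := RingHom.map_adjugate (eval p) M
    exact congrFun (congrFun this i) c
  have hrow1 : ∀ p w (φ : b), (Mp p).mulVec w (ε.symm (Sum.inl φ)) =
      ∑ i, eval p (l φ i) * w i := fun p w φ => by
    simp [Mp, M, Matrix.mulVec, dotProduct, row]
  have hrow2 : ∀ p w (j : Fin e), (Mp p).mulVec w (ε.symm (Sum.inr j)) = ρ w j := by
    intro p w j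
    have h1 : w = ∑ i, w i • Pi.single i (1 : k) := by
      funext c; simp [Finset.sum_apply, Pi.single_apply]
    conv_rhs => rw [h1]
    simp [Mp, M, Matrix.mulVec, dotProduct, row, map_sum, mul_comm]
  -- Since `M * adjugate M = det M`, these columns are mapped to multiples of unit vectors. Where
  -- `det M ≠ 0` they span the kernel of the chosen covectors, which contains the common kernel.
  refine ⟨M.det, fun j i => M.adjugate i (ε.symm (Sum.inr j)), ?_, fun p hp => ⟨?_, ?_⟩⟩
  · rw [hdet]
    intro h0
    obtain ⟨w, hw, hMw⟩ := Matrix.exists_mulVec_eq_zero_iff.mpr h0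
    apply hw
    have hwK : w ∈ kernelAt L p₀ := by
      rw [hK, Submodule.mem_dualCoannihilator]
      intro φ hφ
      induction hφ using Submodule.span_induction with
      | mem φ hφ =>
        obtain ⟨φ, rfl⟩ := hφ
        have := hrow1 p₀ w φ
        rw [hMw] at this
        rw [← hl φ, hlam, ← this]; rfl
      | zero => simp
      | add φ ψ _ _ h1 h2 => simp [h1, h2]
      | smul c φ _ h1 => simp [h1]
    have h1 : r w = ⟨w, hwK⟩ := LinearMap.congr_fun hr ⟨w, hwK⟩
    have h2 : ρ w = 0 := by
      funext j
      rw [← hrow2 p₀ w j, hMw]; rfl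
    have h3 : (⟨w, hwK⟩ : kernelAt L p₀) = 0 := by
      have : eK ⟨w, hwK⟩ = 0 := by rw [← h1]; exact h2
      exact eK.map_eq_zero_iff.mp this
    exact congrArg Subtype.val h3
  · rw [hdet] at hp
    rw [Fintype.linearIndependent_iff]
    intro c hc j
    have h1 : (Mp p).mulVec
        (∑ j', c j' • fun i => (Mp p).adjugate i (ε.symm (Sum.inr j'))) = 0 := by
      have : (∑ j', c j' • fun i => (Mp p).adjugate i (ε.symm (Sum.inr j'))) = 0 := by
        rw [← hc]; simp only [hadj]
      rw [this, Matrix.mulVec_zero]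
    have h2 : ∀ j', (Mp p).mulVec (fun i => (Mp p).adjugate i (ε.symm (Sum.inr j'))) =
        fun i => (Mp p).det * (1 : Matrix κ κ k) i (ε.symm (Sum.inr j')) := fun j' => by
      funext i
      have := congrFun (congrFun (Matrix.mul_adjugate (Mp p)) i) (ε.symm (Sum.inr j'))
      rw [Matrix.mul_apply] at this
      simpa [Matrix.mulVec, dotProduct] using this
    rw [Matrix.mulVec_sum] at h1
    simp only [Matrix.mulVec_smul, h2] at h1
    have h3 := congrFun h1 (ε.symm (Sum.inr j))
    simpa [Finset.sum_apply, Matrix.one_apply, hp] using h3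
  · rw [hdet] at hp
    intro w hw
    have h1 : (Mp p).det • w =
        ∑ j, ρ w j • fun i => eval p (M.adjugate i (ε.symm (Sum.inr j))) := by
      have h2 : (Mp p).adjugate.mulVec ((Mp p).mulVec w) = (Mp p).det • w := by
        rw [Matrix.mulVec_mulVec, Matrix.adjugate_mul, Matrix.smul_mulVec, Matrix.one_mulVec]
      rw [← h2]
      funext i
      simp only [Matrix.mulVec, dotProduct, Finset.sum_apply, Pi.smul_apply, smul_eq_mul, hadj]
      rw [← ε.symm.sum_comp, Fintype.sum_sum_type, Finset.sum_eq_zero, zero_add]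
      · refine Finset.sum_congr rfl fun j _ => ?_
        have := hrow2 p w j
        rw [Matrix.mulVec, dotProduct] at this
        rw [this, mul_comm]
      · intro φ _
        have := hrow1 p w φ
        rw [Matrix.mulVec, dotProduct] at this
        rw [this, mem_kernelAt.mp hw _ (hlL φ), mul_zero]
    have h3 : w = (Mp p).det⁻¹ • ((Mp p).det • w) := by rw [smul_smul, inv_mul_cancel₀ hp, one_smul]
    rw [h3, h1]
    refine Submodule.smul_mem _ _ (Submodule.sum_mem _ fun j _ => Submodule.smul_mem _ _ ?_)
    exact Submodule.subset_span ⟨j, rfl⟩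

theorem finrank_kernelAt_le_of_frame {L : Set (κ → MvPolynomial ι k)} {p : ι → k} {e : ℕ}
    {B : Fin e → κ → k} (hle : kernelAt L p ≤ Submodule.span k (Set.range B)) :
    Module.finrank k (kernelAt L p) ≤ e :=
  (Submodule.finrank_mono hle).trans ((finrank_range_le_card B).trans (by simp))

/-- The common kernel of a family of polynomial covectors has constant dimension at a general point
of an arbitrary nonempty set. -/
theorem exists_forall_finrank_kernelAt_eq (L : Set (κ → MvPolynomial ι k)) {S : Set (ι → k)}
    (hS : S.Nonempty) :
    ∃ (m : ℕ) (h : MvPolynomial ι k), h ∉ vanishingIdeal k S ∧ ∀ p ∈ S, eval p h ≠ 0 →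
      Module.finrank k (kernelAt L p) = m := by
  -- Semicontinuity: the frame bounds the dimension near `p₀` from above by its value at `p₀`, and
  -- `p₀` realizes the minimum on `S`.
  let p₀ := Function.argminOn (fun p => Module.finrank k (kernelAt L p)) S hS
  have hp₀ : p₀ ∈ S := Function.argminOn_mem _ S hS
  obtain ⟨h, B, h0, hB⟩ := exists_kernel_frame L p₀ rfl
  refine ⟨Module.finrank k (kernelAt L p₀), h,
    fun hI => h0 (mem_vanishingIdeal_iff_eval.mp hI p₀ hp₀), fun p hp hph => ?_⟩
  refine le_antisymm (finrank_kernelAt_le_of_frame (hB p hph).2) ?_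
  exact Function.argminOn_le (fun p => Module.finrank k (kernelAt L p)) S hp

end KernelFrame

/-! ### Polynomial frames for tangent spaces. -/

section TangentFrame

variable {k : Type*} [Field k] {ι : Type*} [Fintype ι]

theorem kernelAt_pderiv (S : Set (ι → k)) (p : ι → k) :
    kernelAt ((fun f i => pderiv i f) '' (vanishingIdeal k S : Set (MvPolynomial ι k))) p =
      affineTangent S p := by
  ext w
  simp [mem_kernelAt, mem_affineTangent_iff, polyDifferential_apply]

/-- Near a point `p₀` of `S`, the tangent spaces of `S` are contained in the span of a polynomial
frame whose rank is the dimension of the tangent space at `p₀`. -/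
theorem exists_tangent_frame (S : Set (ι → k)) (p₀ : ι → k) {e : ℕ}
    (he : Module.finrank k (affineTangent S p₀) = e) :
    ∃ (h : MvPolynomial ι k) (B : Fin e → ι → MvPolynomial ι k), eval p₀ h ≠ 0 ∧
      ∀ p, eval p h ≠ 0 → LinearIndependent k (fun j i => eval p (B j i)) ∧
        affineTangent S p ≤ Submodule.span k (Set.range fun j i => eval p (B j i)) ∧
        (Module.finrank k (affineTangent S p) = e →
          affineTangent S p = Submodule.span k (Set.range fun j i => eval p (B j i))) := by
  rw [← kernelAt_pderiv] at he
  obtain ⟨h, B, h0, hB⟩ := exists_kernel_frame _ p₀ he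
  refine ⟨h, B, h0, fun p hp => ?_⟩
  obtain ⟨h1, h2⟩ := hB p hp
  rw [kernelAt_pderiv] at h2
  refine ⟨h1, h2, fun h3 => Submodule.eq_of_le_of_finrank_eq h2 ?_⟩
  rw [h3, finrank_span_eq_card h1, Fintype.card_fin]

end TangentFrame

/-! ### Locality of Krull dimension, and properties of general points. -/

section Topological

/-- An open neighbourhood of a point of the smallest member of a chain meets every member.
Intersecting irreducible closed sets with an open set they meet keeps the chain strict. -/
theorem topologicalKrullDim_le_of_forall_exists_open {X : Type*} [TopologicalSpace X] {Z : Set X}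
    {n : WithBot ℕ∞}
    (h : ∀ z ∈ Z, ∃ V : Set X, IsOpen V ∧ z ∈ V ∧ topologicalKrullDim ↥(Z ∩ V) ≤ n) :
    topologicalKrullDim ↥Z ≤ n := by
  refine iSup_le fun l => ?_
  obtain ⟨⟨z, hz⟩, hzl⟩ := l.head.isIrreducible'.1
  obtain ⟨V, hV, hzV, hle⟩ := h z hz
  refine le_trans ?_ hle
  let f : ↥(Z ∩ V) → ↥Z := fun x => ⟨x.1, x.2.1⟩
  have hf : IsOpenEmbedding f := by
    refine ⟨⟨?_, fun x y hxy => Subtype.ext (congrArg (fun z : ↥Z => z.1) hxy :)⟩, ?_⟩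
    · rw [← IsInducing.subtypeVal.of_comp_iff]
      exact IsInducing.subtypeVal
    · have : Set.range f = Subtype.val ⁻¹' V := by
        ext x
        exact ⟨fun ⟨y, hy⟩ => hy ▸ y.2.2, fun hx => ⟨⟨x.1, x.2, hx⟩, rfl⟩⟩
      rw [this]
      exact hV.preimage continuous_subtype_val
  have hne : ∀ i, (f ⁻¹' (l i : Set ↥Z)).Nonempty := fun i => by
    have hle : l.head ≤ l i := l.monotone (Fin.zero_le i)
    exact ⟨⟨z, hz, hzV⟩, hle hzl⟩
  let e := TopologicalSpace.IrreducibleCloseds.orderIsoOfIsOpenEmbedding f hf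
  let l' : LTSeries (TopologicalSpace.IrreducibleCloseds ↥(Z ∩ V)) :=
    { length := l.length
      toFun := fun i => e.symm ⟨l i, hne i⟩
      step := fun i => e.symm.strictMono (l.step i) }
  exact Order.LTSeries.length_le_krullDim l'

theorem topologicalKrullDim_eq_of_isEmbedding {X Y : Type*} [TopologicalSpace X]
    [TopologicalSpace Y] {f : X → Y} (hf : IsEmbedding f) (hs : Function.Surjective f) :
    topologicalKrullDim X = topologicalKrullDim Y :=
  IsHomeomorph.topologicalKrullDim_eq f (isHomeomorph_iff_isEmbedding_surjective.mpr ⟨hf, hs⟩)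

theorem ForGeneral.and {M : Type*} [TopologicalSpace M] {Z : Set M} (hZ : IsIrreducible Z)
    {P P' : M → Prop} (h : ForGeneral Z P) (h' : ForGeneral Z P') :
    ForGeneral Z fun z => P z ∧ P' z := by
  obtain ⟨U, hU, hne, hP⟩ := h
  obtain ⟨U', hU', hne', hP'⟩ := h'
  exact ⟨U ∩ U', hU.inter hU', hZ.2 U U' hU hU' hne hne',
    fun z hz => ⟨hP z ⟨hz.1, hz.2.1⟩, hP' z ⟨hz.1, hz.2.2⟩⟩⟩

theorem ForGeneral.mono {M : Type*} [TopologicalSpace M] {Z : Set M} {P P' : M → Prop}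
    (h : ForGeneral Z P) (hPP' : ∀ z ∈ Z, P z → P' z) : ForGeneral Z P' := by
  obtain ⟨U, hU, hne, hP⟩ := h
  exact ⟨U, hU, hne, fun z hz => hPP' z hz.1 (hP z hz)⟩

/-- A closed set containing a general point of an irreducible set contains the whole set. -/
theorem subset_of_forGeneral {M : Type*} [TopologicalSpace M] {Z C : Set M} (hZ : IsIrreducible Z)
    (hC : IsClosed C) (h : ForGeneral Z fun z => z ∈ C) : Z ⊆ C := by
  obtain ⟨U, hU, hne, hP⟩ := h
  intro z hz
  by_contra hzC
  obtain ⟨y, hy, hyU, hyC⟩ := hZ.2 U Cᶜ hU hC.isOpen_compl hne ⟨z, hz, hzC⟩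
  exact hyC (hP y ⟨hy, hyU⟩)

end Topological

/-! ### Affine slices as charts of Zariski quotients. -/

section Slice

variable {k : Type*} [Field k] {ι E M : Type*}

/-- A slice of a map `π : E → M`, where `E` is included in affine space by `e`: a closed subset of
affine space contained in `E` and meeting each fibre of `π` in at most one point, together with a
retraction `Q / δ` onto it, which is defined on a saturated open subset of `E`. -/
structure AffineSlice (e : E → ι → k) (π : E → M) where
  carrier : Set (ι → k)
  Q : ι → MvPolynomial ι k
  δ : MvPolynomial ι k
  isClosed' : ∃ J : Set (MvPolynomial ι k), carrier = {x | ∀ f ∈ J, eval x f = 0}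
  exists_eq : ∀ x ∈ carrier, ∃ p, e p = x
  eval_denom : ∀ x ∈ carrier, eval x δ = 1
  eval_num : ∀ x ∈ carrier, ∀ j, eval x (Q j) = x j
  saturated : ∀ p p₀, e p₀ ∈ carrier → π p = π p₀ → eval (e p) δ ≠ 0
  retract : ∀ p, eval (e p) δ ≠ 0 →
    ∃ p₀, e p₀ ∈ carrier ∧ π p₀ = π p ∧ ∀ j, eval (e p) (Q j) = eval (e p) δ * e p₀ j
  unique : ∀ p p₀, e p ∈ carrier → e p₀ ∈ carrier → π p = π p₀ → e p = e p₀

namespace AffineSlice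

variable {e : E → ι → k} {π : E → M} (s : AffineSlice e π)

attribute [local instance] zariski

theorem isClosed : IsClosed s.carrier := isClosed_zariski_iff.mpr s.isClosed'

/-- The point of `E` given by a point of the slice. -/
noncomputable def toE (x : s.carrier) : E := (s.exists_eq x.1 x.2).choose

theorem e_toE (x : s.carrier) : e (s.toE x) = x.1 := (s.exists_eq x.1 x.2).choose_spec

/-- The parametrization of an open subset of `M` by a slice. -/
noncomputable def param (x : s.carrier) : M := π (s.toE x)

/-- The part of the slice lying over a subset of `M`. -/
def part (Z : Set M) : Set (ι → k) := {x | x ∈ s.carrier ∧ ∃ p, e p = x ∧ π p ∈ Z}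

variable {s} in
theorem mem_part_iff (he : Function.Injective e) {Z : Set M} {p : E} :
    e p ∈ s.part Z ↔ e p ∈ s.carrier ∧ π p ∈ Z := by
  constructor
  · rintro ⟨h, p', hp', hZ⟩
    exact ⟨h, he hp' ▸ hZ⟩
  · rintro ⟨h, hZ⟩
    exact ⟨h, p, rfl, hZ⟩

theorem part_eq (he : Function.Injective e) (Z : Set M) :
    s.part Z = Subtype.val '' (s.param ⁻¹' Z) := by
  ext x
  constructor
  · rintro ⟨h, p, rfl, hZ⟩
    refine ⟨⟨e p, h⟩, ?_, rfl⟩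
    rw [Set.mem_preimage, param, he (s.e_toE ⟨e p, h⟩)]
    exact hZ
  · rintro ⟨x, hx, rfl⟩
    exact ⟨x.2, _, s.e_toE x, hx⟩

variable {s} in
/-- The differential of the retraction onto the slice maps the tangent spaces of the preimage of a
set `Z ⊆ M` to the tangent spaces of its slice. -/
theorem retract_mem_affineTangent [Fintype ι] {Z : Set M} {x w : ι → k}
    (hx : x ∈ s.carrier) (hxZ : x ∈ e '' (π ⁻¹' Z)) (hw : w ∈ affineTangent (e '' (π ⁻¹' Z)) x) :
    (fun j => polyDifferential (s.Q j) x w - x j * polyDifferential s.δ x w) ∈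
      affineTangent (s.part Z) x := by
  refine mem_affineTangent_iff.mpr fun g hg => ?_
  set dq : ι → k := fun j => polyDifferential (s.Q j) x w - x j * polyDifferential s.δ x w
  have hxpart : x ∈ s.part Z := by
    obtain ⟨p, hp, rfl⟩ := hxZ
    exact ⟨hx, p, rfl, hp⟩
  have hgx : eval x g = 0 := mem_vanishingIdeal_iff_eval.mp hg x hxpart
  -- Where `δ ≠ 0` this is a multiple of `g` at the retracted point, which lies on the slice of `Z`;
  -- where `δ = 0` the extra factor makes it vanish.
  have hf : s.δ * clearDenom s.Q s.δ g ∈ vanishingIdeal k (e '' (π ⁻¹' Z)) := by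
    rw [mem_vanishingIdeal_iff_eval]
    rintro _ ⟨p, hp, rfl⟩
    by_cases hδ : eval (e p) s.δ = 0
    · rw [map_mul, hδ, zero_mul]
    · obtain ⟨p₀, hp₀, hπ, hQ⟩ := s.retract p hδ
      rw [map_mul, eval_clearDenom _ _ _ _ _ hQ,
        mem_vanishingIdeal_iff_eval.mp hg (e p₀) ⟨hp₀, p₀, rfl, by rw [hπ]; exact hp⟩, mul_zero,
        mul_zero]
  have hδ1 := s.eval_denom x hx
  have hc0 : eval x (clearDenom s.Q s.δ g) = 0 := by
    rw [eval_clearDenom _ _ _ _ x (fun j => by rw [hδ1, one_mul, s.eval_num x hx]), hgx, mul_zero]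
  have hdc : polyDifferential (clearDenom s.Q s.δ g) x w = 0 := by
    have := mem_affineTangent_iff.mp hw _ hf
    rwa [polyDifferential_mul_apply, hδ1, hc0, one_mul, zero_mul, add_zero] at this
  let θ : MvPolynomial ι k →ₐ[k] TrivSqZeroExt k k :=
    aeval fun i => (TrivSqZeroExt.inl (x i) + TrivSqZeroExt.inr (w i) : TrivSqZeroExt k k)
  have hθ : ∀ g, θ g = TrivSqZeroExt.inl (eval x g) + TrivSqZeroExt.inr (polyDifferential g x w) :=
    fun g => aeval_dualNumber g x w
  -- At `x` one has `δ = 1` and `Q = x`, so over the dual numbers the retraction sends `x + εw` to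
  -- `x + ε dq` by the quotient rule.
  have h1 := algHom_clearDenom s.Q s.δ g θ
    (fun j => TrivSqZeroExt.inl (x j) + TrivSqZeroExt.inr (dq j)) (fun j => by
      rw [hθ, hθ, hδ1, s.eval_num x hx]
      ext
      · simp
      · simp [dq]
        ring)
  rw [aeval_dualNumber g x dq, hθ, hc0, hdc, hgx] at h1
  have hunit : IsUnit (θ s.δ) := by
    rw [TrivSqZeroExt.isUnit_iff_isUnit_fst, hθ, hδ1]
    simp
  have h2 := ((hunit.pow g.totalDegree).mul_right_eq_zero).mp (by rw [← h1]; simp)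
  simpa using congrArg TrivSqZeroExt.snd h2

variable [TopologicalSpace M]

/-- The topology of `M` is the quotient topology of the Zariski topology of `E`. -/
structure _root_.GaussGraph.IsZariskiQuotient (e : E → ι → k) (π : E → M) : Prop where
  injective : Function.Injective e
  isOpen_iff : ∀ V : Set M, IsOpen V ↔ ∃ U : Set (ι → k), IsOpen U ∧ e ⁻¹' U = π ⁻¹' V

variable {s}

/-- Injectivity is the uniqueness of slice representatives. For openness, the saturation of a basic
open set `g ≠ 0` of the slice is the basic open set given by `δ * clearDenom Q δ g`. -/
theorem isOpenEmbedding_param (hq : IsZariskiQuotient e π) : IsOpenEmbedding s.param := by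
  refine IsOpenEmbedding.of_continuous_injective_isOpenMap ?_ ?_ ?_
  · refine continuous_def.mpr fun V hV => ?_
    obtain ⟨U, hU, hUV⟩ := (hq.isOpen_iff V).mp hV
    have : s.param ⁻¹' V = Subtype.val ⁻¹' U := by
      ext x
      have h1 : s.toE x ∈ e ⁻¹' U ↔ s.toE x ∈ π ⁻¹' V := by rw [hUV]
      rw [Set.mem_preimage, s.e_toE] at h1
      exact h1.symm
    rw [this]
    exact hU.preimage continuous_subtype_val
  · intro x y hxy
    have := s.unique (s.toE x) (s.toE y) (by rw [s.e_toE]; exact x.2)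
      (by rw [s.e_toE]; exact y.2) hxy
    rw [s.e_toE, s.e_toE] at this
    exact Subtype.ext this
  · intro U hU
    obtain ⟨U', hU', rfl⟩ := isOpen_induced_iff.mp hU
    rw [isOpen_iff_forall_mem_open]
    rintro _ ⟨x, hx, rfl⟩
    obtain ⟨g, hg, hgU⟩ := exists_basic_subset hU' hx
    refine ⟨s.param '' {y | eval y.1 g ≠ 0}, Set.image_mono fun y hy => hgU _ hy, ?_,
      ⟨x, hg, rfl⟩⟩
    rw [hq.isOpen_iff]
    refine ⟨_, isOpen_basic (s.δ * clearDenom s.Q s.δ g), ?_⟩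
    ext p
    simp only [Set.mem_preimage, Set.mem_ofPred_eq, map_mul, mul_ne_zero_iff]
    constructor
    · rintro ⟨hδ, hc⟩
      obtain ⟨p₀, hp₀, hπ, hQ⟩ := s.retract p hδ
      rw [eval_clearDenom _ _ _ _ _ hQ] at hc
      refine ⟨⟨e p₀, hp₀⟩, right_ne_zero_of_mul hc, ?_⟩
      rw [← hπ, param, hq.injective (s.e_toE ⟨e p₀, hp₀⟩)]
    · rintro ⟨y, hy, hyp⟩
      have hδ : eval (e p) s.δ ≠ 0 := s.saturated p (s.toE y) (by rw [s.e_toE]; exact y.2) hyp.symm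
      refine ⟨hδ, ?_⟩
      obtain ⟨p₀, hp₀, hπ, hQ⟩ := s.retract p hδ
      rw [eval_clearDenom _ _ _ _ _ hQ]
      have : e p₀ = y.1 := by
        rw [← s.e_toE y]
        exact s.unique p₀ (s.toE y) hp₀ (by rw [s.e_toE]; exact y.2) (hπ.trans hyp.symm)
      rw [this]
      exact mul_ne_zero (pow_ne_zero _ hδ) hy

theorem mem_range_param (hq : IsZariskiQuotient e π) {p : E} (hp : e p ∈ s.carrier) :
    π p ∈ Set.range s.param :=
  ⟨⟨e p, hp⟩, by rw [param, hq.injective (s.e_toE ⟨e p, hp⟩)]⟩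

theorem isClosed_part (hq : IsZariskiQuotient e π) {Z : Set M} (hZ : IsClosed Z) :
    IsClosed (s.part Z) := by
  rw [s.part_eq hq.injective]
  exact s.isClosed.isClosedEmbedding_subtypeVal.isClosedMap _
    (hZ.preimage (isOpenEmbedding_param hq).continuous)

theorem isIrreducible_part (hq : IsZariskiQuotient e π) {Z : Set M} (hZ : IsIrreducible Z)
    (hne : (s.part Z).Nonempty) : IsIrreducible (s.part Z) := by
  rw [s.part_eq hq.injective] at hne ⊢
  refine IsIrreducible.image ?_ _ continuous_subtype_val.continuousOn
  refine hZ.preimage (isOpenEmbedding_param hq) ?_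
  obtain ⟨_, x, hx, rfl⟩ := hne
  exact ⟨_, hx, x, rfl⟩

variable (s) in
-- Irreducibility makes every open set meeting `Z` also meet the chart, so a general point can be
-- sought on the slice, outside one polynomial hypersurface.
theorem forGeneral_iff (hq : IsZariskiQuotient e π) {Z : Set M} (hZ : IsIrreducible Z)
    (hne : (s.part Z).Nonempty) {P : M → Prop} :
    ForGeneral Z P ↔ ∃ h ∉ vanishingIdeal k (s.part Z),
      ∀ p, e p ∈ s.part Z → eval (e p) h ≠ 0 → P (π p) := by
  have hmem : ∀ x : s.carrier, s.param x ∈ Z → x.1 ∈ s.part Z := fun x hx =>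
    ⟨x.2, _, s.e_toE x, hx⟩
  constructor
  · rintro ⟨U, hU, hneU, hP⟩
    obtain ⟨z, hz, hzU, ⟨x, rfl⟩⟩ := hZ.2 U (Set.range s.param) hU
      (isOpenEmbedding_param hq).isOpen_range hneU (by
        obtain ⟨x, hx, p, rfl, hpZ⟩ := hne
        exact ⟨_, hpZ, mem_range_param hq hx⟩)
    obtain ⟨U', hU', hUU'⟩ := (hq.isOpen_iff U).mp hU
    have hmemU : ∀ p, e p ∈ U' ↔ π p ∈ U := fun p => by
      have : p ∈ e ⁻¹' U' ↔ p ∈ π ⁻¹' U := by rw [hUU']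
      exact this
    have hxU : x.1 ∈ U' := by rw [← s.e_toE x, hmemU]; exact hzU
    obtain ⟨h, hh, hhU⟩ := exists_basic_subset hU' hxU
    refine ⟨h, fun hI => hh (mem_vanishingIdeal_iff_eval.mp hI _ (hmem x hz)), fun p hp hph => ?_⟩
    exact hP _ ⟨((mem_part_iff hq.injective).mp hp).2, (hmemU p).mp (hhU _ hph)⟩
  · rintro ⟨h, hh, hP⟩
    refine ⟨s.param '' {x | eval x.1 h ≠ 0}, ?_, ?_, ?_⟩
    · exact (isOpenEmbedding_param hq).isOpenMap _
        ((isOpen_basic h).preimage continuous_subtype_val)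
    · obtain ⟨x, hx, hxh⟩ := exists_mem_eval_ne_zero hh
      obtain ⟨hxs, p, rfl, hpZ⟩ := hx
      exact ⟨_, hpZ, ⟨e p, hxs⟩, hxh, by rw [param, hq.injective (s.e_toE ⟨e p, hxs⟩)]⟩
    · rintro _ ⟨hz, x, hx, rfl⟩
      refine hP (s.toE x) ?_ ?_
      · rw [s.e_toE]; exact hmem x hz
      · rw [s.e_toE]; exact hx

/-- The dimension of the part of the slice over an open set. -/
theorem topologicalKrullDim_inter (hq : IsZariskiQuotient e π) [IsAlgClosed k] [Finite ι]
    {Z V : Set M} (hZ : IsClosed Z) (hirr : IsIrreducible Z) (hV : IsOpen V)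
    (hVs : V ⊆ Set.range s.param)
    (hne : (Z ∩ V).Nonempty) : topologicalKrullDim ↥(Z ∩ V) = (affDim (s.part Z) : ℕ) := by
  obtain ⟨z, hz, hzV⟩ := hne
  obtain ⟨x₀, rfl⟩ := hVs hzV
  have hmem : ∀ x : s.carrier, s.param x ∈ Z → x.1 ∈ s.part Z := fun x hx =>
    ⟨x.2, _, s.e_toE x, hx⟩
  obtain ⟨U, hU, hUV⟩ := isOpen_induced_iff.mp (hV.preimage (isOpenEmbedding_param hq).continuous)
  have hmemU : ∀ x : s.carrier, x.1 ∈ U ↔ s.param x ∈ V := fun x => by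
    have : x ∈ Subtype.val ⁻¹' U ↔ x ∈ s.param ⁻¹' V := by rw [hUV]
    exact this
  rw [← topologicalKrullDim_inter_open (isClosed_part hq hZ)
    (isIrreducible_part hq hirr ⟨_, hmem x₀ hz⟩) hU ⟨x₀.1, hmem x₀ hz, (hmemU x₀).mpr hzV⟩]
  have hmemZ : ∀ x : ↥(s.part Z ∩ U), s.param ⟨x.1, x.2.1.1⟩ ∈ Z := fun x => by
    obtain ⟨p, hp, hpZ⟩ := x.2.1.2
    rw [param, hq.injective ((s.e_toE ⟨x.1, x.2.1.1⟩).trans hp.symm)]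
    exact hpZ
  let f : ↥(s.part Z ∩ U) → ↥(Z ∩ V) := fun x =>
    ⟨s.param ⟨x.1, x.2.1.1⟩, hmemZ x, (hmemU _).mp x.2.2⟩
  symm
  refine topologicalKrullDim_eq_of_isEmbedding (f := f) ?_ ?_
  · have h1 : IsEmbedding (Subtype.val ∘ f) := by
      have h2 : IsEmbedding fun x : ↥(s.part Z ∩ U) => (⟨x.1, x.2.1.1⟩ : s.carrier) :=
        IsEmbedding.of_comp (by
          exact continuous_induced_rng.mpr continuous_subtype_val) continuous_subtype_val
          IsEmbedding.subtypeVal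
      exact (isOpenEmbedding_param hq).isEmbedding.comp h2
    exact IsEmbedding.of_comp (continuous_induced_rng.mpr h1.continuous) continuous_subtype_val h1
  · rintro ⟨z, hz, hzV⟩
    obtain ⟨x, rfl⟩ := hVs hzV
    exact ⟨⟨x.1, hmem x hz, (hmemU x).mpr hzV⟩, rfl⟩

/-- The dimension of an irreducible closed set is the dimension of any nonempty slice of it, if all
points lie on slices. -/
theorem topologicalKrullDim_eq_affDim (hq : IsZariskiQuotient e π) [IsAlgClosed k] [Finite ι]
    (hcover : ∀ z : M, ∃ (s' : AffineSlice e π) (p : E), π p = z ∧ e p ∈ s'.carrier) {Z : Set M}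
    (hZ : IsClosed Z) (hirr : IsIrreducible Z) (hne : (s.part Z).Nonempty) :
    topologicalKrullDim ↥Z = (affDim (s.part Z) : ℕ) := by
  obtain ⟨x, hx, p, rfl, hpZ⟩ := hne
  have hopen := fun s' : AffineSlice e π => (isOpenEmbedding_param (s := s') hq).isOpen_range
  have hne' : (Z ∩ Set.range s.param).Nonempty := ⟨π p, hpZ, mem_range_param hq hx⟩
  apply le_antisymm
  · refine topologicalKrullDim_le_of_forall_exists_open fun z hz => ?_
    obtain ⟨s', p', rfl, hp'⟩ := hcover z
    have hzs' := mem_range_param hq hp'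
    refine ⟨Set.range s'.param, hopen s', hzs', ?_⟩
    -- The overlap of the two charts has the dimension of either slice, so all slices of `Z` have
    -- the same dimension.
    have h1 : (Z ∩ (Set.range s.param ∩ Set.range s'.param)).Nonempty :=
      hirr.2 _ _ (hopen s) (hopen s') hne' ⟨_, hz, hzs'⟩
    rw [topologicalKrullDim_inter hq hZ hirr (hopen s') le_rfl ⟨_, hz, hzs'⟩,
      ← topologicalKrullDim_inter (s := s') hq hZ hirr ((hopen s).inter (hopen s'))
        Set.inter_subset_right h1,
      topologicalKrullDim_inter (s := s) hq hZ hirr ((hopen s).inter (hopen s'))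
        Set.inter_subset_left h1]
  · rw [← topologicalKrullDim_inter (s := s) hq hZ hirr (hopen s) le_rfl hne']
    have : IsInducing fun x : ↥(Z ∩ Set.range s.param) => (⟨x.1, x.2.1⟩ : ↥Z) := by
      rw [← IsInducing.subtypeVal.of_comp_iff]
      exact IsInducing.subtypeVal
    exact this.topologicalKrullDim_le

end AffineSlice

end Slice

/-! ### Linear forms as polynomials. -/

section LinearPolynomial

variable {k : Type*} [Field k] {ι : Type*} {N : ℕ}

/-- The linear polynomial in the variables `j c` given by a linear form. -/
noncomputable def linPoly (φ : Module.Dual k (Vec k N)) (j : Fin (N + 1) → ι) : MvPolynomial ι k :=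
  ∑ c, C (φ (Pi.single c 1)) * X (j c)

theorem dual_apply_eq_sum (φ : Module.Dual k (Vec k N)) (v : Vec k N) :
    φ v = ∑ c, φ (Pi.single c 1) * v c := by
  conv_lhs => rw [show v = ∑ c, v c • Pi.single c (1 : k) by
    funext c; simp [Finset.sum_apply, Pi.single_apply]]
  simp [map_sum, mul_comm]

theorem eval_linPoly (φ : Module.Dual k (Vec k N)) (j : Fin (N + 1) → ι) (x : ι → k) :
    eval x (linPoly φ j) = φ (x ∘ j) := by
  rw [dual_apply_eq_sum]
  simp [linPoly]

theorem polyDifferential_sum_apply {σ : Type*} [Fintype ι] (t : Finset σ)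
    (f : σ → MvPolynomial ι k) (p w : ι → k) :
    polyDifferential (∑ i ∈ t, f i) p w = ∑ i ∈ t, polyDifferential (f i) p w := by
  classical
  induction t using Finset.induction_on with
  | empty => simpa using polyDifferential_C_apply (0 : k) p w
  | insert a t ha ih =>
    rw [Finset.sum_insert ha, Finset.sum_insert ha, polyDifferential_add, LinearMap.add_apply, ih]

theorem polyDifferential_linPoly_apply [Fintype ι] (φ : Module.Dual k (Vec k N))
    (j : Fin (N + 1) → ι) (x w : ι → k) :
    polyDifferential (linPoly φ j) x w = φ (w ∘ j) := by
  rw [dual_apply_eq_sum, linPoly, polyDifferential_sum_apply]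
  refine Finset.sum_congr rfl fun c _ => ?_
  rw [polyDifferential_mul_apply, polyDifferential_C_apply, polyDifferential_X_apply]
  simp

end LinearPolynomial

/-! ### Affine charts of projective space. -/

section ProjSlice

variable {k : Type*} [Field k] {N : ℕ}

theorem isZariskiQuotient_toProj :
    IsZariskiQuotient (fun v : Punctured k N => v.1) (toProj (k := k) (N := N)) where
  injective := Subtype.val_injective
  isOpen_iff V := by
    rw [isOpen_coinduced]
    exact @isOpen_induced_iff _ _ (zariski k _) _ _

theorem isZariskiQuotient_toGrassProj {r : ℕ} :
    IsZariskiQuotient (fun p : Frame k r N => coords p.1.1 p.1.2)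
      (toGrassProj (k := k) (r := r) (N := N)) where
  injective p q h := by
    refine Subtype.ext (Prod.ext ?_ ?_)
    · funext i c
      exact congrFun h (Sum.inl (i, c))
    · funext c
      exact congrFun h (Sum.inr c)
  isOpen_iff V := by
    rw [isOpen_coinduced]
    exact @isOpen_induced_iff _ _ (zariski k _) _ _

theorem toProj_eq_iff {v w : Punctured k N} :
    toProj v = toProj w ↔ ∃ c : k, c ≠ 0 ∧ v.1 = c • w.1 := by
  rw [toProj, toProj]
  erw [Projectivization.mk_eq_mk_iff']
  constructor
  · rintro ⟨c, hc⟩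
    refine ⟨c, ?_, hc.symm⟩
    rintro rfl
    exact v.2 (by rw [← hc, zero_smul])
  · rintro ⟨c, -, hc⟩
    exact ⟨c, hc.symm⟩

theorem cone_eq (X : Set (ProjSpace k N)) :
    cone X = (fun v : Punctured k N => v.1) '' (toProj ⁻¹' X) := by
  ext v
  constructor
  · rintro ⟨h, hX⟩
    exact ⟨⟨v, h⟩, hX, rfl⟩
  · rintro ⟨w, hw, rfl⟩
    exact ⟨w.2, hw⟩

/-- The slice of `k^(N+1) ∖ {0} → ℙ^N` given by an affine hyperplane. -/
noncomputable def projSlice (β : Module.Dual k (Vec k N)) :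
    AffineSlice (fun v : Punctured k N => v.1) (toProj (k := k) (N := N)) where
  carrier := {x | β x = 1}
  Q := X
  δ := linPoly β id
  isClosed' := ⟨{linPoly β id - 1}, by ext x; simp [eval_linPoly, sub_eq_zero]⟩
  exists_eq x hx := ⟨⟨x, fun h => by
    simp only [Set.mem_ofPred_eq, h, map_zero] at hx
    exact zero_ne_one hx⟩, rfl⟩
  eval_denom x hx := by rw [eval_linPoly]; exact hx
  eval_num x _ j := eval_X j
  saturated p p₀ h0 hp := by
    obtain ⟨c, hc, h⟩ := toProj_eq_iff.mp hp
    rw [eval_linPoly, Function.comp_id, h, map_smul, smul_eq_mul, show β p₀.1 = 1 from h0, mul_one]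
    exact hc
  retract p hp := by
    rw [eval_linPoly, Function.comp_id] at hp
    refine ⟨⟨(β p.1)⁻¹ • p.1, smul_ne_zero (inv_ne_zero hp) p.2⟩, ?_, ?_, ?_⟩
    · simp [hp]
    · exact toProj_eq_iff.mpr ⟨(β p.1)⁻¹, inv_ne_zero hp, rfl⟩
    · intro j
      rw [eval_linPoly, Function.comp_id, eval_X]
      change p.1 j = β p.1 * ((β p.1)⁻¹ * p.1 j)
      rw [mul_inv_cancel_left₀ hp]
  unique p p₀ hp hp₀ h := by
    obtain ⟨c, hc, h⟩ := toProj_eq_iff.mp h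
    have h1 : β p.1 = c * β p₀.1 := by rw [h, map_smul, smul_eq_mul]
    rw [show β p.1 = 1 from hp, show β p₀.1 = 1 from hp₀, mul_one] at h1
    rw [h, ← h1, one_smul]

theorem exists_dual_eq_one {v : Vec k N} (hv : v ≠ 0) : ∃ β : Module.Dual k (Vec k N), β v = 1 := by
  obtain ⟨c, hc⟩ := Function.ne_iff.mp hv
  exact ⟨(v c)⁻¹ • LinearMap.proj c, by simpa using inv_mul_cancel₀ hc⟩

theorem toProj_surjective : Function.Surjective (toProj (k := k) (N := N)) := by
  intro x
  induction x using Projectivization.ind with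
  | h v hv => exact ⟨⟨v, hv⟩, rfl⟩

theorem exists_mem_projSlice (x : ProjSpace k N) :
    ∃ (s : AffineSlice (fun v : Punctured k N => v.1) (toProj (k := k) (N := N)))
      (p : Punctured k N), toProj p = x ∧ p.1 ∈ s.carrier := by
  obtain ⟨v, rfl⟩ := toProj_surjective x
  obtain ⟨β, hβ⟩ := exists_dual_eq_one v.2
  exact ⟨projSlice β, v, rfl, hβ⟩

end ProjSlice

/-! ### Affine charts of `Grass × ℙ^N` by normalized frames. -/

section FrameSlice

variable {k : Type*} [Field k] {r N : ℕ}

/-- The `i`-th vector of a list of vectors. -/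
abbrev rowAt (i : Fin r) : ((Fin r × Fin (N + 1)) ⊕ Fin (N + 1) → k) →ₗ[k] Vec k N :=
  LinearMap.funLeft k k fun c => Sum.inl (i, c)

/-- The last vector of a list of vectors. -/
abbrev vecAt : ((Fin r × Fin (N + 1)) ⊕ Fin (N + 1) → k) →ₗ[k] Vec k N :=
  LinearMap.funLeft k k Sum.inr

theorem rowAt_coords (A : Fin r → Vec k N) (v : Vec k N) (i : Fin r) :
    rowAt i (coords A v) = A i := rfl

theorem vecAt_coords (A : Fin r → Vec k N) (v : Vec k N) : vecAt (coords A v) = v := rfl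

theorem coords_rowAt_vecAt (x : (Fin r × Fin (N + 1)) ⊕ Fin (N + 1) → k) :
    coords (fun i => rowAt i x) (vecAt x) = x := by
  funext j
  rcases j with ⟨i, c⟩ | c <;> rfl

theorem toGrassProj_eq_iff {p q : Frame k r N} :
    toGrassProj p = toGrassProj q ↔
      Submodule.span k (Set.range p.1.1) = Submodule.span k (Set.range q.1.1) ∧
        ∃ c : k, c ≠ 0 ∧ p.1.2 = c • q.1.2 := by
  rw [← toProj_eq_iff (v := ⟨p.1.2, p.2.2⟩) (w := ⟨q.1.2, q.2.2⟩), toGrassProj, toGrassProj]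
  erw [Prod.mk.injEq, Subtype.mk.injEq]

/-- The combinations of a list of vectors given by the rows of a square matrix. -/
def combine (g : Matrix (Fin r) (Fin r) k) (A : Fin r → Vec k N) : Fin r → Vec k N :=
  fun i => ∑ l, g i l • A l

theorem linearIndependent_combine {g : Matrix (Fin r) (Fin r) k} (hg : g.det ≠ 0)
    {A : Fin r → Vec k N} (hA : LinearIndependent k A) : LinearIndependent k (combine g A) := by
  rw [Fintype.linearIndependent_iff] at hA ⊢
  intro c hc i
  have h1 : Matrix.vecMul c g = 0 := by
    funext l
    refine hA (Matrix.vecMul c g) ?_ l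
    rw [← hc]
    simp only [combine, Matrix.vecMul, dotProduct, Finset.sum_smul, Finset.smul_sum, smul_smul]
    exact Finset.sum_comm
  by_contra hci
  exact hg (Matrix.exists_vecMul_eq_zero_iff.mp ⟨c, fun h => hci (congrFun h i), h1⟩)

theorem span_combine {g : Matrix (Fin r) (Fin r) k} (hg : g.det ≠ 0)
    {A : Fin r → Vec k N} (hA : LinearIndependent k A) :
    Submodule.span k (Set.range (combine g A)) = Submodule.span k (Set.range A) := by
  refine Submodule.eq_of_le_of_finrank_eq ?_ ?_
  · rw [Submodule.span_le]
    rintro _ ⟨i, rfl⟩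
    exact Submodule.sum_mem _ fun l _ => Submodule.smul_mem _ _ (Submodule.subset_span ⟨l, rfl⟩)
  · rw [finrank_span_eq_card hA, finrank_span_eq_card (linearIndependent_combine hg hA)]

theorem mem_span_range_iff {A : Fin r → Vec k N} {u : Vec k N} :
    u ∈ Submodule.span k (Set.range A) ↔ ∃ a : Fin r → k, ∑ i, a i • A i = u := by
  rw [Submodule.mem_span_range_iff_exists_fun]

theorem eq_sum_of_mem_span {α : Fin r → Module.Dual k (Vec k N)} {A : Fin r → Vec k N}
    (hα : ∀ i j, α j (A i) = if i = j then 1 else 0) {u : Vec k N}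
    (hu : u ∈ Submodule.span k (Set.range A)) : u = ∑ i, α i u • A i := by
  obtain ⟨a, rfl⟩ := mem_span_range_iff.mp hu
  refine Finset.sum_congr rfl fun i _ => ?_
  simp [map_sum, hα]

theorem linearIndependent_of_dual {α : Fin r → Module.Dual k (Vec k N)} {A : Fin r → Vec k N}
    (hα : ∀ i j, α j (A i) = if i = j then 1 else 0) : LinearIndependent k A := by
  rw [Fintype.linearIndependent_iff]
  intro c hc i
  have := congrArg (α i) hc
  simpa [map_sum, hα] using this

theorem exists_dual_family {A : Fin r → Vec k N} (hA : LinearIndependent k A) :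
    ∃ α : Fin r → Module.Dual k (Vec k N), ∀ i j, α j (A i) = if i = j then 1 else 0 := by
  obtain ⟨g, hg⟩ := LinearMap.exists_extend
    (hA.repr : Submodule.span k (Set.range A) →ₗ[k] (Fin r →₀ k))
  refine ⟨fun j => Finsupp.lapply j ∘ₗ g, fun i j => ?_⟩
  have h1 : g (A i) = hA.repr ⟨A i, Submodule.subset_span ⟨i, rfl⟩⟩ :=
    LinearMap.congr_fun hg ⟨A i, Submodule.subset_span ⟨i, rfl⟩⟩
  rw [LinearMap.comp_apply, h1, hA.repr_eq_single i _ rfl]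
  simp [Finsupp.single_apply]

variable (α : Fin r → Module.Dual k (Vec k N)) (β : Module.Dual k (Vec k N))

/-- The matrix of the values of the linear forms `α` on the vectors of a frame. -/
noncomputable def pairingMatrix :
    Matrix (Fin r) (Fin r) (MvPolynomial ((Fin r × Fin (N + 1)) ⊕ Fin (N + 1)) k) :=
  Matrix.of fun i j => linPoly (α j) fun c => Sum.inl (i, c)

theorem map_pairingMatrix (x : (Fin r × Fin (N + 1)) ⊕ Fin (N + 1) → k) :
    (pairingMatrix α).map (eval x) = Matrix.of fun i j => α j (rowAt i x) := by
  ext i j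
  simp only [pairingMatrix, Matrix.map_apply, Matrix.of_apply, eval_linPoly]
  rfl

theorem eval_det_pairingMatrix (x : (Fin r × Fin (N + 1)) ⊕ Fin (N + 1) → k) :
    eval x (pairingMatrix α).det = (Matrix.of fun i j => α j (rowAt i x)).det := by
  rw [RingHom.map_det, ← map_pairingMatrix]; rfl

theorem eval_adjugate_pairingMatrix (x : (Fin r × Fin (N + 1)) ⊕ Fin (N + 1) → k) (i l : Fin r) :
    eval x ((pairingMatrix α).adjugate i l) =
      (Matrix.of fun i j => α j (rowAt i x)).adjugate i l := by
  rw [← map_pairingMatrix]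
  exact congrFun (congrFun (RingHom.map_adjugate (eval x) (pairingMatrix α)) i) l

/-- The slice of the space of frames given by linear forms `α` and `β`: the frames `(A, v)` such
that `A` is dual to `α` and `β v = 1`. -/
noncomputable def frameSlice :
    AffineSlice (fun p : Frame k r N => coords p.1.1 p.1.2)
      (toGrassProj (k := k) (r := r) (N := N)) where
  carrier := {x | (∀ i j, α j (rowAt i x) = if i = j then 1 else 0) ∧ β (vecAt x) = 1}
  -- With `m = (α j (A i))` the retraction is `(A, v) ↦ (m⁻¹ A, v / β v)`; these are its numerators
  -- over the common denominator `det m * β v`.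
  Q := Sum.elim
    (fun ic => linPoly β Sum.inr * ∑ l, (pairingMatrix α).adjugate ic.1 l * X (Sum.inl (l, ic.2)))
    (fun c => (pairingMatrix α).det * X (Sum.inr c))
  δ := (pairingMatrix α).det * linPoly β Sum.inr
  isClosed' := by
    refine ⟨insert (linPoly β Sum.inr - 1) (Set.range fun ij : Fin r × Fin r =>
      linPoly (α ij.2) (fun c => Sum.inl (ij.1, c)) - C (if ij.1 = ij.2 then 1 else 0)), ?_⟩
    ext x
    have h1 : ∀ i, x ∘ (fun c => Sum.inl (i, c)) = rowAt i x := fun i => rfl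
    have h2 : x ∘ Sum.inr = vecAt x := rfl
    simp only [Set.mem_ofPred_eq, Set.forall_mem_insert, Set.forall_mem_range, map_sub,
      eval_linPoly, eval_C, map_one, sub_eq_zero, Prod.forall, h1, h2]
    exact and_comm
  exists_eq x hx := by
    refine ⟨⟨(fun i => rowAt i x, vecAt x), linearIndependent_of_dual hx.1, fun h => ?_⟩,
      coords_rowAt_vecAt x⟩
    have := hx.2
    rw [show vecAt x = 0 from h, map_zero] at this
    exact zero_ne_one this
  eval_denom x hx := by
    have h1 : (Matrix.of fun i j => α j (rowAt i x)) = 1 := by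
      ext i j; rw [Matrix.of_apply, hx.1, Matrix.one_apply]
    rw [map_mul, eval_det_pairingMatrix, h1, Matrix.det_one, eval_linPoly, one_mul]
    exact hx.2
  eval_num x hx j := by
    have h1 : (Matrix.of fun i j => α j (rowAt i x)) = 1 := by
      ext i j; rw [Matrix.of_apply, hx.1, Matrix.one_apply]
    rcases j with ⟨i, c⟩ | c
    · have h2 : eval x (linPoly β Sum.inr) = 1 := by rw [eval_linPoly]; exact hx.2
      simp only [Sum.elim_inl, map_mul, map_sum, h2, eval_adjugate_pairingMatrix, h1,
        Matrix.adjugate_one, Matrix.one_apply, eval_X, one_mul, ite_mul, zero_mul,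
        Finset.sum_ite_eq, Finset.mem_univ, if_true]
    · rw [Sum.elim_inr, map_mul, eval_det_pairingMatrix, h1, Matrix.det_one, one_mul, eval_X]
  saturated p p₀ h0 hp := by
    obtain ⟨hspan, c, hc, hv⟩ := toGrassProj_eq_iff.mp hp
    rw [map_mul, eval_det_pairingMatrix, eval_linPoly]
    refine mul_ne_zero (fun hdet => ?_) ?_
    -- A relation among the rows of `m` gives a vector of the subspace killed by all `α j`, hence
    -- zero, contradicting the independence of the frame.
    · obtain ⟨a, ha, h1⟩ := Matrix.exists_vecMul_eq_zero_iff.mpr hdet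
      have h2 : ∑ i, a i • p.1.1 i ∈ Submodule.span k (Set.range p₀.1.1) := by
        rw [← hspan]; exact mem_span_range_iff.mpr ⟨a, rfl⟩
      have h3 := eq_sum_of_mem_span h0.1 h2
      have h4 : ∀ j, α j (∑ i, a i • p.1.1 i) = 0 := fun j => by
        rw [map_sum]
        simp only [map_smul, smul_eq_mul]
        exact congrFun h1 j
      simp only [h4, zero_smul, Finset.sum_const_zero] at h3
      exact ha (funext fun i => (Fintype.linearIndependent_iff.mp p.2.1) a h3 i)
    · have h1 : β p₀.1.2 = 1 := h0.2
      change β p.1.2 ≠ 0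
      rw [hv, map_smul, h1, smul_eq_mul, mul_one]
      exact hc
  retract p hp := by
    rw [map_mul, eval_det_pairingMatrix, eval_linPoly] at hp
    set m : Matrix (Fin r) (Fin r) k :=
      Matrix.of fun i j => α j (rowAt i (coords p.1.1 p.1.2)) with hm
    have hdet : m.det ≠ 0 := left_ne_zero_of_mul hp
    have hβ : β p.1.2 ≠ 0 := right_ne_zero_of_mul hp
    have hdet' : (m⁻¹).det ≠ 0 := by
      rw [Matrix.det_nonsing_inv, Ring.inverse_eq_inv']
      exact inv_ne_zero hdet
    have hinv : ∀ i l, m.det * m⁻¹ i l = m.adjugate i l := fun i l => by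
      rw [Matrix.inv_def, Ring.inverse_eq_inv', Matrix.smul_apply, smul_eq_mul,
        mul_inv_cancel_left₀ hdet]
    refine ⟨⟨(combine m⁻¹ p.1.1, (β p.1.2)⁻¹ • p.1.2), linearIndependent_combine hdet' p.2.1,
      smul_ne_zero (inv_ne_zero hβ) p.2.2⟩, ⟨fun i j => ?_, ?_⟩, ?_, ?_⟩
    · rw [rowAt_coords]
      have h1 : (m⁻¹ * m) i j = (1 : Matrix (Fin r) (Fin r) k) i j := by
        rw [Matrix.nonsing_inv_mul _ (isUnit_iff_ne_zero.mpr hdet)]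
      rw [Matrix.mul_apply, Matrix.one_apply] at h1
      rw [← h1]
      simp only [combine, map_sum, map_smul, smul_eq_mul]
      rfl
    · rw [vecAt_coords, map_smul, smul_eq_mul, inv_mul_cancel₀ hβ]
    · exact toGrassProj_eq_iff.mpr ⟨span_combine hdet' p.2.1, _, inv_ne_zero hβ, rfl⟩
    · rintro (⟨i, c⟩ | c)
      · rw [Sum.elim_inl, map_mul, map_mul, eval_det_pairingMatrix, map_sum, eval_linPoly, ← hm]
        have h1 : ∀ l, eval (coords p.1.1 p.1.2) ((pairingMatrix α).adjugate i l *
            X (Sum.inl (l, c))) = m.det * (m⁻¹ i l * p.1.1 l c) := fun l => by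
          rw [map_mul, eval_adjugate_pairingMatrix, ← hm, ← hinv, eval_X, mul_assoc]
          rfl
        have h2 : combine m⁻¹ p.1.1 i c = ∑ l, m⁻¹ i l * p.1.1 l c := by
          simp [combine, Finset.sum_apply]
        change _ = _ * combine m⁻¹ p.1.1 i c
        rw [Finset.sum_congr rfl fun l _ => h1 l, ← Finset.mul_sum, h2]
        ring
      · rw [Sum.elim_inr, map_mul, map_mul, eval_det_pairingMatrix, eval_linPoly, ← hm, eval_X]
        change m.det * p.1.2 c = m.det * β p.1.2 * ((β p.1.2)⁻¹ * p.1.2 c)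
        field_simp
  unique p p₀ hp hp₀ h := by
    obtain ⟨hspan, c, hc, hv⟩ := toGrassProj_eq_iff.mp h
    have h1 : ∀ i, p.1.1 i = p₀.1.1 i := fun i => by
      have h2 : p.1.1 i ∈ Submodule.span k (Set.range p₀.1.1) := by
        rw [← hspan]; exact Submodule.subset_span ⟨i, rfl⟩
      rw [eq_sum_of_mem_span hp₀.1 h2]
      have h3 : ∀ j, α j (p.1.1 i) = if i = j then 1 else 0 := hp.1 i
      simp [h3, rowAt_coords]
    have h4 : p.1.2 = p₀.1.2 := by
      have h5 : β p.1.2 = c * β p₀.1.2 := by rw [hv, map_smul, smul_eq_mul]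
      rw [show β p.1.2 = 1 from hp.2, show β p₀.1.2 = 1 from hp₀.2, mul_one] at h5
      rw [hv, ← h5, one_smul]
    rw [show p.1.1 = p₀.1.1 from funext h1, h4]

end FrameSlice

/-! ### Tangent vectors under linear maps. -/

section LinearMaps

variable {k : Type*} [Field k] {ι κ : Type*} [Fintype ι] [Fintype κ]

/-- Linear maps push tangent vectors forward. -/
theorem linearMap_mem_affineTangent {S : Set (ι → k)} {T : Set (κ → k)}
    (M : (ι → k) →ₗ[k] (κ → k)) (hM : ∀ x ∈ S, M x ∈ T) {x w : ι → k}
    (hw : w ∈ affineTangent S x) : M w ∈ affineTangent T (M x) := by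
  classical
  let Q : κ → MvPolynomial ι k := fun j => ∑ i, C (M (Pi.single i 1) j) * X i
  have hsum : ∀ (y : ι → k) (j : κ), ∑ i, M (Pi.single i 1) j * y i = M y j := fun y j => by
    conv_rhs => rw [show y = ∑ i, y i • Pi.single i (1 : k) by
      funext c; simp [Finset.sum_apply, Pi.single_apply]]
    simp [map_sum, Finset.sum_apply, mul_comm]
  have hQ : ∀ y, (fun j => eval y (Q j)) = M y := fun y => by
    funext j
    rw [← hsum y j]
    simp [Q]
  have hdQ : (fun j => polyDifferential (Q j) x w) = M w := by
    funext j
    rw [← hsum w j, polyDifferential_sum_apply]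
    refine Finset.sum_congr rfl fun i _ => ?_
    rw [polyDifferential_mul_apply, polyDifferential_C_apply, polyDifferential_X_apply]
    simp
  have h1 := polyDifferential_mem_affineTangent Q (T := T) (fun y hy => by
    rw [hQ]; exact hM y hy) hw
  rwa [hdQ, hQ] at h1

end LinearMaps

/-! ### Rank comparisons. -/

section LinearAlgebra

variable {k V V₁ V₂ : Type*} [Field k] [AddCommGroup V] [Module k V] [AddCommGroup V₁] [Module k V₁]
  [AddCommGroup V₂] [Module k V₂] [FiniteDimensional k V]

theorem finrank_map_eq_finrank_map (f : V →ₗ[k] V₁) (g : V →ₗ[k] V₂) (S : Submodule k V)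
    (h : ∀ w ∈ S, f w = 0 ↔ g w = 0) :
    Module.finrank k (S.map f) = Module.finrank k (S.map g) := by
  have h1 := (f.domRestrict S).finrank_range_add_finrank_ker
  have h2 := (g.domRestrict S).finrank_range_add_finrank_ker
  have h3 : LinearMap.ker (f.domRestrict S) = LinearMap.ker (g.domRestrict S) := by
    ext w
    exact h w.1 w.2
  rw [LinearMap.range_domRestrict] at h1 h2
  rw [h3] at h1
  omega

theorem finrank_map_eq_of_forall_eq_zero (f : V →ₗ[k] V₁) (S : Submodule k V)
    (h : ∀ w ∈ S, f w = 0 → w = 0) : Module.finrank k (S.map f) = Module.finrank k S := by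
  rw [finrank_map_eq_finrank_map f LinearMap.id S fun w hw =>
    ⟨h w hw, fun h0 => by rw [LinearMap.id_apply] at h0; rw [h0, map_zero]⟩, Submodule.map_id]

end LinearAlgebra

/-! ### The tangent space, `d pr₂` and `Φ` in slice coordinates. -/

section FrameTangent

variable {k : Type*} [Field k] {r N : ℕ}

theorem frames_eq (Z : Set (GrassProj k r N)) :
    frames Z = (fun p : Frame k r N => coords p.1.1 p.1.2) '' (toGrassProj ⁻¹' Z) := by
  ext x
  constructor
  · rintro ⟨p, hp, rfl⟩
    exact ⟨p, hp, rfl⟩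
  · rintro ⟨p, hp, rfl⟩
    exact ⟨p, hp, rfl⟩

theorem part_subset_frames {Z : Set (GrassProj k r N)}
    (s : AffineSlice (fun p : Frame k r N => coords p.1.1 p.1.2) (toGrassProj (k := k))) :
    s.part Z ⊆ frames Z := by
  rintro x ⟨-, p, rfl, hp⟩
  exact ⟨p, hp, rfl⟩

variable {α : Fin r → Module.Dual k (Vec k N)} {β : Module.Dual k (Vec k N)}

/-- The derivative of the slice equation `α j (A i) = δ_ij`. Together with `dual_vecAt_eq_zero` it
removes the infinitesimal changes of frame. -/
theorem dual_rowAt_eq_zero {Z : Set (GrassProj k r N)}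
    {x w : (Fin r × Fin (N + 1)) ⊕ Fin (N + 1) → k}
    (hw : w ∈ affineTangent ((frameSlice α β).part Z) x) (i j : Fin r) :
    α j (rowAt i w) = 0 := by
  have h := mem_affineTangent_iff.mp hw
    (linPoly (α j) (fun c => Sum.inl (i, c)) + C (-if i = j then 1 else 0)) (by
      rw [mem_vanishingIdeal_iff_eval]
      intro y hy
      have h1 : α j (rowAt i y) = if i = j then 1 else 0 := hy.1.1 i j
      rw [map_add, eval_linPoly, eval_C, ← h1, ← sub_eq_add_neg]
      exact sub_self _)
  rwa [polyDifferential_add, LinearMap.add_apply, polyDifferential_C_apply, add_zero,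
    polyDifferential_linPoly_apply] at h

theorem dual_vecAt_eq_zero {Z : Set (GrassProj k r N)}
    {x w : (Fin r × Fin (N + 1)) ⊕ Fin (N + 1) → k}
    (hw : w ∈ affineTangent ((frameSlice α β).part Z) x) : β (vecAt w) = 0 := by
  have h := mem_affineTangent_iff.mp hw (linPoly β Sum.inr + C (-1)) (by
      rw [mem_vanishingIdeal_iff_eval]
      intro y hy
      have h1 : β (vecAt y) = 1 := hy.1.2
      rw [map_add, eval_linPoly, eval_C, ← h1, ← sub_eq_add_neg]
      exact sub_self _)
  rwa [polyDifferential_add, LinearMap.add_apply, polyDifferential_C_apply, add_zero,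
    polyDifferential_linPoly_apply] at h

/-- A tangent vector of the space of frames over `Z` can be moved into the slice without changing
the tangent vector of `Z`. -/
theorem exists_mem_affineTangent_part {Z : Set (GrassProj k r N)}
    {x w : (Fin r × Fin (N + 1)) ⊕ Fin (N + 1) → k} (hx : x ∈ (frameSlice α β).carrier)
    (hxZ : x ∈ frames Z) (hw : w ∈ affineTangent (frames Z) x) :
    ∃ w₀ ∈ affineTangent ((frameSlice α β).part Z) x,
      (∀ i, rowAt i w₀ - rowAt i w ∈ Submodule.span k (Set.range fun i => rowAt i x)) ∧
        vecAt w₀ - vecAt w ∈ Submodule.span k {vecAt x} := by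
  rw [frames_eq] at hxZ hw
  refine ⟨_, AffineSlice.retract_mem_affineTangent hx hxZ hw, fun i => ?_, ?_⟩
  · have h1 : (Matrix.of fun i j => α j (rowAt i x)) = 1 := by
      ext i j; rw [Matrix.of_apply, hx.1, Matrix.one_apply]
    have h2 : eval x (linPoly β Sum.inr) = 1 := by rw [eval_linPoly]; exact hx.2
    have h3 : ∀ l, eval x ((pairingMatrix α).adjugate i l) = if i = l then 1 else 0 := fun l => by
      rw [eval_adjugate_pairingMatrix, h1, Matrix.adjugate_one, Matrix.one_apply]
    set D := polyDifferential (frameSlice α β).δ x w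
    -- At `x` the adjugate is the identity and `β v = 1`, so the product rule yields the rows of `w`
    -- plus a combination of the rows of `x` with these coefficients.
    refine Submodule.mem_span_range_iff_exists_fun k |>.mpr
      ⟨fun l => polyDifferential ((pairingMatrix α).adjugate i l) x w +
        (if i = l then polyDifferential (linPoly β Sum.inr) x w - D else 0), ?_⟩
    funext c
    change _ = polyDifferential (linPoly β Sum.inr * ∑ l, (pairingMatrix α).adjugate i l *
      X (Sum.inl (l, c))) x w - x (Sum.inl (i, c)) * D - w (Sum.inl (i, c))
    rw [polyDifferential_mul_apply, h2, one_mul, polyDifferential_sum_apply, map_sum]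
    simp only [polyDifferential_mul_apply, polyDifferential_X_apply, h3, map_mul, eval_X, ite_mul,
      one_mul, zero_mul, Finset.sum_ite_eq, Finset.mem_univ, if_true, Finset.sum_add_distrib,
      add_smul, ite_smul, zero_smul, ite_apply, Pi.zero_apply, Pi.add_apply,
      Finset.sum_apply, Pi.smul_apply, smul_eq_mul]
    have h4 : ∑ l, polyDifferential ((pairingMatrix α).adjugate i l) x w * rowAt l x c =
        ∑ l, x (Sum.inl (l, c)) * polyDifferential ((pairingMatrix α).adjugate i l) x w :=
      Finset.sum_congr rfl fun l _ => mul_comm _ _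
    rw [h4]
    change _ + (_ - D) * x (Sum.inl (i, c)) = _
    ring
  · have h1 : (Matrix.of fun i j => α j (rowAt i x)) = 1 := by
      ext i j; rw [Matrix.of_apply, hx.1, Matrix.one_apply]
    set D := polyDifferential (frameSlice α β).δ x w
    refine Submodule.mem_span_singleton.mpr
      ⟨polyDifferential (pairingMatrix α).det x w - D, ?_⟩
    funext c
    change _ = polyDifferential ((pairingMatrix α).det * X (Sum.inr c)) x w -
      x (Sum.inr c) * D - w (Sum.inr c)
    rw [polyDifferential_mul_apply, eval_det_pairingMatrix, h1, Matrix.det_one,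
      polyDifferential_X_apply, eval_X, one_mul]
    change _ * x (Sum.inr c) = _
    ring

/-- The basis of the subspace given by a frame. -/
noncomputable def frameBasis (p : Frame k r N) :
    Module.Basis (Fin r) k (pr1 (toGrassProj p)).1 := Module.Basis.span p.2.1

theorem coe_frameBasis (p : Frame k r N) (i : Fin r) : (frameBasis p i : Vec k N) = p.1.1 i :=
  congrArg Subtype.val (Module.Basis.span_apply p.2.1 i)

theorem line_toProj (v : Punctured k N) : (toProj v).line = Submodule.span k {v.1} :=
  Projectivization.submodule_mk _ _

theorem line_pr2 (p : Frame k r N) :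
    (pr2 (toGrassProj p)).line = Submodule.span k {p.1.2} := line_toProj _

/-- The basis of the line given by a frame. -/
noncomputable def lineBasis (p : Frame k r N) :
    Module.Basis Unit k (pr2 (toGrassProj p)).line :=
  (Module.Basis.singleton Unit k).map ((LinearEquiv.toSpanNonzeroSingleton k _ p.1.2 p.2.2).trans
    (LinearEquiv.ofEq _ _ (line_pr2 p).symm))

theorem coe_lineBasis (p : Frame k r N) (u : Unit) : (lineBasis p u : Vec k N) = p.1.2 := by
  simp only [lineBasis, Module.Basis.map_apply, Module.Basis.singleton_apply,
    LinearEquiv.trans_apply, LinearEquiv.toSpanNonzeroSingleton_one]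
  rfl

/-- The velocity of a point of `Grass × ℙ^N` given by the velocity of a frame. -/
noncomputable def velocity (p : Frame k r N) :
    ((Fin r × Fin (N + 1)) ⊕ Fin (N + 1) → k) →ₗ[k]
      TGrass (pr1 (toGrassProj p)).1 × TGrass (pr2 (toGrassProj p)).line :=
  LinearMap.prod
    (((frameBasis p).constr k).toLinearMap ∘ₗ
      LinearMap.pi fun i => (Submodule.mkQ _) ∘ₗ rowAt i)
    (((lineBasis p).constr k).toLinearMap ∘ₗ LinearMap.pi fun _ => (Submodule.mkQ _) ∘ₗ vecAt)

theorem velocity_fst_apply (p : Frame k r N) (w : (Fin r × Fin (N + 1)) ⊕ Fin (N + 1) → k)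
    (i : Fin r) : (velocity p w).1 (frameBasis p i) = Submodule.Quotient.mk (rowAt i w) := by
  simp [velocity]

theorem velocity_snd_apply (p : Frame k r N) (w : (Fin r × Fin (N + 1)) ⊕ Fin (N + 1) → k)
    (u : Unit) : (velocity p w).2 (lineBasis p u) = Submodule.Quotient.mk (vecAt w) := by
  simp [velocity]

theorem eq_velocity_iff {p : Frame k r N} {w : (Fin r × Fin (N + 1)) ⊕ Fin (N + 1) → k}
    {t : TGrass (pr1 (toGrassProj p)).1 × TGrass (pr2 (toGrassProj p)).line} :
    t = velocity p w ↔ (∀ i, t.1 (frameBasis p i) = Submodule.Quotient.mk (rowAt i w)) ∧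
      t.2 (lineBasis p ()) = Submodule.Quotient.mk (vecAt w) := by
  constructor
  · rintro rfl
    exact ⟨velocity_fst_apply p w, velocity_snd_apply p w ()⟩
  · rintro ⟨h1, h2⟩
    refine Prod.ext ((frameBasis p).ext fun i => ?_) ((lineBasis p).ext fun u => ?_)
    · rw [h1, velocity_fst_apply]
    · rw [velocity_snd_apply, ← h2]

/-- Change of frame. -/
def changeFrame (g : Matrix (Fin r) (Fin r) k) (c : k) :
    ((Fin r × Fin (N + 1)) ⊕ Fin (N + 1) → k) →ₗ[k] ((Fin r × Fin (N + 1)) ⊕ Fin (N + 1) → k) where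
  toFun x := coords (combine g fun i => rowAt i x) (c • vecAt x)
  map_add' x y := by
    funext j
    rcases j with ⟨i, a⟩ | a
    · change (∑ l, g i l • rowAt l (x + y)) a =
        (∑ l, g i l • rowAt l x) a + (∑ l, g i l • rowAt l y) a
      rw [← Pi.add_apply, ← Finset.sum_add_distrib]
      simp only [map_add, smul_add]
    · exact mul_add _ _ _
  map_smul' b x := by
    funext j
    rcases j with ⟨i, a⟩ | a
    · change (∑ l, g i l • rowAt l (b • x)) a = (b • ∑ l, g i l • rowAt l x) a
      simp only [map_smul, Finset.smul_sum, smul_comm b]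
    · exact mul_left_comm _ _ _

theorem changeFrame_coords (g : Matrix (Fin r) (Fin r) k) (c : k) (A : Fin r → Vec k N)
    (v : Vec k N) : changeFrame g c (coords A v) = coords (combine g A) (c • v) := rfl

theorem changeFrame_mem_frames {Z : Set (GrassProj k r N)} {g : Matrix (Fin r) (Fin r) k} {c : k}
    (hg : g.det ≠ 0) (hc : c ≠ 0) {x : (Fin r × Fin (N + 1)) ⊕ Fin (N + 1) → k}
    (hx : x ∈ frames Z) : changeFrame g c x ∈ frames Z := by
  obtain ⟨p, hp, rfl⟩ := hx
  let q : Frame k r N := ⟨(combine g p.1.1, c • p.1.2), linearIndependent_combine hg p.2.1,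
    smul_ne_zero hc p.2.2⟩
  have h : toGrassProj q = toGrassProj p :=
    toGrassProj_eq_iff.mpr ⟨span_combine hg p.2.1, c, hc, rfl⟩
  exact ⟨q, by rwa [h], changeFrame_coords g c p.1.1 p.1.2⟩

/-- One frame suffices: any other frame over the same point is obtained by a matrix `g` and a scalar
`c`, and this change of frame is a linear map preserving the frames over `Z`. -/
theorem mem_tangent_iff {Z : Set (GrassProj k r N)} {p : Frame k r N}
    {t : TGrass (pr1 (toGrassProj p)).1 × TGrass (pr2 (toGrassProj p)).line} :
    t ∈ tangent Z (toGrassProj p) ↔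
      ∃ w ∈ affineTangent (frames Z) (coords p.1.1 p.1.2), t = velocity p w := by
  constructor
  · intro ht
    obtain ⟨A', v', h1, h2, h3⟩ := ht (frameBasis p) (lineBasis p ())
      (frameBasis p).linearIndependent ((lineBasis p).ne_zero ())
    refine ⟨coords A' v', ?_, eq_velocity_iff.mpr ⟨h1, h2⟩⟩
    simpa only [coe_frameBasis, coe_lineBasis] using h3
  · rintro ⟨w, hw, rfl⟩ A v hA hv
    let g : Matrix (Fin r) (Fin r) k := fun i l => (frameBasis p).repr (A i) l
    let c : k := (lineBasis p).repr v ()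
    have hAg : ∀ i, A i = ∑ l, g i l • frameBasis p l := fun i =>
      ((frameBasis p).sum_repr (A i)).symm
    have hvc : v = c • lineBasis p () := by
      conv_lhs => rw [← (lineBasis p).sum_repr v]
      simp [c]
    have hc : c ≠ 0 := by
      intro h
      rw [hvc, h, zero_smul] at hv
      exact hv rfl
    have hg : g.det ≠ 0 := by
      intro h
      obtain ⟨a, ha, h1⟩ := Matrix.exists_vecMul_eq_zero_iff.mpr h
      refine ha (funext fun i => Fintype.linearIndependent_iff.mp hA a ?_ i)
      simp only [hAg, Finset.smul_sum, smul_smul]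
      rw [Finset.sum_comm]
      refine Finset.sum_eq_zero fun l _ => ?_
      rw [← Finset.sum_smul]
      have : ∑ i, a i * g i l = 0 := congrFun h1 l
      rw [this, zero_smul]
    have hAc : ∀ i, (A i : Vec k N) = combine g p.1.1 i := fun i => by
      rw [hAg]
      simp [combine, coe_frameBasis]
    have hvc' : (v : Vec k N) = c • p.1.2 := by
      rw [hvc, Submodule.coe_smul, coe_lineBasis]
    refine ⟨combine g fun i => rowAt i w, c • vecAt w, fun i => ?_, ?_, ?_⟩
    · rw [hAg, map_sum]
      simp only [map_smul, velocity_fst_apply]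
      change _ = Submodule.mkQ _ (∑ l, g i l • rowAt l w)
      simp
    · rw [hvc, map_smul, velocity_snd_apply]
      rfl
    · have h1 := linearMap_mem_affineTangent (changeFrame g c)
        (fun x hx => changeFrame_mem_frames hg hc hx) hw
      have h2 : coords (fun i => (A i : Vec k N)) (v : Vec k N) =
          changeFrame g c (coords p.1.1 p.1.2) := by
        rw [show (fun i => (A i : Vec k N)) = combine g p.1.1 from funext hAc, hvc']
        rfl
      rw [h2]
      exact h1

section AtSlicePoint

variable {Z : Set (GrassProj k r N)} {p : Frame k r N}

/-- Moving a tangent vector into the slice changes its rows by elements of `W` and its last vector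
by a multiple of `v`, and both disappear in `V/W` and `V/ℓ`. -/
theorem tangent_eq_map (hp : coords p.1.1 p.1.2 ∈ (frameSlice α β).part Z) :
    tangent Z (toGrassProj p) =
      (affineTangent ((frameSlice α β).part Z) (coords p.1.1 p.1.2)).map (velocity p) := by
  ext t
  rw [mem_tangent_iff]
  constructor
  · rintro ⟨w, hw, rfl⟩
    obtain ⟨w₀, hw₀, h1, h2⟩ :=
      exists_mem_affineTangent_part hp.1 (part_subset_frames _ hp) hw
    refine ⟨w₀, hw₀, ?_⟩
    symm
    rw [eq_velocity_iff]
    refine ⟨fun i => ?_, ?_⟩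
    · rw [velocity_fst_apply, eq_comm, Submodule.Quotient.eq]
      exact h1 i
    · rw [velocity_snd_apply, eq_comm, Submodule.Quotient.eq, line_pr2]
      exact h2
  · rintro ⟨w, hw, rfl⟩
    exact ⟨w, affineTangent_mono (part_subset_frames _) _ hw, rfl⟩

theorem eq_zero_of_dual_eq_zero (hp : coords p.1.1 p.1.2 ∈ (frameSlice α β).part Z)
    {u : Vec k N} (hu : u ∈ (pr1 (toGrassProj p)).1)
    (h : ∀ j, α j u = 0) : u = 0 := by
  have := eq_sum_of_mem_span hp.1.1 hu
  simpa [h] using this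

theorem eq_zero_of_mem_line (hp : coords p.1.1 p.1.2 ∈ (frameSlice α β).part Z)
    {u : Vec k N} (hu : u ∈ (pr2 (toGrassProj p)).line)
    (h : β u = 0) : u = 0 := by
  rw [line_pr2] at hu
  obtain ⟨c, rfl⟩ := Submodule.mem_span_singleton.mp hu
  have h1 : β p.1.2 = 1 := hp.1.2
  rw [map_smul, h1, smul_eq_mul, mul_one] at h
  rw [h, zero_smul]

/-- The velocity map is injective on the slice: if the velocity is zero, the rows lie in `W` and are
killed by all `α j`, and the last vector lies in `ℓ` and is killed by `β`. -/
theorem finrank_tangent (hp : coords p.1.1 p.1.2 ∈ (frameSlice α β).part Z) :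
    Module.finrank k (tangent Z (toGrassProj p)) =
      Module.finrank k (affineTangent ((frameSlice α β).part Z) (coords p.1.1 p.1.2)) := by
  rw [tangent_eq_map hp]
  refine finrank_map_eq_of_forall_eq_zero _ _ fun w hw h => ?_
  obtain ⟨h1, h2⟩ := eq_velocity_iff.mp h.symm
  rw [← coords_rowAt_vecAt w]
  have h3 : ∀ i, rowAt i w = 0 := fun i =>
    eq_zero_of_dual_eq_zero hp ((Submodule.Quotient.mk_eq_zero _).mp (h1 i).symm)
      (dual_rowAt_eq_zero hw i)
  have h4 : vecAt w = 0 :=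
    eq_zero_of_mem_line hp ((Submodule.Quotient.mk_eq_zero _).mp h2.symm) (dual_vecAt_eq_zero hw)
  rw [show (fun i => rowAt i w) = 0 from funext h3, h4]
  funext j
  rcases j with j | j <;> rfl

theorem finrank_range_dpr2 (hp : coords p.1.1 p.1.2 ∈ (frameSlice α β).part Z) :
    Module.finrank k (LinearMap.range (dpr2 Z (toGrassProj p))) =
      Module.finrank k
        ((affineTangent ((frameSlice α β).part Z) (coords p.1.1 p.1.2)).map vecAt) := by
  have h1 : LinearMap.range (dpr2 Z (toGrassProj p)) =
      (affineTangent ((frameSlice α β).part Z) (coords p.1.1 p.1.2)).map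
        (LinearMap.snd k _ _ ∘ₗ velocity p) := by
    rw [dpr2, LinearMap.range_comp, Submodule.range_subtype, tangent_eq_map hp, Submodule.map_comp]
  rw [h1]
  refine finrank_map_eq_finrank_map _ _ _ fun w hw => ?_
  constructor
  · intro h
    have h2 := velocity_snd_apply p w ()
    rw [show (velocity p w).2 = 0 from h, LinearMap.zero_apply, eq_comm,
      Submodule.Quotient.mk_eq_zero] at h2
    exact eq_zero_of_mem_line hp h2 (dual_vecAt_eq_zero hw)
  · intro h
    refine (lineBasis p).ext fun u => ?_
    change (velocity p w).2 (lineBasis p u) = 0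
    rw [velocity_snd_apply, h, Submodule.Quotient.mk_zero]

theorem mem_ker_Phi_iff (hp : coords p.1.1 p.1.2 ∈ (frameSlice α β).part Z)
    {a : Fin r → k} :
    (frameBasis p).equivFun.symm a ∈ LinearMap.ker (Phi Z (toGrassProj p)) ↔
      ∀ w ∈ affineTangent ((frameSlice α β).part Z) (coords p.1.1 p.1.2),
        ∑ i, a i • rowAt i w ∈ (pr1 (toGrassProj p)).1 := by
  have h1 : ∀ w, (velocity p w).1 ((frameBasis p).equivFun.symm a) =
      Submodule.Quotient.mk (∑ i, a i • rowAt i w) := fun w => by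
    rw [Module.Basis.equivFun_symm_apply, map_sum]
    simp only [map_smul, velocity_fst_apply]
    change _ = Submodule.mkQ _ (∑ i, a i • rowAt i w)
    simp
  rw [LinearMap.mem_ker]
  constructor
  · intro h w hw
    have h2 : velocity p w ∈ tangent Z (toGrassProj p) := by
      rw [tangent_eq_map hp]
      exact Submodule.mem_map_of_mem hw
    have h3 : (velocity p w).1 ((frameBasis p).equivFun.symm a) = 0 :=
      LinearMap.congr_fun h ⟨_, h2⟩
    rwa [h1, Submodule.Quotient.mk_eq_zero] at h3
  · intro h
    refine LinearMap.ext fun t => ?_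
    obtain ⟨t, ht⟩ := t
    have ht' := ht
    rw [tangent_eq_map hp] at ht'
    obtain ⟨w, hw, rfl⟩ := ht'
    change (velocity p w).1 ((frameBasis p).equivFun.symm a) = 0
    rw [h1, Submodule.Quotient.mk_eq_zero]
    exact h w hw

/-- The kernel of `Φ` in coordinates. -/
theorem finrank_ker_Phi (hp : coords p.1.1 p.1.2 ∈ (frameSlice α β).part Z)
    (K : Submodule k (Fin r → k))
    (hK : ∀ a, a ∈ K ↔
      ∀ w ∈ affineTangent ((frameSlice α β).part Z) (coords p.1.1 p.1.2),
        ∑ i, a i • rowAt i w ∈ (pr1 (toGrassProj p)).1) :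
    Module.finrank k (LinearMap.ker (Phi Z (toGrassProj p))) = Module.finrank k K := by
  have h1 : K = (LinearMap.ker (Phi Z (toGrassProj p))).map
      (frameBasis p).equivFun.toLinearMap := by
    ext a
    rw [hK, ← mem_ker_Phi_iff hp]
    constructor
    · exact fun h => ⟨_, h, (frameBasis p).equivFun.apply_symm_apply a⟩
    · rintro ⟨b, hb, rfl⟩
      simpa using hb
  rw [h1]
  exact (LinearEquiv.finrank_map_eq (frameBasis p).equivFun _).symm

/-- On the universal family, the differentiated relation `v = ∑ i, α i v • A i`. -/
theorem vecAt_eq_of_mem_affineTangent (hZ : Z ⊆ universalFamily k r N)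
    {w : (Fin r × Fin (N + 1)) ⊕ Fin (N + 1) → k}
    (hw : w ∈ affineTangent ((frameSlice α β).part Z) (coords p.1.1 p.1.2)) :
    vecAt w = ∑ i, (α i (vecAt w) • p.1.1 i + α i p.1.2 • rowAt i w) := by
  funext c
  have h := mem_affineTangent_iff.mp hw
    (X (Sum.inr c) + ∑ i, (C (-1) * linPoly (α i) Sum.inr) * X (Sum.inl (i, c))) (by
      rw [mem_vanishingIdeal_iff_eval]
      rintro x ⟨hx, q, rfl, hq⟩
      have h1 : q.1.2 ∈ Submodule.span k (Set.range q.1.1) :=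
        hZ hq (by rw [line_pr2]; exact Submodule.mem_span_singleton_self _)
      have h2 : q.1.2 c = ∑ i, α i q.1.2 * q.1.1 i c := by
        conv_lhs => rw [eq_sum_of_mem_span (A := q.1.1) hx.1 h1]
        simp [Finset.sum_apply]
      simp only [map_add, map_sum, map_mul, eval_X, eval_C, eval_linPoly]
      change q.1.2 c + ∑ i, -1 * α i q.1.2 * q.1.1 i c = 0
      rw [h2]
      simp)
  rw [polyDifferential_add, LinearMap.add_apply, polyDifferential_X_apply,
    polyDifferential_sum_apply] at h
  simp only [polyDifferential_mul_apply, polyDifferential_X_apply, polyDifferential_C_apply,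
    map_mul, eval_X, eval_C, eval_linPoly, polyDifferential_linPoly_apply, mul_zero, add_zero] at h
  rw [add_eq_zero_iff_eq_neg] at h
  refine h.trans ?_
  simp only [Finset.sum_apply, Pi.add_apply, Pi.smul_apply, smul_eq_mul, ← Finset.sum_neg_distrib]
  refine Finset.sum_congr rfl fun i _ => ?_
  change -(-1 * α i p.1.2 * w (Sum.inl (i, c)) + p.1.1 i c * (-1 * α i (vecAt w))) =
    α i (vecAt w) * p.1.1 i c + α i p.1.2 * w (Sum.inl (i, c))
  ring

/-- By the differentiated relation, `vecAt w` and the value of `Φ` on `v` differ by a combination of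
the frame vectors, so they agree modulo `W`. This turns condition (ii) into a statement about the
image of `d pr₂`. -/
theorem Phi_comp_tautIncl_eq_zero_iff (hZ : Z ⊆ universalFamily k r N)
    (hp : coords p.1.1 p.1.2 ∈ (frameSlice α β).part Z)
    (hz : toGrassProj p ∈ universalFamily k r N) :
    Phi Z (toGrassProj p) ∘ₗ tautIncl (toGrassProj p) hz = 0 ↔
      ∀ w ∈ affineTangent ((frameSlice α β).part Z) (coords p.1.1 p.1.2),
        vecAt w ∈ Submodule.span k (Set.range p.1.1) := by
  have hv : p.1.2 ∈ Submodule.span k (Set.range p.1.1) :=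
    hz (by rw [line_pr2]; exact Submodule.mem_span_singleton_self _)
  have h1 : tautIncl (toGrassProj p) hz (lineBasis p ()) =
      (frameBasis p).equivFun.symm fun i => α i p.1.2 := by
    refine Subtype.ext ?_
    rw [Module.Basis.equivFun_symm_apply]
    simp only [Submodule.coe_sum, Submodule.coe_smul, coe_frameBasis]
    exact (coe_lineBasis p ()).trans (eq_sum_of_mem_span hp.1.1 hv)
  have h2 : Phi Z (toGrassProj p) ∘ₗ tautIncl (toGrassProj p) hz = 0 ↔
      (frameBasis p).equivFun.symm (fun i => α i p.1.2) ∈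
        LinearMap.ker (Phi Z (toGrassProj p)) := by
    rw [← h1, LinearMap.mem_ker]
    constructor
    · exact fun h => LinearMap.congr_fun h _
    · intro h
      exact (lineBasis p).ext fun u => h
  rw [h2, mem_ker_Phi_iff hp]
  refine forall₂_congr fun w hw => ?_
  conv_rhs => rw [vecAt_eq_of_mem_affineTangent hZ hw, Finset.sum_add_distrib]
  refine (Submodule.add_mem_iff_right _ ?_).symm
  exact Submodule.sum_mem _ fun i _ =>
    Submodule.smul_mem _ _ (Submodule.subset_span ⟨i, rfl⟩)

end AtSlicePoint

theorem toGrassProj_surjective : Function.Surjective (toGrassProj (k := k) (r := r) (N := N)) := by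
  rintro ⟨⟨W, hW⟩, x⟩
  obtain ⟨v, rfl⟩ := toProj_surjective x
  let b := Module.finBasisOfFinrankEq k W hW
  have hb : LinearIndependent k fun i => (b i : Vec k N) :=
    b.linearIndependent.map' W.subtype (Submodule.ker_subtype W)
  refine ⟨⟨(fun i => b i, v.1), hb, v.2⟩, Prod.ext (Subtype.ext ?_) rfl⟩
  change Submodule.span k (Set.range fun i => W.subtype (b i)) = W
  rw [Set.range_comp', Submodule.span_image, b.span_eq, Submodule.map_top, Submodule.range_subtype]

theorem exists_mem_frameSlice (z : GrassProj k r N) :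
    ∃ (α : Fin r → Module.Dual k (Vec k N)) (β : Module.Dual k (Vec k N)) (p : Frame k r N),
      toGrassProj p = z ∧ coords p.1.1 p.1.2 ∈ (frameSlice α β).carrier := by
  obtain ⟨p, rfl⟩ := toGrassProj_surjective z
  obtain ⟨α, hα⟩ := exists_dual_family p.2.1
  obtain ⟨β, hβ⟩ := exists_dual_eq_one p.2.2
  exact ⟨α, β, p, rfl, hα, hβ⟩

end FrameTangent

attribute [local instance] zariski

/-! ### Open and closed sets of Zariski quotients by polynomials. -/

section Quotient

variable {k : Type*} [Field k] {ι E M : Type*} [TopologicalSpace M] {e : E → ι → k} {π : E → M}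

theorem IsZariskiQuotient.isOpen_of_forall (hq : IsZariskiQuotient e π) {V : Set M}
    (h : ∀ p, π p ∈ V → ∃ f : MvPolynomial ι k, eval (e p) f ≠ 0 ∧
      ∀ q, eval (e q) f ≠ 0 → π q ∈ V) : IsOpen V := by
  choose! f hf hfV using h
  refine (hq.isOpen_iff V).mpr ⟨⋃ p ∈ π ⁻¹' V, {x | eval x (f p) ≠ 0},
    isOpen_biUnion fun p _ => isOpen_basic (f p), ?_⟩
  ext q
  simp only [Set.mem_preimage, Set.mem_iUnion, Set.mem_ofPred_eq, exists_prop]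
  exact ⟨fun ⟨p, hp, hpq⟩ => hfV p hp q hpq, fun hqV => ⟨q, hqV, hf q hqV⟩⟩

theorem IsZariskiQuotient.exists_basic (hq : IsZariskiQuotient e π) {V : Set M} (hV : IsOpen V)
    {p : E} (hp : π p ∈ V) :
    ∃ f : MvPolynomial ι k, eval (e p) f ≠ 0 ∧ ∀ q, eval (e q) f ≠ 0 → π q ∈ V := by
  obtain ⟨U, hU, hUV⟩ := (hq.isOpen_iff V).mp hV
  have hmem : ∀ q, e q ∈ U ↔ π q ∈ V := fun q => by
    have : q ∈ e ⁻¹' U ↔ q ∈ π ⁻¹' V := by rw [hUV]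
    exact this
  obtain ⟨f, hf, hfU⟩ := exists_basic_subset hU ((hmem p).mpr hp)
  exact ⟨f, hf, fun q h => (hmem q).mp (hfU _ h)⟩

theorem IsZariskiQuotient.mem_of_forall_vanishingIdeal (hq : IsZariskiQuotient e π) {Z : Set M}
    (hZ : IsClosed Z) {p : E}
    (h : ∀ f ∈ vanishingIdeal k (e '' (π ⁻¹' Z)), eval (e p) f = 0) : π p ∈ Z := by
  by_contra hp
  obtain ⟨f, hf, hfZ⟩ := hq.exists_basic hZ.isOpen_compl hp
  refine hf (h f (mem_vanishingIdeal_iff_eval.mpr ?_))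
  rintro _ ⟨q, hqZ, rfl⟩
  by_contra hfq
  exact hfZ q hfq hqZ

end Quotient

/-! ### Cones over projective sets and embedded tangent spaces. -/

section Cone

variable {k : Type*} [Field k] {N : ℕ} {X : Set (ProjSpace k N)}

theorem mem_cone_iff {v : Punctured k N} : v.1 ∈ cone X ↔ toProj v ∈ X :=
  ⟨fun ⟨_, h⟩ => h, fun h => ⟨v.2, h⟩⟩

theorem smul_mem_cone {v : Vec k N} {c : k} (hc : c ≠ 0) (hv : v ∈ cone X) : c • v ∈ cone X := by
  obtain ⟨h0, hX⟩ := hv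
  refine ⟨smul_ne_zero hc h0, ?_⟩
  have h : toProj ⟨c • v, smul_ne_zero hc h0⟩ = toProj ⟨v, h0⟩ := toProj_eq_iff.mpr ⟨c, hc, rfl⟩
  rwa [h]

theorem affineTangent_cone_le_smul {v : Vec k N} {c : k} (hc : c ≠ 0) :
    affineTangent (cone X) v ≤ affineTangent (cone X) (c • v) := by
  intro w hw
  have h := linearMap_mem_affineTangent (T := cone X) (LinearMap.lsmul k (Vec k N) c)
    (fun x hx => smul_mem_cone hc hx) hw
  have h' := Submodule.smul_mem _ c⁻¹ h
  rwa [LinearMap.lsmul_apply, LinearMap.lsmul_apply, inv_smul_smul₀ hc] at h'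

theorem embTangent_toProj (v : Punctured k N) :
    embTangent X (toProj v) = affineTangent (cone X) v.1 := by
  ext u
  simp only [embTangent, Submodule.mem_iInf]
  refine ⟨fun h => h v rfl, fun h w hw => ?_⟩
  obtain ⟨c, hc, hwc⟩ := toProj_eq_iff.mp hw
  rw [hwc]
  exact affineTangent_cone_le_smul hc h

/-- Euler's relation: the tangent space of a cone at a point contains this point. -/
theorem self_mem_affineTangent_cone [Infinite k] {v : Vec k N} (hv : v ∈ cone X) :
    v ∈ affineTangent (cone X) v := by
  let Q : Fin (N + 1) → MvPolynomial Unit k := fun i => C (v i) * MvPolynomial.X ()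
  -- The punctured line `c ↦ c • v` stays in the cone; over an infinite field no nonzero polynomial
  -- vanishes on it, so the unit vector is tangent at `1`, and it is sent to `v`.
  let T : Set (Unit → k) := {c | c () ≠ 0}
  have hQ : ∀ c : Unit → k, (fun i => eval c (Q i)) = c () • v := fun c => by
    funext i
    simp [Q, mul_comm]
  have hT : vanishingIdeal k T = ⊥ := by
    rw [eq_bot_iff]
    intro f hf
    have h1 : f * MvPolynomial.X () = 0 := by
      refine MvPolynomial.funext fun c => ?_
      rw [map_mul, eval_X, map_zero]
      by_cases hc : c () = 0
      · rw [hc, mul_zero]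
      · rw [mem_vanishingIdeal_iff_eval.mp hf c hc, zero_mul]
    exact (mul_eq_zero.mp h1).resolve_right (X_ne_zero ())
  have h1 : (1 : Unit → k) ∈ affineTangent T 1 := by
    rw [mem_affineTangent_iff, hT]
    intro f hf
    rw [(Ideal.mem_bot.mp hf), ← C_0, polyDifferential_C_apply]
  have h2 := polyDifferential_mem_affineTangent (T := cone X) Q
    (fun c hc => by rw [hQ]; exact smul_mem_cone hc hv) h1
  have h3 : (fun j => polyDifferential (Q j) 1 (1 : Unit → k)) = v := by
    funext i
    rw [polyDifferential_mul_apply, polyDifferential_C_apply, polyDifferential_X_apply]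
    simp
  rwa [h3, hQ, Pi.one_apply, one_smul] at h2

theorem part_projSlice_subset_cone
    (s : AffineSlice (fun v : Punctured k N => v.1) (toProj (k := k))) :
    s.part X ⊆ cone X := by
  rintro _ ⟨-, v, rfl, hv⟩
  exact mem_cone_iff.mpr hv

/-- The retraction `u ↦ u / β u` has differential `w ↦ w - β w • v` at `v`. Passing from the
hyperplane slice to the cone thus adds at most one dimension. -/
theorem affineTangent_cone_le {β : Module.Dual k (Vec k N)} {v : Vec k N}
    (hβ : β v = 1) (hv : v ∈ cone X) :
    affineTangent (cone X) v ≤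
      affineTangent ((projSlice β).part X) v ⊔ Submodule.span k {v} := by
  intro w hw
  rw [cone_eq] at hv hw
  have h := AffineSlice.retract_mem_affineTangent (s := projSlice β) hβ hv hw
  rw [Submodule.mem_sup]
  refine ⟨_, h, β w • v, Submodule.smul_mem _ _ (Submodule.mem_span_singleton_self v), ?_⟩
  funext c
  change polyDifferential (MvPolynomial.X c) v w - v c * polyDifferential (linPoly β id) v w +
    β w * v c = w c
  rw [polyDifferential_X_apply, polyDifferential_linPoly_apply, Function.comp_id]
  ring

/-- The polynomial need not be homogeneous: the saturation is the union over scalars `c` of the loci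
where `f (c • q) ≠ 0`, and each is given by a polynomial in `q`. -/
theorem isOpen_image_toProj (f : MvPolynomial (Fin (N + 1)) k) :
    IsOpen (toProj '' {v : Punctured k N | eval v.1 f ≠ 0}) := by
  refine isZariskiQuotient_toProj.isOpen_of_forall ?_
  rintro p ⟨v, hv, hvp⟩
  obtain ⟨c, hc, h⟩ := toProj_eq_iff.mp hvp
  have heval : ∀ q : Vec k N, eval q (bind₁ (fun i => C c * MvPolynomial.X i) f) =
      eval (c • q) f := fun q => by
    rw [eval, eval₂Hom_bind₁]
    congr 2
    funext i
    simp
  refine ⟨_, by rw [heval, ← h]; exact hv, fun q hq => ?_⟩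
  rw [heval] at hq
  exact ⟨⟨c • q.1, smul_ne_zero hc q.2⟩, hq, toProj_eq_iff.mpr ⟨c, hc, rfl⟩⟩

theorem continuous_pr2 {r : ℕ} : Continuous (pr2 : GrassProj k r N → ProjSpace k N) := by
  refine continuous_def.mpr fun V hV => isZariskiQuotient_toGrassProj.isOpen_of_forall ?_
  intro p hp
  obtain ⟨f, hf, hfV⟩ := isZariskiQuotient_toProj.exists_basic (p := ⟨p.1.2, p.2.2⟩) hV hp
  have h1 : ∀ q : Frame k r N, eval (coords q.1.1 q.1.2) (rename Sum.inr f) = eval q.1.2 f :=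
    fun q => by rw [eval_rename]; rfl
  exact ⟨rename Sum.inr f, by rw [h1]; exact hf, fun q hq => hfV ⟨q.1.2, q.2.2⟩ (by rwa [h1] at hq)⟩

/-- The pairs `(W, x)` with `W` contained in the embedded tangent space at `x` form a closed set. -/
theorem isClosed_le_embTangent {r : ℕ} (X : Set (ProjSpace k N)) :
    IsClosed {z : GrassProj k r N | (pr1 z).1 ≤ embTangent X (pr2 z)} := by
  rw [← isOpen_compl_iff]
  refine isZariskiQuotient_toGrassProj.isOpen_of_forall ?_
  intro p hp
  have hiff : ∀ q : Frame k r N, (pr1 (toGrassProj q)).1 ≤ embTangent X (pr2 (toGrassProj q)) ↔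
      ∀ i, ∀ f ∈ vanishingIdeal k (cone X), polyDifferential f q.1.2 (q.1.1 i) = 0 := fun q => by
    change Submodule.span k (Set.range q.1.1) ≤ embTangent X (toProj ⟨q.1.2, q.2.2⟩) ↔ _
    rw [embTangent_toProj, Submodule.span_le, Set.range_subset_iff]
    exact forall_congr' fun i => mem_affineTangent_iff
  rw [Set.mem_compl_iff, Set.mem_ofPred_eq, hiff] at hp
  push Not at hp
  obtain ⟨i, f, hf, h⟩ := hp
  have heval : ∀ q : Frame k r N, eval (coords q.1.1 q.1.2)
      (∑ c, rename Sum.inr (pderiv c f) * MvPolynomial.X (Sum.inl (i, c))) =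
        polyDifferential f q.1.2 (q.1.1 i) := fun q => by
    rw [polyDifferential_apply, map_sum]
    refine Finset.sum_congr rfl fun c _ => ?_
    rw [map_mul, eval_rename, eval_X]
    rfl
  refine ⟨_, by rw [heval]; exact h, fun q hq => ?_⟩
  rw [heval] at hq
  rw [Set.mem_compl_iff, Set.mem_ofPred_eq, hiff]
  exact fun hall => hq (hall i f hf)

end Cone

/-! ### Dimension and generic smoothness of `Z` and of its image under `pr₂`. -/

section Variety

variable {k : Type*} [Field k] {r N : ℕ} {Z : Set (GrassProj k r N)}
  {α : Fin r → Module.Dual k (Vec k N)} {β : Module.Dual k (Vec k N)}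

theorem exists_frameSlice_part_nonempty (hZ : Z.Nonempty) :
    ∃ (α : Fin r → Module.Dual k (Vec k N)) (β : Module.Dual k (Vec k N)),
      ((frameSlice α β).part Z).Nonempty := by
  obtain ⟨z, hz⟩ := hZ
  obtain ⟨α, β, p, rfl, hp⟩ := exists_mem_frameSlice z
  exact ⟨α, β, _, hp, p, rfl, hz⟩

theorem toGrassProj_mem_of_mem_part {p : Frame k r N}
    (hp : coords p.1.1 p.1.2 ∈ (frameSlice α β).part Z) : toGrassProj p ∈ Z :=
  ((AffineSlice.mem_part_iff isZariskiQuotient_toGrassProj.injective).mp hp).2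

theorem topologicalKrullDim_eq_affDim_frameSlice [IsAlgClosed k] (hZ : IsClosed Z)
    (hirr : IsIrreducible Z) (hne : ((frameSlice α β).part Z).Nonempty) :
    topologicalKrullDim ↥Z = (affDim ((frameSlice α β).part Z) : ℕ) :=
  AffineSlice.topologicalKrullDim_eq_affDim isZariskiQuotient_toGrassProj
    (fun z => by
      obtain ⟨α, β, p, hp, hpc⟩ := exists_mem_frameSlice z
      exact ⟨_, p, hp, hpc⟩) hZ hirr hne

theorem exists_mem_part_of_isOpen (hirr : IsIrreducible Z)
    (hne : ((frameSlice α β).part Z).Nonempty) {U : Set (GrassProj k r N)} (hU : IsOpen U)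
    (hZU : (Z ∩ U).Nonempty) :
    ∃ p : Frame k r N, coords p.1.1 p.1.2 ∈ (frameSlice α β).part Z ∧ toGrassProj p ∈ U := by
  have hq := isZariskiQuotient_toGrassProj (k := k) (r := r) (N := N)
  obtain ⟨x, hx, p, rfl, hpZ⟩ := hne
  obtain ⟨z, hz, hzU, y, rfl⟩ := hirr.2 U _ hU
    (AffineSlice.isOpenEmbedding_param (s := frameSlice α β) hq).isOpen_range hZU
    ⟨_, hpZ, AffineSlice.mem_range_param hq hx⟩
  refine ⟨(frameSlice α β).toE y, ?_, hzU⟩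
  rw [AffineSlice.mem_part_iff hq.injective]
  refine ⟨?_, hz⟩
  have := (frameSlice α β).e_toE y
  rw [this]
  exact y.2

theorem isIrreducible_image_pr2 (hirr : IsIrreducible Z) : IsIrreducible (pr2 '' Z) :=
  hirr.image _ continuous_pr2.continuousOn

theorem vecAt_mem_part {p : Frame k r N}
    (hp : coords p.1.1 p.1.2 ∈ (frameSlice α β).part Z) :
    p.1.2 ∈ (projSlice β).part (pr2 '' Z) :=
  ⟨hp.1.2, ⟨p.1.2, p.2.2⟩, rfl, toGrassProj p, toGrassProj_mem_of_mem_part hp, rfl⟩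

/-- The slice of the closure of `pr₂ Z` is the closure of the projection of the slice of `Z`. -/
theorem part_closure_image_pr2 (hirr : IsIrreducible Z)
    (hne : ((frameSlice α β).part Z).Nonempty) :
    (projSlice β).part (closure (pr2 '' Z)) =
      closure ((fun x => x ∘ Sum.inr) '' (frameSlice α β).part Z) := by
  have hq := isZariskiQuotient_toProj (k := k) (N := N)
  apply subset_antisymm
  · intro v hv
    by_contra hvC
    obtain ⟨f, hf, hfC⟩ := exists_basic_subset isClosed_closure.isOpen_compl hvC
    obtain ⟨hvβ, w, rfl, hwX⟩ := hv
    let O := (projSlice β).param '' {y | eval y.1 f ≠ 0}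
    have hO : IsOpen O := (AffineSlice.isOpenEmbedding_param hq).isOpenMap _
      ((isOpen_basic f).preimage continuous_subtype_val)
    have hwO : toProj w ∈ O :=
      ⟨⟨w.1, hvβ⟩, hf, by rw [AffineSlice.param, hq.injective ((projSlice β).e_toE ⟨w.1, hvβ⟩)]⟩
    obtain ⟨_, hO', z, hz, rfl⟩ := mem_closure_iff.mp hwX O hO hwO
    -- Irreducibility replaces the point of `Z` over `O` by one lying on the frame slice, whose last
    -- vector is then the slice representative in `ℙ^N`.
    obtain ⟨p, hp, y, hy, hyp⟩ := exists_mem_part_of_isOpen hirr hne (hO.preimage continuous_pr2)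
      ⟨z, hz, hO'⟩
    have h1 := (projSlice β).unique ((projSlice β).toE y) ⟨p.1.2, p.2.2⟩
      (by rw [(projSlice β).e_toE]; exact y.2) hp.1.2 hyp
    rw [(projSlice β).e_toE] at h1
    have hy' : eval y.1 f ≠ 0 := hy
    rw [h1] at hy'
    exact hfC _ hy' (subset_closure ⟨_, hp, rfl⟩)
  · refine closure_minimal ?_ (AffineSlice.isClosed_part hq isClosed_closure)
    rintro _ ⟨x, hx, rfl⟩
    obtain ⟨-, p, rfl, hpZ⟩ := id hx
    obtain ⟨h1, v, h2, h3⟩ := vecAt_mem_part hx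
    exact ⟨h1, v, h2, subset_closure h3⟩

theorem finite_fibre_part {z : ProjSpace k N} (hfin : {y ∈ Z | pr2 y = z}.Finite) :
    {x ∈ (frameSlice α β).part Z | ∃ h : x ∘ Sum.inr ≠ 0, toProj ⟨x ∘ Sum.inr, h⟩ = z}.Finite := by
  have hsub : {x ∈ (frameSlice α β).part Z | ∃ h : x ∘ Sum.inr ≠ 0,
      toProj ⟨x ∘ Sum.inr, h⟩ = z} ⊆ ⋃ y ∈ {y ∈ Z | pr2 y = z},
        {x | x ∈ (frameSlice α β).carrier ∧
          ∃ p : Frame k r N, coords p.1.1 p.1.2 = x ∧ toGrassProj p = y} := by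
    rintro x ⟨⟨hx, p, rfl, hp⟩, h, hz⟩
    exact Set.mem_biUnion (x := toGrassProj p) ⟨hp, hz⟩ ⟨hx, p, rfl, rfl⟩
  refine (hfin.biUnion fun y _ => Set.Subsingleton.finite ?_).subset hsub
  rintro _ ⟨hx, p, rfl, hp⟩ _ ⟨hx', p', rfl, hp'⟩
  exact (frameSlice α β).unique p p' hx hx' (hp.trans hp'.symm)

/-- The dimension of the slice of the closure of `pr₂ Z`. -/
theorem affDim_part_closure_image_pr2 [IsAlgClosed k] (hZ : IsClosed Z) (hirr : IsIrreducible Z)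
    (hne : ((frameSlice α β).part Z).Nonempty) (hfin : IsGenericallyFinitePr2 Z) :
    affDim ((projSlice β).part (closure (pr2 '' Z))) = affDim ((frameSlice α β).part Z) := by
  have hq := isZariskiQuotient_toProj (k := k) (N := N)
  have hq' := isZariskiQuotient_toGrassProj (k := k) (r := r) (N := N)
  have hne' : ((projSlice β).part (pr2 '' Z)).Nonempty := by
    obtain ⟨x, hx⟩ := hne
    obtain ⟨-, p, rfl, hpZ⟩ := id hx
    exact ⟨_, vecAt_mem_part hx⟩
  obtain ⟨h, hh, hfib⟩ := ((projSlice β).forGeneral_iff hq (isIrreducible_image_pr2 hirr)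
    hne').mp hfin
  have hpart := part_closure_image_pr2 hirr hne
  rw [hpart]
  refine affDim_closure_comp (AffineSlice.isClosed_part hq' hZ)
    (AffineSlice.isIrreducible_part hq' hirr hne) Sum.inr (a₀ := h) ?_ ?_
  · rw [← hpart]
    refine fun hI => hh ?_
    rw [mem_vanishingIdeal_iff_eval] at hI ⊢
    rintro _ ⟨hv, w, rfl, hw⟩
    exact hI _ ⟨hv, w, rfl, subset_closure hw⟩
  · rintro _ ⟨x, hx, rfl⟩ hxh
    obtain ⟨-, p, rfl, hpZ⟩ := id hx
    refine (finite_fibre_part (α := α) (β := β)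
      (hfib ⟨p.1.2, p.2.2⟩ (vecAt_mem_part hx) hxh)).subset ?_
    rintro y ⟨hy, hyp⟩
    refine ⟨hy, ?_⟩
    rw [hyp]
    exact ⟨p.2.2, rfl⟩

theorem isProjVariety_closure_image_pr2 [IsAlgClosed k] {n : ℕ} (hZ : IsProjVariety Z n)
    (hfin : IsGenericallyFinitePr2 Z) : IsProjVariety (closure (pr2 '' Z)) n := by
  obtain ⟨hcl, hirr, hdim⟩ := hZ
  obtain ⟨α, β, hne⟩ := exists_frameSlice_part_nonempty hirr.1
  refine ⟨isClosed_closure, (isIrreducible_image_pr2 hirr).closure, ?_⟩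
  have hne' : ((projSlice β).part (closure (pr2 '' Z))).Nonempty := by
    rw [part_closure_image_pr2 hirr hne]
    exact (hne.image _).closure
  rw [AffineSlice.topologicalKrullDim_eq_affDim isZariskiQuotient_toProj exists_mem_projSlice
    isClosed_closure (isIrreducible_image_pr2 hirr).closure hne',
    affDim_part_closure_image_pr2 hcl hirr hne hfin,
    ← topologicalKrullDim_eq_affDim_frameSlice hcl hirr hne, hdim]

/-- The image is not known here to be closed. By Chevalley it contains a nonempty open piece of its
closure, and such a piece already has dimension `n`. -/
theorem le_topologicalKrullDim_image_pr2 [IsAlgClosed k] {n : ℕ} (hZ : IsProjVariety Z n)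
    (hfin : IsGenericallyFinitePr2 Z) : (n : WithBot ℕ∞) ≤ topologicalKrullDim ↥(pr2 '' Z) := by
  obtain ⟨hcl, hirr, hdim⟩ := hZ
  have hq := isZariskiQuotient_toProj (k := k) (N := N)
  have hq' := isZariskiQuotient_toGrassProj (k := k) (r := r) (N := N)
  obtain ⟨α, β, hne⟩ := exists_frameSlice_part_nonempty hirr.1
  have hpart := part_closure_image_pr2 hirr hne
  have hSirr := AffineSlice.isIrreducible_part hq' hirr hne
  obtain ⟨a, ha, hlift⟩ := exists_forall_exists_lift (AffineSlice.isClosed_part hq' hcl) hSirr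
    Sum.inr (b := 1) (by
      obtain ⟨x, hx⟩ := hne
      exact fun h => one_ne_zero ((map_one (eval x)).symm.trans
        (mem_vanishingIdeal_iff_eval.mp h x hx)))
  rw [← hpart] at ha hlift
  set T := (projSlice β).part (closure (pr2 '' Z)) with hT
  have hTirr : IsIrreducible T := hpart ▸ isIrreducible_closure_comp hSirr Sum.inr
  have hTcl : IsClosed T := AffineSlice.isClosed_part hq isClosed_closure
  have hneT : (T ∩ {x | eval x a ≠ 0}).Nonempty := exists_mem_eval_ne_zero ha
  have h1 := topologicalKrullDim_inter_open hTcl hTirr (isOpen_basic a) hneT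
  rw [affDim_part_closure_image_pr2 hcl hirr hne hfin,
    ← topologicalKrullDim_eq_affDim_frameSlice hcl hirr hne, hdim] at h1
  rw [← h1]
  have hmem : ∀ x : ↥(T ∩ {x | eval x a ≠ 0}),
      (projSlice β).param ⟨x.1, x.2.1.1⟩ ∈ pr2 '' Z := fun x => by
    obtain ⟨y, hy, hyx, -⟩ := hlift x.1 x.2.1 x.2.2
    obtain ⟨-, p, rfl, hpZ⟩ := id hy
    refine ⟨toGrassProj p, hpZ, ?_⟩
    have h2 := (projSlice β).e_toE ⟨x.1, x.2.1.1⟩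
    have h3 : (projSlice β).toE ⟨x.1, x.2.1.1⟩ = ⟨p.1.2, p.2.2⟩ :=
      hq.injective (h2.trans hyx.symm)
    rw [AffineSlice.param, h3]
    rfl
  let f : ↥(T ∩ {x | eval x a ≠ 0}) → ↥(pr2 '' Z) := fun x => ⟨_, hmem x⟩
  have hf : IsEmbedding f := by
    have h1 : IsEmbedding (Subtype.val ∘ f) := by
      have h2 : IsEmbedding fun x : ↥(T ∩ {x | eval x a ≠ 0}) =>
          (⟨x.1, x.2.1.1⟩ : (projSlice β).carrier) :=
        IsEmbedding.of_comp (continuous_induced_rng.mpr continuous_subtype_val)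
          continuous_subtype_val IsEmbedding.subtypeVal
      exact (AffineSlice.isOpenEmbedding_param hq).isEmbedding.comp h2
    exact IsEmbedding.of_comp (continuous_induced_rng.mpr h1.continuous) continuous_subtype_val h1
  exact hf.isInducing.topologicalKrullDim_le

/-- At a general point the variety is smooth and the differential of `pr₂` is injective. -/
theorem forGeneral_smooth [IsAlgClosed k] {n : ℕ} (hZ : IsProjVariety Z n) (hsep : IsSeparablePr2 Z)
    (hfin : IsGenericallyFinitePr2 Z) :
    ForGeneral Z fun z => z ∈ smoothPoints Z n ∧
      Module.finrank k (LinearMap.range (dpr2 Z z)) = n := by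
  obtain ⟨hcl, hirr, hdim⟩ := id hZ
  have hq' := isZariskiQuotient_toGrassProj (k := k) (r := r) (N := N)
  obtain ⟨α, β, hne⟩ := exists_frameSlice_part_nonempty hirr.1
  have hSirr := AffineSlice.isIrreducible_part hq' hirr hne
  obtain ⟨h, hh, hle⟩ := exists_forall_finrank_affineTangent_le hSirr
  have hn : affDim ((frameSlice α β).part Z) = n := by
    have := (topologicalKrullDim_eq_affDim_frameSlice hcl hirr hne).symm.trans hdim
    exact_mod_cast this
  have hgen : ForGeneral Z fun z => Module.finrank k (tangent Z z) ≤ n :=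
    ((frameSlice α β).forGeneral_iff hq' hirr hne).mpr ⟨h, hh, fun p hp hph => by
      rw [finrank_tangent hp, ← hn]
      exact hle _ hp hph⟩
  refine (hgen.and hirr hsep).mono fun z hz ⟨h1, h2⟩ => ?_
  -- This closes the chain `n ≤ rank d pr₂ ≤ dim T_z Z ≤ n`, giving both claims.
  have h3 : n ≤ Module.finrank k (LinearMap.range (dpr2 Z z)) := by
    have := le_topologicalKrullDim_image_pr2 hZ hfin
    rw [← h2] at this
    exact_mod_cast this
  have h4 := LinearMap.finrank_range_le (dpr2 Z z)
  exact ⟨⟨hz, by omega⟩, by omega⟩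

end Variety

/-! ### Comparison of `Z` with the graph of a Gauss map. -/

section GaussGraphs

variable {k : Type*} [Field k] {n N : ℕ} {Z : Set (GrassProj k (n + 1) N)}

theorem vecAt_mem_affineTangent {r : ℕ} {S : Set ((Fin r × Fin (N + 1)) ⊕ Fin (N + 1) → k)}
    {T : Set (Vec k N)} (h : ∀ x ∈ S, vecAt x ∈ T) {A : Fin r → Vec k N} {v : Vec k N}
    {w : (Fin r × Fin (N + 1)) ⊕ Fin (N + 1) → k} (hw : w ∈ affineTangent S (coords A v)) :
    vecAt w ∈ affineTangent T v := by
  have h1 := linearMap_mem_affineTangent (T := T) vecAt h hw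
  rwa [vecAt_coords] at h1

/-- Over a general point `v` of the cone over `pr₂ Z`, the tangent space of the cone is the sum of
the image of the tangent space of `Z` and the line of `v`; if the former is contained in the
subspace given by `Z`, the two agree. -/
theorem forGeneral_eq_embTangent [IsAlgClosed k] (hZ : IsProjVariety Z n)
    (hU : Z ⊆ universalFamily k (n + 1) N) (hsep : IsSeparablePr2 Z)
    (hfin : IsGenericallyFinitePr2 Z)
    (h : ForGeneral Z fun z => ∃ hz : z ∈ universalFamily k (n + 1) N,
      Phi Z z ∘ₗ tautIncl z hz = 0) :
    ForGeneral Z fun z => (pr1 z).1 = embTangent (closure (pr2 '' Z)) (pr2 z) := by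
  obtain ⟨hcl, hirr, hdim⟩ := id hZ
  have hq' := isZariskiQuotient_toGrassProj (k := k) (r := n + 1) (N := N)
  obtain ⟨α, β, hne⟩ := exists_frameSlice_part_nonempty hirr.1
  have hSirr := AffineSlice.isIrreducible_part hq' hirr hne
  have hpart := part_closure_image_pr2 hirr hne
  set X := closure (pr2 '' Z) with hX
  have hTirr : IsIrreducible ((projSlice β).part X) :=
    hpart ▸ isIrreducible_closure_comp hSirr Sum.inr
  obtain ⟨g, hg, hle⟩ := exists_forall_finrank_affineTangent_le hTirr
  have hn : affDim ((projSlice β).part X) = n := by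
    have := (topologicalKrullDim_eq_affDim_frameSlice hcl hirr hne).symm.trans hdim
    rw [affDim_part_closure_image_pr2 hcl hirr hne hfin]
    exact_mod_cast this
  have hg' : rename Sum.inr g ∉ vanishingIdeal k ((frameSlice α β).part Z) := by
    rwa [hpart, vanishingIdeal_closure_comp] at hg
  obtain ⟨g₁, hg₁, hgen⟩ := ((frameSlice α β).forGeneral_iff hq' hirr hne).mp
    ((forGeneral_smooth hZ hsep hfin).and hirr h)
  refine ((frameSlice α β).forGeneral_iff hq' hirr hne).mpr
    ⟨g₁ * rename Sum.inr g, fun hI => ?_, fun p hp hgp => ?_⟩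
  · exact ((isIrreducible_iff_isPrime_vanishingIdeal.mp hSirr).mem_or_mem hI).elim hg₁ hg'
  rw [map_mul] at hgp
  obtain ⟨⟨-, hrank⟩, hz, hPhi⟩ := hgen p hp (left_ne_zero_of_mul hgp)
  have hgv : eval p.1.2 g ≠ 0 := by
    have := right_ne_zero_of_mul hgp
    rwa [eval_rename] at this
  have hvT : p.1.2 ∈ (projSlice β).part X := by
    obtain ⟨h1, v, h2, h3⟩ := vecAt_mem_part hp
    exact ⟨h1, v, h2, subset_closure h3⟩
  have hTle : Module.finrank k (affineTangent ((projSlice β).part X) p.1.2) ≤ n :=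
    (hle _ hvT hgv).trans_eq hn
  have hvcone : p.1.2 ∈ cone X := part_projSlice_subset_cone _ hvT
  have hβ : β p.1.2 = 1 := hp.1.2
  set R := (affineTangent ((frameSlice α β).part Z) (coords p.1.1 p.1.2)).map vecAt with hR
  rw [finrank_range_dpr2 hp] at hrank
  have hRT : R ≤ affineTangent ((projSlice β).part X) p.1.2 := by
    rintro _ ⟨w, hw, rfl⟩
    refine vecAt_mem_affineTangent (fun x hx => ?_) hw
    rw [hpart]
    exact subset_closure ⟨x, hx, rfl⟩
  have hRW : R ≤ Submodule.span k (Set.range p.1.1) := by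
    rintro _ ⟨w, hw, rfl⟩
    exact (Phi_comp_tautIncl_eq_zero_iff hU hp hz).mp hPhi w hw
  have hvW : p.1.2 ∈ Submodule.span k (Set.range p.1.1) :=
    hz (by rw [line_pr2]; exact Submodule.mem_span_singleton_self _)
  -- On the slice `β` vanishes on velocities while `β v = 1`, so `R` misses the line.
  have hdisj : R ⊓ Submodule.span k {p.1.2} = ⊥ := by
    rw [eq_bot_iff]
    rintro _ ⟨⟨w, hw, rfl⟩, hu⟩
    exact eq_zero_of_mem_line hp (by rw [line_pr2]; exact hu) (dual_vecAt_eq_zero hw)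
  have hsup := Submodule.finrank_sup_add_finrank_inf_eq R (Submodule.span k {p.1.2})
  rw [hdisj, finrank_bot, add_zero, hrank, finrank_span_singleton p.2.2] at hsup
  have hW : Module.finrank k (Submodule.span k (Set.range p.1.1)) = n + 1 := by
    rw [finrank_span_eq_card p.2.1, Fintype.card_fin]
  have h1 : R ⊔ Submodule.span k {p.1.2} = Submodule.span k (Set.range p.1.1) := by
    refine Submodule.eq_of_le_of_finrank_eq (sup_le hRW ?_) (hsup.trans hW.symm)
    rwa [Submodule.span_singleton_le_iff_mem]
  have h2 : R ⊔ Submodule.span k {p.1.2} ≤ affineTangent (cone X) p.1.2 := by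
    refine sup_le (hRT.trans (affineTangent_mono (part_projSlice_subset_cone _) _)) ?_
    rw [Submodule.span_singleton_le_iff_mem]
    exact self_mem_affineTangent_cone hvcone
  -- At most `n` from the slice of `X` at a general point, plus one for the line of `v`.
  have h3 : Module.finrank k (affineTangent (cone X) p.1.2) ≤ n + 1 := by
    refine (Submodule.finrank_mono (affineTangent_cone_le hβ hvcone)).trans
      ((Submodule.finrank_add_le_finrank_add_finrank _ _).trans ?_)
    rw [finrank_span_singleton p.2.2]
    omega
  change Submodule.span k (Set.range p.1.1) = embTangent X (toProj ⟨p.1.2, p.2.2⟩)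
  rw [embTangent_toProj, ← h1]
  exact Submodule.eq_of_le_of_finrank_le h2 (h3.trans_eq hsup.symm)

theorem subset_gaussGraph (hirr : IsIrreducible Z) {X : Set (ProjSpace k N)}
    (hX : ∀ z ∈ Z, pr2 z ∈ X)
    (h : ForGeneral Z fun z => (pr1 z).1 = embTangent X (pr2 z)) : Z ⊆ gaussGraph X n := by
  refine subset_of_forGeneral hirr isClosed_closure (h.mono fun z hz hzE => subset_closure ?_)
  refine ⟨⟨pr2 z, hX z hz, ?_⟩, Prod.ext (Subtype.ext hzE.symm) rfl⟩
  rw [← hzE]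
  exact (pr1 z).2

/-- A closed set that contains the tangent spaces at general points contains the graph. -/
theorem gaussGraph_subset (hcl : IsClosed Z) (hirr : IsIrreducible Z)
    (h : ForGeneral Z fun z => (pr1 z).1 = embTangent (closure (pr2 '' Z)) (pr2 z)) :
    gaussGraph (closure (pr2 '' Z)) n ⊆ Z := by
  set X := closure (pr2 '' Z) with hX
  refine closure_minimal ?_ hcl
  rintro _ ⟨⟨x, hx, hxs⟩, rfl⟩
  obtain ⟨v, rfl⟩ := toProj_surjective x
  have hxs' := hxs
  rw [embTangent_toProj] at hxs'
  -- Near the smooth point `v` the Gauss map is given by the polynomial frame `B`, wherever the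
  -- tangent space has dimension `n + 1`.
  obtain ⟨g, B, hg, hB⟩ := exists_tangent_frame (cone X) v.1 hxs'
  have hspan := (hB v.1 hg).2.2 hxs'
  let q : Frame k (n + 1) N := ⟨(fun j i => eval v.1 (B j i), v.1), (hB v.1 hg).1, v.2⟩
  have hqeq : toGrassProj q = ((gaussMap X n ⟨toProj v, hx, hxs⟩, toProj v) :
      GrassProj k (n + 1) N) := by
    refine Prod.ext (Subtype.ext ?_) rfl
    change Submodule.span k _ = embTangent X (toProj v)
    rw [embTangent_toProj, hspan]
  change ((gaussMap X n ⟨toProj v, hx, hxs⟩, toProj v) : GrassProj k (n + 1) N) ∈ Z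
  rw [← hqeq]
  refine isZariskiQuotient_toGrassProj.mem_of_forall_vanishingIdeal hcl fun f hf => ?_
  rw [← frames_eq] at hf
  let F : MvPolynomial (Fin (N + 1)) k :=
    bind₁ (Sum.elim (fun ji => B ji.1 ji.2) MvPolynomial.X) f
  have hF : ∀ u : Vec k N, eval u F = eval (coords (fun j i => eval u (B j i)) u) f := fun u => by
    rw [eval, eval₂Hom_bind₁]
    congr 2
    funext i
    rcases i with i | i
    · rfl
    · exact eval_X i
  -- If `f` were nonzero at the frame over `v`, it would stay nonzero at the frames `B u` for nearby
  -- `u`. One such `u` lies under a general point of `Z`, where `B u` is a frame of `Z` and `f` must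
  -- vanish.
  by_contra hFq
  have hFv : eval v.1 (g * F) ≠ 0 := by
    rw [map_mul, hF]
    exact mul_ne_zero hg hFq
  obtain ⟨_, hO, z, hz, rfl⟩ := mem_closure_iff.mp hx _ (isOpen_image_toProj (g * F)) ⟨v, hFv, rfl⟩
  obtain ⟨U, hUo, hUne, hUE⟩ := h
  obtain ⟨z', hz', hzU, u, hu, huz⟩ := hirr.2 _ _ hUo
    ((isOpen_image_toProj (g * F)).preimage continuous_pr2) hUne ⟨z, hz, hO⟩
  have hE := hUE z' ⟨hz', hzU⟩
  have hu' : eval u.1 (g * F) ≠ 0 := hu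
  rw [map_mul] at hu'
  have hgu := left_ne_zero_of_mul hu'
  have hTu : embTangent X (pr2 z') = affineTangent (cone X) u.1 := by
    rw [← huz, embTangent_toProj]
  have hfr : Module.finrank k (affineTangent (cone X) u.1) = n + 1 := by
    rw [← hTu, ← hE]
    exact (pr1 z').2
  have hspanu := (hB u.1 hgu).2.2 hfr
  let q' : Frame k (n + 1) N := ⟨(fun j i => eval u.1 (B j i), u.1), (hB u.1 hgu).1, u.2⟩
  have hq' : toGrassProj q' = z' := by
    refine Prod.ext (Subtype.ext ?_) huz
    change Submodule.span k _ = (pr1 z').1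
    rw [hE, hTu, hspanu]
  refine right_ne_zero_of_mul hu' ?_
  rw [hF]
  exact mem_vanishingIdeal_iff_eval.mp hf _ ⟨q', by rw [hq']; exact hz', rfl⟩

/-- A general point of the graph of the Gauss map of `X` consists of a point of `X` and the embedded
tangent space at this point. -/
theorem forGeneral_eq_embTangent_of_gaussGraph {X : Set (ProjSpace k N)} (hX : IsClosed X)
    (hne : (gaussGraph X n).Nonempty) :
    (∀ z ∈ gaussGraph X n, pr2 z ∈ X) ∧
      ForGeneral (gaussGraph X n) fun z => (pr1 z).1 = embTangent X (pr2 z) := by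
  -- Only the inclusion is a closed condition; equality follows below where the tangent space has
  -- dimension at most `n + 1`.
  have hle : gaussGraph X n ⊆ {z | (pr1 z).1 ≤ embTangent X (pr2 z)} := by
    refine closure_minimal ?_ (isClosed_le_embTangent X)
    rintro _ ⟨x, rfl⟩
    exact le_refl (embTangent X x.1)
  refine ⟨?_, ?_⟩
  · refine closure_minimal ?_ (hX.preimage continuous_pr2)
    rintro _ ⟨x, rfl⟩
    exact x.2.1
  obtain ⟨_, ⟨x, hx, hxs⟩, rfl⟩ := closure_nonempty_iff.mp hne
  obtain ⟨v, rfl⟩ := toProj_surjective x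
  have hxs' := hxs
  rw [embTangent_toProj] at hxs'
  obtain ⟨g, B, hg, hB⟩ := exists_tangent_frame (cone X) v.1 hxs'
  refine ⟨pr2 ⁻¹' (toProj '' {u : Punctured k N | eval u.1 g ≠ 0}),
    (isOpen_image_toProj g).preimage continuous_pr2,
    ⟨_, subset_closure ⟨⟨toProj v, hx, hxs⟩, rfl⟩, v, hg, rfl⟩, ?_⟩
  rintro z ⟨hz, u, hu, huz⟩
  refine Submodule.eq_of_le_of_finrank_le (hle hz) ?_
  rw [← huz, embTangent_toProj, (pr1 z).2]
  refine (Submodule.finrank_mono (hB u.1 hu).2.1).trans_eq ?_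
  rw [finrank_span_eq_card (hB u.1 hu).1, Fintype.card_fin]

/-- Velocities of `v` are tangent to the cone over `X`, because frames over `Z` have their last
vector there; when that tangent space is `W`, the criterion for `Φ` applies. -/
theorem forGeneral_Phi_comp_tautIncl_eq_zero
    (hU : Z ⊆ universalFamily k (n + 1) N) {X : Set (ProjSpace k N)} (hX : ∀ z ∈ Z, pr2 z ∈ X)
    (h : ForGeneral Z fun z => (pr1 z).1 = embTangent X (pr2 z)) :
    ForGeneral Z fun z => ∃ hz : z ∈ universalFamily k (n + 1) N,
      Phi Z z ∘ₗ tautIncl z hz = 0 := by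
  refine h.mono fun z hz hE => ?_
  obtain ⟨α, β, p, rfl, hp⟩ := exists_mem_frameSlice z
  have hp' : coords p.1.1 p.1.2 ∈ (frameSlice α β).part Z := ⟨hp, p, rfl, hz⟩
  refine ⟨hU hz, (Phi_comp_tautIncl_eq_zero_iff hU hp' (hU hz)).mpr fun w hw => ?_⟩
  change Submodule.span k (Set.range p.1.1) = embTangent X (toProj ⟨p.1.2, p.2.2⟩) at hE
  rw [hE, embTangent_toProj]
  refine vecAt_mem_affineTangent (fun x hx => ?_) hw
  obtain ⟨-, q, rfl, hq⟩ := hx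
  exact mem_cone_iff (v := ⟨q.1.2, q.2.2⟩).mpr (hX _ hq)

end GaussGraphs

/-! ### Membership in a varying subspace as a polynomial condition. -/

section Residual

variable {k : Type*} [Field k] {r N : ℕ} (α : Fin r → Module.Dual k (Vec k N))

/-- The difference of a polynomial vector `u` and its projection `∑ l, α l u • A l` to the subspace
spanned by a frame. -/
noncomputable def residual (u : Fin (N + 1) → MvPolynomial ((Fin r × Fin (N + 1)) ⊕ Fin (N + 1)) k)
    (c : Fin (N + 1)) : MvPolynomial ((Fin r × Fin (N + 1)) ⊕ Fin (N + 1)) k :=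
  u c - ∑ l, (∑ a, C (α l (Pi.single a 1)) * u a) * X (Sum.inl (l, c))

theorem eval_residual (u : Fin (N + 1) → MvPolynomial ((Fin r × Fin (N + 1)) ⊕ Fin (N + 1)) k)
    (c : Fin (N + 1)) (x : (Fin r × Fin (N + 1)) ⊕ Fin (N + 1) → k) :
    eval x (residual α u c) =
      eval x (u c) - ∑ l, α l (fun a => eval x (u a)) * rowAt l x c := by
  have h : ∀ l, eval x (∑ a, C (α l (Pi.single a 1)) * u a) = α l fun a => eval x (u a) :=
    fun l => by
      rw [dual_apply_eq_sum]
      simp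
  simp only [residual, map_sub, map_sum (eval x) _ Finset.univ, map_mul, eval_X]
  congr 1
  refine Finset.sum_congr rfl fun l _ => ?_
  rw [← h, map_sum]
  simp only [map_mul]
  rfl

variable {α}

theorem mem_span_iff_forall_sub_eq_zero {A : Fin r → Vec k N}
    (hα : ∀ i j, α j (A i) = if i = j then 1 else 0) {u : Vec k N} :
    u ∈ Submodule.span k (Set.range A) ↔ ∀ c, u c - ∑ l, α l u * A l c = 0 := by
  have h : (∀ c, u c - ∑ l, α l u * A l c = 0) ↔ u = ∑ l, α l u • A l := by
    rw [funext_iff]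
    refine forall_congr' fun c => ?_
    rw [sub_eq_zero, Finset.sum_apply]
    rfl
  rw [h]
  refine ⟨eq_sum_of_mem_span hα, fun h => ?_⟩
  rw [h]
  exact Submodule.sum_mem _ fun l _ => Submodule.smul_mem _ _ (Submodule.subset_span ⟨l, rfl⟩)

theorem sum_sub_mul_eq (a : Fin r → k) (u A : Fin r → Vec k N) (c : Fin (N + 1)) :
    ∑ i, (u i c - ∑ l, α l (u i) * A l c) * a i =
      (∑ i, a i • u i) c - ∑ l, α l (∑ i, a i • u i) * A l c := by
  simp only [sub_mul, Finset.sum_sub_distrib]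
  congr 1
  · simp [Finset.sum_apply, mul_comm]
  · simp only [map_sum, map_smul, smul_eq_mul, Finset.sum_mul]
    rw [Finset.sum_comm]
    exact Finset.sum_congr rfl fun l _ => Finset.sum_congr rfl fun i _ => by ring

end Residual

/-! ### The shrinking map and its domain. -/

section Shrinking

variable {k : Type*} [Field k] {r n N : ℕ} {Z : Set (GrassProj k r N)}

theorem line_le_map_ker_Phi_iff {z : GrassProj k r N} (hz : z ∈ universalFamily k r N) :
    (pr2 z).line ≤ (LinearMap.ker (Phi Z z)).map (pr1 z).1.subtype ↔
      Phi Z z ∘ₗ tautIncl z hz = 0 := by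
  constructor
  · intro h
    refine LinearMap.ext fun u => ?_
    obtain ⟨a, ha, hau⟩ := h u.2
    have h1 : tautIncl z hz u = a := Subtype.ext hau.symm
    rw [LinearMap.comp_apply, h1]
    exact ha
  · intro h u hu
    exact ⟨⟨u, hz hu⟩, LinearMap.congr_fun h ⟨u, hu⟩, rfl⟩

theorem range_shrinkingMap_subset_iff (hU : Z ⊆ universalFamily k r N) :
    Set.range (fun z : shrinkDomain Z n =>
        ((shrinkingMap Z n z, pr2 z.1) : GrassProj k (shrinkRank Z) N)) ⊆
        universalFamily k (shrinkRank Z) N ↔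
      ∀ z ∈ shrinkDomain Z n, ∃ hz : z ∈ universalFamily k r N,
        Phi Z z ∘ₗ tautIncl z hz = 0 := by
  constructor
  · intro h z hz
    have hzU := hU hz.1.1
    exact ⟨hzU, (line_le_map_ker_Phi_iff hzU).mp (h ⟨⟨z, hz⟩, rfl⟩)⟩
  · rintro h _ ⟨⟨z, hz⟩, rfl⟩
    obtain ⟨hzU, h0⟩ := h z hz
    exact (line_le_map_ker_Phi_iff hzU).mpr h0

/-- If `Φ` vanishes on the tautological line at a general point, then it does so at each smooth
point. -/
theorem Phi_comp_tautIncl_eq_zero_of_smooth (hirr : IsIrreducible Z)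
    (hU : Z ⊆ universalFamily k r N)
    (h : ForGeneral Z fun z => z ∈ smoothPoints Z n ∧ ∃ hz : z ∈ universalFamily k r N,
      Phi Z z ∘ₗ tautIncl z hz = 0) {z : GrassProj k r N} (hz : z ∈ smoothPoints Z n) :
    Phi Z z ∘ₗ tautIncl z (hU hz.1) = 0 := by
  have hq' := isZariskiQuotient_toGrassProj (k := k) (r := r) (N := N)
  obtain ⟨α, β, p, rfl, hpc⟩ := exists_mem_frameSlice z
  have hp : coords p.1.1 p.1.2 ∈ (frameSlice α β).part Z := ⟨hpc, p, rfl, hz.1⟩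
  have hprime := isIrreducible_iff_isPrime_vanishingIdeal.mp
    (AffineSlice.isIrreducible_part hq' hirr ⟨_, hp⟩)
  obtain ⟨g, hg, hgen⟩ := ((frameSlice α β).forGeneral_iff hq' hirr ⟨_, hp⟩).mp h
  have hdim := hz.2
  rw [finrank_tangent hp] at hdim
  obtain ⟨f, B, hf, hB⟩ := exists_tangent_frame _ _ hdim
  -- The residual says whether the last vector of a tangent frame vector lies in `W`. It vanishes at
  -- smooth points with `f, g ≠ 0`; primality cancels the generic factor `g`, and `f` is nonzero at
  -- the given point.
  have hvan : ∀ j c, f * residual α (fun a => B j (Sum.inr a)) c ∈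
      vanishingIdeal k ((frameSlice α β).part Z) := fun j c => by
    refine (hprime.mem_or_mem (x := g) ?_).resolve_left hg
    rw [mem_vanishingIdeal_iff_eval]
    rintro x hx
    obtain ⟨hxc, q, rfl, hq⟩ := id hx
    by_contra hne
    rw [map_mul, map_mul] at hne
    obtain ⟨hqs, hqU, hqPhi⟩ := hgen q hx (left_ne_zero_of_mul hne)
    have hqf := left_ne_zero_of_mul (right_ne_zero_of_mul hne)
    refine right_ne_zero_of_mul (right_ne_zero_of_mul hne) ?_
    have hqdim := hqs.2
    rw [finrank_tangent hx] at hqdim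
    have h1 := (Phi_comp_tautIncl_eq_zero_iff hU hx hqU).mp hqPhi
      (fun i => eval (coords q.1.1 q.1.2) (B j i)) (by
        rw [(hB _ hqf).2.2 hqdim]
        exact Submodule.subset_span ⟨j, rfl⟩)
    rw [eval_residual]
    exact (mem_span_iff_forall_sub_eq_zero (A := q.1.1) hxc.1).mp h1 c
  rw [Phi_comp_tautIncl_eq_zero_iff hU hp]
  rw [(hB _ hf).2.2 hdim]
  intro w hw
  have hle : Submodule.span k (Set.range fun j i => eval (coords p.1.1 p.1.2) (B j i)) ≤
      (Submodule.span k (Set.range p.1.1)).comap vecAt := by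
    rw [Submodule.span_le]
    rintro _ ⟨j, rfl⟩
    refine (mem_span_iff_forall_sub_eq_zero (A := p.1.1) hpc.1).mpr fun c => ?_
    have h1 := mem_vanishingIdeal_iff_eval.mp (hvan j c) _ hp
    rw [map_mul, eval_residual] at h1
    exact (mul_eq_zero.mp h1).resolve_left hf
  exact hle hw

/-- The dimension of the kernel of `Φ` is constant at general points. -/
theorem exists_forGeneral_finrank_ker_Phi_eq (hirr : IsIrreducible Z)
    (h : ForGeneral Z fun z => z ∈ smoothPoints Z n) :
    ∃ m, ForGeneral Z fun z => Module.finrank k (LinearMap.ker (Phi Z z)) = m := by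
  have hq' := isZariskiQuotient_toGrassProj (k := k) (r := r) (N := N)
  obtain ⟨α, β, hne⟩ := exists_frameSlice_part_nonempty hirr.1
  have hprime := isIrreducible_iff_isPrime_vanishingIdeal.mp
    (AffineSlice.isIrreducible_part hq' hirr hne)
  obtain ⟨g, hg, hgen⟩ := ((frameSlice α β).forGeneral_iff hq' hirr hne).mp h
  obtain ⟨x, hx, hgx⟩ := exists_mem_eval_ne_zero hg
  obtain ⟨-, p, rfl, hpZ⟩ := id hx
  have hdim := (hgen p hx hgx).2
  rw [finrank_tangent hx] at hdim
  obtain ⟨f, B, hf, hB⟩ := exists_tangent_frame _ _ hdim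
  -- In the coordinates `a` of a vector `∑ a i • A i` of `W`, the kernel of `Φ` is cut out by the
  -- residuals of `∑ a i • A i'`, with `A'` running through the tangent frame; these are linear in
  -- `a` with polynomial coefficients.
  let L : Set (Fin r → MvPolynomial ((Fin r × Fin (N + 1)) ⊕ Fin (N + 1)) k) :=
    Set.range fun jc : Fin n × Fin (N + 1) => fun i =>
      residual α (fun a => B jc.1 (Sum.inl (i, a))) jc.2
  obtain ⟨m, f', hf', hm⟩ := exists_forall_finrank_kernelAt_eq L hne
  have hfI : f ∉ vanishingIdeal k ((frameSlice α β).part Z) := fun hI =>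
    hf (mem_vanishingIdeal_iff_eval.mp hI _ hx)
  refine ⟨m, ((frameSlice α β).forGeneral_iff hq' hirr hne).mpr ⟨g * (f * f'), fun hI =>
    (hprime.mem_or_mem hI).elim hg fun hI => (hprime.mem_or_mem hI).elim hfI hf',
    fun q hq hqne => ?_⟩⟩
  rw [map_mul, map_mul] at hqne
  have hqdim := (hgen q hq (left_ne_zero_of_mul hqne)).2
  rw [finrank_tangent hq] at hqdim
  have hqf := left_ne_zero_of_mul (right_ne_zero_of_mul hqne)
  rw [← hm _ hq (right_ne_zero_of_mul (right_ne_zero_of_mul hqne))]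
  refine finrank_ker_Phi hq _ fun a => ?_
  rw [(hB _ hqf).2.2 hqdim, mem_kernelAt]
  let M : ((Fin r × Fin (N + 1)) ⊕ Fin (N + 1) → k) →ₗ[k] Vec k N := ∑ i, a i • rowAt i
  have hM : ∀ w, M w = ∑ i, a i • rowAt i w := fun w => by
    simp [M, LinearMap.sum_apply]
  have h1 : (∀ w ∈ Submodule.span k
      (Set.range fun j i => eval (coords q.1.1 q.1.2) (B j i)),
        ∑ i, a i • rowAt i w ∈ (pr1 (toGrassProj q)).1) ↔
      Submodule.span k (Set.range fun j i => eval (coords q.1.1 q.1.2) (B j i)) ≤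
        (Submodule.span k (Set.range q.1.1)).comap M := by
    refine forall₂_congr fun w _ => ?_
    rw [Submodule.mem_comap, hM]
    rfl
  rw [h1, Submodule.span_le, Set.range_subset_iff, Set.forall_mem_range, Prod.forall]
  refine forall_congr' fun j => ?_
  rw [SetLike.mem_coe, Submodule.mem_comap, mem_span_iff_forall_sub_eq_zero (A := q.1.1) hq.1.1]
  refine forall_congr' fun c => ?_
  simp only [eval_residual]
  rw [hM, ← sum_sub_mul_eq]
  rfl

/-- A generic kernel dimension exists, so the infimum defining `shrinkRank` is over a nonempty set
and is attained, not the default value `0`. -/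
theorem forGeneral_mem_shrinkDomain (hirr : IsIrreducible Z)
    (h : ForGeneral Z fun z => z ∈ smoothPoints Z n) :
    ForGeneral Z fun z => z ∈ shrinkDomain Z n :=
  h.and hirr (Nat.sInf_mem (exists_forGeneral_finrank_ker_Phi_eq hirr h))

end Shrinking

end GaussGraph

end

theorem mainTheorem4 {k : Type*} [Field k] [IsAlgClosed k] (n N : ℕ)
    (X' : Set (GaussGraph.GrassProj k (n + 1) N))
    (hX' : GaussGraph.IsProjVariety X' n)
    (hU : X' ⊆ GaussGraph.universalFamily k (n + 1) N)
    (hsep : GaussGraph.IsSeparablePr2 X')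
    (hfin : GaussGraph.IsGenericallyFinitePr2 X') :
    List.TFAE [
      ∃ X : Set (GaussGraph.ProjSpace k N),
        GaussGraph.IsProjVariety X n ∧ X' = GaussGraph.gaussGraph X n,
      GaussGraph.ForGeneral X' fun z => z ∈ GaussGraph.smoothPoints X' n ∧
        ∃ hz : z ∈ GaussGraph.universalFamily k (n + 1) N,
          GaussGraph.Phi X' z ∘ₗ GaussGraph.tautIncl z hz = 0,
      Set.range (fun z : GaussGraph.shrinkDomain X' n =>
          ((GaussGraph.shrinkingMap X' n z, GaussGraph.pr2 z.1) :
            GaussGraph.GrassProj k (GaussGraph.shrinkRank X') N)) ⊆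
        GaussGraph.universalFamily k (GaussGraph.shrinkRank X') N] := by
  have hirr := hX'.2.1
  -- Smoothness at a general point comes from the hypotheses on `pr₂`: its differential already has
  -- rank `n` there.
  have hsmooth : GaussGraph.ForGeneral X' fun z => z ∈ GaussGraph.smoothPoints X' n :=
    (GaussGraph.forGeneral_smooth hX' hsep hfin).mono fun z _ h => h.1
  have hiff := GaussGraph.range_shrinkingMap_subset_iff (n := n) hU
  tfae_have 1 → 2 := by
    rintro ⟨X, hX, rfl⟩
    obtain ⟨h1, h2⟩ := GaussGraph.forGeneral_eq_embTangent_of_gaussGraph hX.1 hirr.1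
    exact hsmooth.and hirr (GaussGraph.forGeneral_Phi_comp_tautIncl_eq_zero hU h1 h2)
  tfae_have 2 → 1 := fun h => by
    have hE := GaussGraph.forGeneral_eq_embTangent hX' hU hsep hfin (h.mono fun z _ hz => hz.2)
    -- The variety `X` is the closure of `pr₂ X'`.
    exact ⟨_, GaussGraph.isProjVariety_closure_image_pr2 hX' hfin, subset_antisymm
      (GaussGraph.subset_gaussGraph hirr (fun z hz => subset_closure ⟨z, hz, rfl⟩) hE)
      (GaussGraph.gaussGraph_subset hX'.1 hirr hE)⟩
  tfae_have 2 → 3 := fun h => hiff.mpr fun z hz =>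
    ⟨hU hz.1.1, GaussGraph.Phi_comp_tautIncl_eq_zero_of_smooth hirr hU h hz.1⟩
  tfae_have 3 → 2 := fun h =>
    (GaussGraph.forGeneral_mem_shrinkDomain hirr hsmooth).mono fun z _ hz =>
    ⟨hz.1, hiff.mp h z hz⟩
  tfae_finish
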